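/- Let $B$ be a finite set of Boolean functions of finite arity (arity $0$ allowed). An $n$-ary Boolean function $f$ is an OR-function if it is constant or $f(x_1,\dots,x_n)=x_{r_1}\vee\dots\vee x_{r_m}$ for some subset $\{x_{r_1},\dots,x_{r_m}\}$ of its arguments; it is an AND-function if it is constant or $f(x_1,\dots,x_n)=x_{r_1}\wedge\dots\wedge x_{r_m}$ for such a subset; it is an XOR-function if $f(x_1,\dots,x_n)=c\oplus x_{r_1}\oplus\dots\oplus x_{r_m}$ for a constant $c\in\{0,1\}$ and such a (possibly empty) subset. A $B$-formula is a variable, or $f(\varphi_1,\dots,\varphi_n)$ with $f\in B$ $n$-ary and $\varphi_1,\dots,\varphi_n$ $B$-formulas; a $B$-circuit is an acyclic circuit whose gates compute functions from $B$, each input of a gate being a variable or another gate, and whose output is a gate or a variable. Two formulas (circuits) are equivalent if they have the same value under every assignment. Let $\mathrm{size}_l$ be the number of occurrences of variables (in a circuit: the number of times a variable is used as an input of a gate or as the output), and $\mathrm{size}_s$ the number of occurrences of function symbols (in a circuit: the number of non-input gates). For $\mathrm{size}\in\{\mathrm{size}_l,\mathrm{size}_s\}$, the minimum equivalent expression problem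 is: given a $B$-formula (respectively $B$-circuit) $\varphi$ and a natural number $k$, is there a $B$-formula (respectively $B$-circuit) $\psi$ with $\mathrm{size}(\psi)\le k$ that is equivalent to $\varphi$? Theorem. If $B$ contains only OR-functions, only AND-functions, or only XOR-functions, then all four of these problems $\mathrm{MEE}(B)$ (formulas or circuits, $\mathrm{size}_l$ or $\mathrm{size}_s$) can be solved in polynomial time. -/

import Mathlib

/-- A Boolean function of finite arity (arity `0` allowed). -/
abbrev BoolFun : Type := Σ n : ℕ, ((Fin n → Bool) → Bool)

namespace BoolFun

/-- The arity of a Boolean function. -/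
abbrev arity (f : BoolFun) : ℕ := f.1

/-- OR-functions: constants, and disjunctions of a subset of the arguments. -/
def IsOr (f : BoolFun) : Prop :=
  (∃ c : Bool, ∀ x, f.2 x = c) ∨
    ∃ S : Finset (Fin f.arity), ∀ x, f.2 x = true ↔ ∃ i ∈ S, x i = true

/-- AND-functions: constants, and conjunctions of a subset of the arguments. -/
def IsAnd (f : BoolFun) : Prop :=
  (∃ c : Bool, ∀ x, f.2 x = c) ∨
    ∃ S : Finset (Fin f.arity), ∀ x, f.2 x = true ↔ ∀ i ∈ S, x i = true

/-- XOR-functions: `c ⊕ x_{r₁} ⊕ ⋯ ⊕ x_{rₘ}`, for a constant `c` and a subset of the arguments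
(the empty subset gives the constants). -/
def IsXor (f : BoolFun) : Prop :=
  ∃ (c : Bool) (S : Finset (Fin f.arity)),
    ∀ x, f.2 x = xor c (decide (Odd (S.filter (fun i => x i = true)).card))

end BoolFun

/-- `B`-formulas over the variables `x₀, x₁, x₂, …`. -/
inductive BFormula (B : Finset BoolFun) : Type
  | var (x : ℕ) : BFormula B
  | app (f : {f : BoolFun // f ∈ B}) (args : Fin f.1.arity → BFormula B) : BFormula B

namespace BFormula

variable {B : Finset BoolFun}

/-- The value of a formula under an assignment. -/
def eval (α : ℕ → Bool) : BFormula B → Bool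
  | var x => α x
  | app f args => f.1.2 (fun i => (args i).eval α)

/-- The number of occurrences of variables. -/
def sizeL : BFormula B → ℕ
  | var _ => 1
  | app _ args => ∑ i, (args i).sizeL

/-- The number of occurrences of function symbols. -/
def sizeS : BFormula B → ℕ
  | var _ => 0
  | app _ args => 1 + ∑ i, (args i).sizeS

end BFormula

/-- What can feed an input of a gate when `m` gates are available: a variable, or one of these
gates. -/
inductive Wire (m : ℕ) : Type
  | var (x : ℕ) : Wire m
  | gate (j : Fin m) : Wire m

namespace Wire

variable {m : ℕ}

/-- The value of a wire, given an assignment and the values of the available gates. -/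
def eval (α : ℕ → Bool) (v : Fin m → Bool) : Wire m → Bool
  | var x => α x
  | gate j => v j

/-- `1` if the wire is an occurrence of a variable, and `0` otherwise. -/
def varCount : Wire m → ℕ
  | var _ => 1
  | gate _ => 0

end Wire

/-- The `m` gates of a circuit over `B`, in topological order: every input of a gate is a variable
or an earlier gate. Gates may be used any number of times. -/
inductive GateSeq (B : Finset BoolFun) : ℕ → Type
  | nil : GateSeq B 0
  | snoc {m : ℕ} (G : GateSeq B m) (f : {f : BoolFun // f ∈ B})
      (args : Fin f.1.arity → Wire m) : GateSeq B (m + 1)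

namespace GateSeq

variable {B : Finset BoolFun}

/-- The values of all gates under an assignment. -/
def eval (α : ℕ → Bool) : {m : ℕ} → GateSeq B m → Fin m → Bool
  | _, nil => Fin.elim0
  | _, snoc G f args =>
      Fin.snoc (α := fun _ => Bool) (G.eval α) (f.1.2 (fun i => (args i).eval α (G.eval α)))

/-- The number of occurrences of variables as inputs of gates. -/
def varCount : {m : ℕ} → GateSeq B m → ℕ
  | _, nil => 0
  | _, snoc G _ args => G.varCount + ∑ i, (args i).varCount

end GateSeq

/-- `B`-circuits: acyclic circuits with gates from `B` and a designated output, which is a gate or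
a variable. -/
structure BCircuit (B : Finset BoolFun) : Type where
  /-- the number of gates -/
  m : ℕ
  /-- the gates -/
  gates : GateSeq B m
  /-- the output -/
  out : Wire m

namespace BCircuit

variable {B : Finset BoolFun}

/-- The value of a circuit under an assignment. -/
def eval (α : ℕ → Bool) (C : BCircuit B) : Bool :=
  C.out.eval α (C.gates.eval α)

/-- The number of occurrences of variables: as an input of a gate, or as the output. -/
def sizeL (C : BCircuit B) : ℕ :=
  C.gates.varCount + C.out.varCount

/-- The number of (non-input) gates. -/
def sizeS (C : BCircuit B) : ℕ := C.m

end BCircuit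

/-- The input alphabet: one letter for each function in `B`, two bits, and three markers. -/
inductive Letter (B : Finset BoolFun) : Type
  | fn (f : {f : BoolFun // f ∈ B}) : Letter B
  | bit (b : Bool) : Letter B
  | var : Letter B
  | gate : Letter B
  | sep : Letter B

/-- A natural number in binary (least significant bit first), followed by an end marker. -/
def encodeNumber (B : Finset BoolFun) (n : ℕ) : List (Letter B) :=
  (Computability.encodeNat n).map Letter.bit ++ [Letter.sep]

/-- Formulas in prefix notation, the index of a variable being written in binary. -/
def BFormula.encode {B : Finset BoolFun} : BFormula B → List (Letter B)
  | .var x => Letter.var :: encodeNumber B x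
  | .app f args => Letter.fn f :: (List.ofFn (fun i => (args i).encode)).flatten

/-- Wires, as a variable or a gate with its number in binary. -/
def Wire.encode (B : Finset BoolFun) {m : ℕ} : Wire m → List (Letter B)
  | .var x => Letter.var :: encodeNumber B x
  | .gate j => Letter.gate :: encodeNumber B (j : ℕ)

/-- The list of the gates, each with the list of its inputs. -/
def GateSeq.encode {B : Finset BoolFun} : {m : ℕ} → GateSeq B m → List (Letter B)
  | _, .nil => []
  | _, .snoc G f args =>
      G.encode ++ Letter.fn f :: (List.ofFn (fun i => (args i).encode B)).flatten

/-- The gates, followed by the output. -/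
def BCircuit.encode {B : Finset BoolFun} (C : BCircuit B) : List (Letter B) :=
  C.gates.encode ++ C.out.encode B

/-- Instances `(φ, k)`, with `k` in binary, where `φ` is a formula. -/
def encodeFormulaInstance {B : Finset BoolFun} (p : BFormula B × ℕ) : List (Letter B) :=
  encodeNumber B p.2 ++ p.1.encode

/-- Instances `(φ, k)`, with `k` in binary, where `φ` is a circuit. -/
def encodeCircuitInstance {B : Finset BoolFun} (p : BCircuit B × ℕ) : List (Letter B) :=
  encodeNumber B p.2 ++ p.1.encode

/-- The positive instances `(φ, k)` of the minimization problem for `B`-formulas: some `B`-formula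
of size at most `k` is equivalent to `φ`. -/
def MEEFormula {B : Finset BoolFun} (size : BFormula B → ℕ) (p : BFormula B × ℕ) : Prop :=
  ∃ ψ : BFormula B, size ψ ≤ p.2 ∧ ∀ α : ℕ → Bool, p.1.eval α = ψ.eval α

/-- The positive instances `(φ, k)` of the minimization problem for `B`-circuits: some `B`-circuit
of size at most `k` is equivalent to `φ`. -/
def MEECircuit {B : Finset BoolFun} (size : BCircuit B → ℕ) (p : BCircuit B × ℕ) : Prop :=
  ∃ ψ : BCircuit B, size ψ ≤ p.2 ∧ ∀ α : ℕ → Bool, p.1.eval α = ψ.eval α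

/-- The problem `P`, with instances given by `enc` as words over a finite alphabet, is solved by a
Turing machine in time polynomial in the length of the word. -/
def SolvableInPolyTime {ι Γ : Type} (enc : ι → List Γ) (P : ι → Prop) : Prop :=
  ∃ answer : ι → Bool, (∀ a, answer a = true ↔ P a) ∧
    Nonempty (Turing.TM2ComputableInPolyTime enc Computability.encodeBool answer)

/-- First step of the proof that the encodings are injective: an instance can be recovered
from its word. -/
theorem encodeNumber_append_inj {B : Finset BoolFun} {a b : ℕ} {r s : List (Letter B)}
    (h : encodeNumber B a ++ r = encodeNumber B b ++ s) : a = b ∧ r = s := by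
  have key : ∀ u v : List Bool,
      u.map Letter.bit ++ [Letter.sep] ++ r = v.map Letter.bit ++ [Letter.sep] ++ s →
      u = v ∧ r = s := by
    intro u
    induction u with
    | nil => intro v hv; cases v <;> simp_all
    | cons c u ih =>
      intro v hv
      cases v with
      | nil => simp at hv
      | cons d v =>
        simp only [List.map_cons, List.cons_append, List.cons.injEq, Letter.bit.injEq] at hv
        obtain ⟨h1, h2⟩ := ih v hv.2
        exact ⟨by rw [hv.1, h1], h2⟩
  obtain ⟨h1, h2⟩ := key _ _ h
  exact ⟨by rw [← Computability.decode_encodeNat a, h1, Computability.decode_encodeNat], h2⟩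

theorem flatten_ofFn_append_inj {β γ : Type} (P : β → Prop) (e : β → List γ)
    (he : ∀ a, P a → ∀ b (r s : List γ), e a ++ r = e b ++ s → a = b ∧ r = s) :
    ∀ {n : ℕ} (a b : Fin n → β) (r s : List γ), (∀ i, P (a i)) →
      (List.ofFn (fun i => e (a i))).flatten ++ r = (List.ofFn (fun i => e (b i))).flatten ++ s →
      a = b ∧ r = s := by
  intro n
  induction n with
  | zero => intro a b r s _ h; exact ⟨Subsingleton.elim _ _, by simpa using h⟩
  | succ n ih =>
    intro a b r s hP h
    simp only [List.ofFn_succ, List.flatten_cons, List.append_assoc] at h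
    obtain ⟨h0, h⟩ := he _ (hP 0) _ _ _ h
    obtain ⟨h1, h⟩ := ih (fun i => a i.succ) (fun i => b i.succ) r s (fun i => hP _) h
    refine ⟨funext fun i => ?_, h⟩
    cases i using Fin.cases with
    | zero => exact h0
    | succ i => exact congrFun h1 i

theorem BFormula.encode_append_inj {B : Finset BoolFun} (φ : BFormula B) :
    ∀ (ψ : BFormula B) (r s : List (Letter B)), φ.encode ++ r = ψ.encode ++ s →
      φ = ψ ∧ r = s := by
  induction φ with
  | var x =>
    intro ψ r s h
    cases ψ with
    | var y =>
      simp only [encode, List.cons_append, List.cons.injEq, true_and] at h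
      obtain ⟨rfl, h'⟩ := encodeNumber_append_inj h
      exact ⟨rfl, h'⟩
    | app g b => simp [encode] at h
  | app f a ih =>
    intro ψ r s h
    cases ψ with
    | var y => simp [encode] at h
    | app g b =>
      simp only [encode, List.cons_append, List.cons.injEq, Letter.fn.injEq] at h
      obtain ⟨rfl, h⟩ := h
      obtain ⟨rfl, h'⟩ := flatten_ofFn_append_inj
        (fun φ => ∀ (ψ : BFormula B) (r s : List (Letter B)), φ.encode ++ r = ψ.encode ++ s →
          φ = ψ ∧ r = s) BFormula.encode (fun a ha => ha) a b r s ih h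
      exact ⟨rfl, h'⟩

theorem encodeFormulaInstance_injective {B : Finset BoolFun} :
    Function.Injective (encodeFormulaInstance (B := B)) := by
  rintro ⟨φ, k⟩ ⟨ψ, l⟩ h
  obtain ⟨rfl, h⟩ := encodeNumber_append_inj h
  obtain ⟨rfl, -⟩ := BFormula.encode_append_inj φ ψ [] [] (by simpa using h)
  rfl

/-- A wire with the bound on gate numbers forgotten, in a uniform type. -/
def Wire.raw {m : ℕ} : Wire m → ℕ ⊕ ℕ
  | .var x => .inl x
  | .gate j => .inr j

theorem Wire.raw_injective {m : ℕ} : Function.Injective (Wire.raw (m := m)) := by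
  intro u v h
  cases u <;> cases v <;> simp_all [raw, Fin.ext_iff]

/-- The list of the gates of a circuit, in a uniform type. -/
def GateSeq.raw {B : Finset BoolFun} : {m : ℕ} → GateSeq B m →
    List (Σ f : {f : BoolFun // f ∈ B}, (Fin f.1.arity → ℕ ⊕ ℕ))
  | _, .nil => []
  | _, .snoc G f args => G.raw ++ [⟨f, fun i => (args i).raw⟩]

/-- The word of a wire, read off from its uniform version. -/
def encodeRaw (B : Finset BoolFun) : ℕ ⊕ ℕ → List (Letter B)
  | .inl x => Letter.var :: encodeNumber B x
  | .inr j => Letter.gate :: encodeNumber B j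

theorem Wire.encode_eq (B : Finset BoolFun) {m : ℕ} (w : Wire m) :
    w.encode B = encodeRaw B w.raw := by
  cases w <;> rfl

theorem encodeRaw_append_inj {B : Finset BoolFun} (u v : ℕ ⊕ ℕ)
    (r s : List (Letter B)) (h : encodeRaw B u ++ r = encodeRaw B v ++ s) : u = v ∧ r = s := by
  cases u <;> cases v <;>
    simp only [encodeRaw, List.cons_append, List.cons.injEq, reduceCtorEq, false_and,
      true_and] at h
  all_goals
    obtain ⟨h1, h2⟩ := encodeNumber_append_inj h
    exact ⟨by rw [h1], h2⟩

theorem GateSeq.encode_eq {B : Finset BoolFun} {m : ℕ} (G : GateSeq B m) :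
    G.encode = G.raw.flatMap fun g =>
      Letter.fn g.1 :: (List.ofFn (fun i => encodeRaw B (g.2 i))).flatten := by
  induction G with
  | nil => rfl
  | snoc G f args ih => simp [encode, raw, ih, Wire.encode_eq]

theorem GateSeq.length_raw {B : Finset BoolFun} {m : ℕ} (G : GateSeq B m) :
    G.raw.length = m := by
  induction G with
  | nil => rfl
  | snoc G f args ih => simp [raw, ih]

theorem GateSeq.raw_injective {B : Finset BoolFun} {m : ℕ} :
    Function.Injective (GateSeq.raw (B := B) (m := m)) := by
  intro G H h
  induction G with
  | nil => cases H; rfl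
  | snoc G f a ih =>
    cases H with
    | snoc H g b =>
      obtain ⟨h1, h2⟩ := List.append_inj h (by rw [length_raw, length_raw])
      obtain rfl := ih h1
      simp only [List.cons.injEq, Sigma.mk.injEq, and_true] at h2
      obtain ⟨rfl, h2⟩ := h2
      have hab : a = b := funext fun i => Wire.raw_injective (congrFun (eq_of_heq h2) i)
      rw [hab]

theorem encodeCircuitInstance_injective {B : Finset BoolFun} :
    Function.Injective (encodeCircuitInstance (B := B)) := by
  rintro ⟨⟨m, G, u⟩, k⟩ ⟨⟨n, H, v⟩, l⟩ h
  obtain ⟨rfl, h⟩ := encodeNumber_append_inj h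
  simp only [BCircuit.encode, GateSeq.encode_eq, Wire.encode_eq] at h
  have key : ∀ (L M : List (Σ f : {f : BoolFun // f ∈ B}, (Fin f.1.arity → ℕ ⊕ ℕ)))
      (x y : ℕ ⊕ ℕ),
      (L.flatMap fun g => Letter.fn g.1 :: (List.ofFn (fun i => encodeRaw B (g.2 i))).flatten)
          ++ encodeRaw B x =
        (M.flatMap fun g => Letter.fn g.1 :: (List.ofFn (fun i => encodeRaw B (g.2 i))).flatten)
          ++ encodeRaw B y → L = M ∧ x = y := by
    intro L
    induction L with
    | nil =>
      intro M x y hxy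
      cases M with
      | nil =>
        exact ⟨rfl, (encodeRaw_append_inj (B := B) x y [] [] (by simpa using hxy)).1⟩
      | cons g M => cases x <;> simp [encodeRaw] at hxy
    | cons g L ih =>
      intro M x y hxy
      cases M with
      | nil => cases y <;> simp [encodeRaw] at hxy
      | cons g' M =>
        obtain ⟨f, a⟩ := g
        obtain ⟨f', b⟩ := g'
        simp only [List.flatMap_cons, List.cons_append, List.append_assoc, List.cons.injEq,
          Letter.fn.injEq] at hxy
        obtain ⟨rfl, hxy⟩ := hxy
        obtain ⟨rfl, hab⟩ := flatten_ofFn_append_inj (fun _ => True) (encodeRaw B)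
          (fun a _ => encodeRaw_append_inj a) a b _ _ (fun _ => trivial) hxy
        obtain ⟨rfl, hxy'⟩ := ih M x y hab
        exact ⟨rfl, hxy'⟩
  obtain ⟨h1, h2⟩ := key _ _ _ _ h
  obtain rfl : m = n := by rw [← G.length_raw, ← H.length_raw, h1]
  rw [GateSeq.raw_injective h1, Wire.raw_injective h2]

/-! Up to equivalence and renaming of variables, an expression is determined by one bit and one
number, and the minimal size is eventually linear along residue classes of that number.

Algebra. The map `val` carries the Boolean values to a two-element commutative monoid in which every
function of `B` is a constant times a product of some of its arguments: conjunction for AND,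
conjunction of the negated values for OR, the group of order two for XOR. Hence every expression
computes `c * ∏ x ∈ T, val (α x)`, where `T` can be chosen as the set of variables on which the
value really depends (`IsMonomial.exists_hasProfile`). Renaming variables preserves the size, so the
least size of an equivalent expression depends only on `c` and on `T.card`.

Sizes. For fixed `c`, let N(m) be the least size of an expression with `T.card = m`. If no function
of `B` has two essential arguments, then m ≤ 1. Otherwise, a suitable symbol of `B` put twice on top
of an expression adds p variables at cost q and restores `c`, while a counting argument gives q·m ≤
p·N(m) + C (`Grows`). So p·N(m) − q·m is bounded below and does not increase under m ↦ m + p once m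
≥ 2; on each residue class where it is defined for some m ≥ 2 it becomes constant, which means N(m +
p) = N(m) + q (`exists_quasilinear`). Such a function is given by a finite table. The table can be
built into the machine because `B` is fixed; only its existence is needed (`exists_threshold`).

Algorithm. The constant `c` is read off at the assignment that is `neutralBit val` everywhere, and y
lies in `T` exactly if flipping y there changes the value (`HasProfile.mem_iff`). So linearly many
evaluations determine `T.card`; after each of them the probed variable is marked throughout the
input word, so that it is counted only once (`hits_eq_card`). Then the table is applied and the
result is compared with k.

Machines. The algorithm is a structured stack program. Its semantics `Cmd.Runs` only bounds the
number of iterations of each execution of a loop by `n`; since the nesting of the loops is fixed,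
the running time is polynomial in `n` (`Cmd.Runs.reach`). Programs are translated into flow charts,
and these into Turing machines (`Cmd.computableInPolyTime`). -/

/-! ### A structured language of stack programs -/

/-- Structured programs acting on finitely many stacks. -/
inductive Cmd {K : Type} (Γ : K → Type) : Type
  /-- do nothing -/
  | skip : Cmd Γ
  /-- push a letter -/
  | push (k : K) (a : Γ k) : Cmd Γ
  /-- pop the top letter, if any, and continue accordingly -/
  | pop (k : K) (c : Option (Γ k) → Cmd Γ) : Cmd Γ
  /-- sequential composition -/
  | seq (c d : Cmd Γ) : Cmd Γ
  /-- pop letters and run the body on each of them, until the stack is empty or a last letter has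
  been treated -/
  | loop (k : K) (isLast : Γ k → Bool) (c : Γ k → Cmd Γ) : Cmd Γ

/-- A type of memory states, given by the contents of a family of stacks. -/
class StackStore (S : Type) {K : outParam Type} (Γ : outParam (K → Type)) where
  /-- the contents of a stack -/
  get : S → (k : K) → List (Γ k)
  /-- replace the contents of a stack -/
  set : S → (k : K) → List (Γ k) → S
  get_set_self : ∀ s k l, get (set s k l) k = l
  get_set_of_ne : ∀ s k l j, j ≠ k → get (set s k l) j = get s j
  ext : ∀ s s', (∀ k, get s k = get s' k) → s = s'

namespace Cmd

open StackStore

variable {K : Type} {Γ : K → Type} {S : Type} [StackStore S Γ]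

/-- `LoopRuns k isLast R i s s'`: a loop whose body has the semantics `R` leads from `s` to `s'`
with `i` iterations. -/
inductive LoopRuns (k : K) (isLast : Γ k → Bool) (R : Γ k → S → S → Prop) : ℕ → S → S → Prop
  | done {s : S} (h : get s k = []) : LoopRuns k isLast R 0 s s
  | last {s s' : S} {a : Γ k} {l : List (Γ k)} (h : get s k = a :: l) (ha : isLast a = true)
      (hR : R a (set s k l) s') : LoopRuns k isLast R 1 s s'
  | step {i : ℕ} {s s₁ s' : S} {a : Γ k} {l : List (Γ k)} (h : get s k = a :: l)
      (ha : isLast a = false) (hR : R a (set s k l) s₁) (hL : LoopRuns k isLast R i s₁ s') :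
      LoopRuns k isLast R (i + 1) s s'

/-- `Runs n c s s'`: the program `c` leads from `s` to `s'`, no loop being iterated more than
`n` times. -/
def Runs (n : ℕ) : Cmd Γ → S → S → Prop
  | skip, s, s' => s' = s
  | push k a, s, s' => s' = set s k (a :: get s k)
  | pop k c, s, s' => Runs n (c (get s k).head?) (set s k (get s k).tail) s'
  | seq c d, s, s' => ∃ s₁, Runs n c s s₁ ∧ Runs n d s₁ s'
  | loop k isLast c, s, s' => ∃ i ≤ n, LoopRuns k isLast (fun a => Runs n (c a)) i s s'

/-- A bound for the running time of a program, in terms of the number of iterations of its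
loops. -/
noncomputable def time [∀ k, Fintype (Γ k)] : Cmd Γ → Polynomial ℕ
  | skip => 1
  | push _ _ => 1
  | pop _ c => 1 + ∑ a, (c a).time
  | seq c d => c.time + d.time
  | loop _ _ c => 1 + Polynomial.X * (1 + ∑ a, (c a).time)

end Cmd

/-! ### Flow charts -/

/-- An elementary instruction, with targets in `L`. -/
inductive Instr {K : Type} (Γ : K → Type) (L : Type) : Type
  | jump (l : L) : Instr Γ L
  | push (k : K) (a : Γ k) (l : L) : Instr Γ L
  | pop (k : K) (l : Option (Γ k) → L) : Instr Γ L

namespace Instr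

open StackStore

variable {K : Type} {Γ : K → Type} {S : Type} [StackStore S Γ] {L L' : Type}

/-- Rename the targets of an instruction. -/
def map (f : L → L') : Instr Γ L → Instr Γ L'
  | jump l => jump (f l)
  | push k a l => push k a (f l)
  | pop k l => pop k (fun a => f (l a))

/-- Execute an instruction. -/
def exec : Instr Γ L → S → L × S
  | jump l, s => (l, s)
  | push k a l, s => (l, set s k (a :: get s k))
  | pop k l, s => (l (get s k).head?, set s k (get s k).tail)

theorem exec_map (f : L → L') (i : Instr Γ L) (s : S) :
    (i.map f).exec s = (f (i.exec s).1, (i.exec s).2) := by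
  cases i <;> rfl

end Instr

/-- A flow chart; the target `none` is its exit. -/
structure Chart {K : Type} (Γ : K → Type) : Type 1 where
  /-- the labels -/
  Λ : Type
  [fin : Fintype Λ]
  /-- the label at which the execution starts -/
  start : Λ
  /-- the instructions -/
  instr : Λ → Instr Γ (Option Λ)

attribute [instance] Chart.fin

namespace Chart

open StackStore

variable {K : Type} {Γ : K → Type} {S : Type} [StackStore S Γ]

/-- `C.Reach t o s o' s'`: in `t` steps, the execution of `C` leads from `(o, s)` to
`(o', s')`. -/
inductive Reach (C : Chart Γ) : ℕ → Option C.Λ → S → Option C.Λ → S → Prop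
  | refl (o : Option C.Λ) (s : S) : Reach C 0 o s o s
  | step {t : ℕ} {l : C.Λ} {s s' : S} {o : Option C.Λ}
      (h : Reach C t ((C.instr l).exec s).1 ((C.instr l).exec s).2 o s') :
      Reach C (t + 1) (some l) s o s'

theorem Reach.trans {C : Chart Γ} {t u : ℕ} {o o' o'' : Option C.Λ} {s s' s'' : S}
    (h : C.Reach t o s o' s') (h' : C.Reach u o' s' o'' s'') :
    C.Reach (t + u) o s o'' s'' := by
  induction h with
  | refl => simpa using h'
  | step _ ih => rw [Nat.add_right_comm]; exact .step (ih h')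

/-- Targets of a part of a flow chart, seen in the whole flow chart. -/
def link {Λ Λ' : Type} (g : Λ → Λ') (e : Option Λ') (o : Option Λ) : Option Λ' :=
  o.elim e (fun l => some (g l))

theorem Reach.embed {C D : Chart Γ} (g : C.Λ → D.Λ) (e : Option D.Λ)
    (hg : ∀ l, D.instr (g l) = (C.instr l).map (link g e)) {t : ℕ} {o o' : Option C.Λ} {s s' : S}
    (h : C.Reach t o s o' s') : D.Reach t (link g e o) s (link g e o') s' := by
  induction h with
  | refl => exact .refl _ _
  | step _ ih =>
    refine .step ?_
    rw [hg, Instr.exec_map]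
    exact ih

/-- A flow chart with one instruction. -/
def single (i : Instr Γ (Option Unit)) : Chart Γ where
  Λ := Unit
  start := ()
  instr := fun _ => i

/-- Pop a letter and continue accordingly. -/
def branch (k : K) [Fintype (Γ k)] (C : Option (Γ k) → Chart Γ) : Chart Γ where
  Λ := Option (Σ a, (C a).Λ)
  start := none
  instr := fun o => match o with
    | none => .pop k (fun a => some (some ⟨a, (C a).start⟩))
    | some ⟨a, l⟩ => ((C a).instr l).map (link (fun l => some ⟨a, l⟩) none)

/-- Sequential composition. -/
def seq (C D : Chart Γ) : Chart Γ where
  Λ := C.Λ ⊕ D.Λ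
  start := .inl C.start
  instr := fun o => match o with
    | .inl l => (C.instr l).map (link .inl (some (.inr D.start)))
    | .inr l => (D.instr l).map (link .inr none)

/-- Iteration. -/
def loop (k : K) [Fintype (Γ k)] (isLast : Γ k → Bool) (C : Γ k → Chart Γ) : Chart Γ where
  Λ := Option (Σ a, (C a).Λ)
  start := none
  instr := fun o => match o with
    | none => .pop k (fun o => o.elim none (fun a => some (some ⟨a, (C a).start⟩)))
    | some ⟨a, l⟩ => ((C a).instr l).map
        (link (fun l => some ⟨a, l⟩) (bif isLast a then none else some none))

end Chart

namespace Cmd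

open StackStore Chart

variable {K : Type} {Γ : K → Type} {S : Type} [StackStore S Γ] [∀ k, Fintype (Γ k)]

/-- The flow chart of a program. -/
def compile : Cmd Γ → Chart Γ
  | skip => .single (.jump none)
  | push k a => .single (.push k a none)
  | pop k c => .branch k fun a => (c a).compile
  | seq c d => .seq c.compile d.compile
  | loop k isLast c => .loop k isLast fun a => (c a).compile

/-- The branch taken after a pop costs no more than the sum over all branches, which is a polynomial
independent of the data; a loop costs at most `n` such sums, one pop per iteration and one final
pop. -/
theorem Runs.reach {n : ℕ} {c : Cmd Γ} {s s' : S} (h : Runs n c s s') :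
    ∃ t ≤ c.time.eval n, c.compile.Reach t (some c.compile.start) s none s' := by
  induction c generalizing s s' with
  | skip =>
    obtain rfl : s' = s := h
    exact ⟨1, by simp [time], .step (.refl _ _)⟩
  | push k a =>
    obtain rfl : s' = set s k (a :: get s k) := h
    exact ⟨1, by simp [time], .step (.refl _ _)⟩
  | pop k c ih =>
    obtain ⟨t, ht, hr⟩ := ih _ h
    refine ⟨t + 1, ?_, ?_⟩
    · have := Finset.single_le_sum (f := fun a => (c a).time.eval n) (fun _ _ => Nat.zero_le _)
        (Finset.mem_univ (get s k).head?)
      simp only [time, Polynomial.eval_add, Polynomial.eval_one, Polynomial.eval_finsetSum]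
      omega
    · exact .step (hr.embed (D := .branch k fun a => (c a).compile) (fun l => some ⟨_, l⟩) none
        (fun _ => rfl))
  | seq c d ihc ihd =>
    obtain ⟨s₁, h₁, h₂⟩ := h
    obtain ⟨t, ht, hr⟩ := ihc h₁
    obtain ⟨u, hu, hq⟩ := ihd h₂
    refine ⟨t + u, by simpa [time] using add_le_add ht hu, ?_⟩
    exact (hr.embed (D := .seq c.compile d.compile) Sum.inl (some (Sum.inr d.compile.start))
      (fun _ => rfl)).trans
        (hq.embed (D := .seq c.compile d.compile) Sum.inr none (fun _ => rfl))
  | loop k isLast c ih =>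
    obtain ⟨i, hi, hL⟩ := h
    -- The bound is proved for the actual number `i` of iterations, which varies in the induction;
    -- `i ≤ n` enters only at the end.
    have key : ∃ t ≤ 1 + i * (1 + ∑ a, (c a).time.eval n),
        (Chart.loop k isLast fun a => (c a).compile).Reach t (some none) s none s' := by
      clear hi
      have hle : ∀ a, (c a).time.eval n ≤ ∑ a, (c a).time.eval n := fun a =>
        Finset.single_le_sum (f := fun a => (c a).time.eval n) (fun _ _ => Nat.zero_le _)
          (Finset.mem_univ a)
      induction hL with
      | @done s h =>
        refine ⟨1, by simp, .step ?_⟩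
        have : set s k ([] : List (Γ k)) = s := by
          apply StackStore.ext (Γ := Γ)
          intro j
          by_cases hj : j = k
          · subst hj; rw [get_set_self, h]
          · rw [get_set_of_ne _ _ _ _ hj]
        simp only [Chart.loop, Instr.exec, h, List.head?_nil, List.tail_nil, this]
        exact .refl _ _
      | @last s s' a l h ha hR =>
        obtain ⟨t, ht, hr⟩ := ih a hR
        refine ⟨t + 1, ?_, .step ?_⟩
        · have := hle a
          omega
        · have := hr.embed (D := .loop k isLast fun a => (c a).compile) (fun l => some ⟨a, l⟩)
            (bif isLast a then none else some none) (fun _ => rfl)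
          simp only [link, Option.elim, ha, cond_true] at this
          simp only [Chart.loop, Instr.exec, h]
          exact this
      | @step i s s₁ s' a l h ha hR _ ihL =>
        obtain ⟨t, ht, hr⟩ := ih a hR
        obtain ⟨u, hu, hq⟩ := ihL
        refine ⟨t + u + 1, ?_, .step ?_⟩
        · have := hle a
          rw [Nat.add_mul]
          omega
        · have := hr.embed (D := .loop k isLast fun a => (c a).compile) (fun l => some ⟨a, l⟩)
            (bif isLast a then none else some none) (fun _ => rfl)
          simp only [link, Option.elim, ha, cond_false] at this
          have := this.trans hq
          simp only [Chart.loop, Instr.exec, h]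
          exact this
    obtain ⟨t, ht, hr⟩ := key
    refine ⟨t, ht.trans ?_, hr⟩
    simp only [time, Polynomial.eval_add, Polynomial.eval_one, Polynomial.eval_mul,
      Polynomial.eval_X, Polynomial.eval_finsetSum]
    gcongr

end Cmd

/-! ### Turing machines of flow charts -/

namespace Chart

open StackStore Turing

variable {K : Type} {Γ : K → Type} {S : Type} [StackStore S Γ]

/-- Go to the label held by the internal state, or halt. -/
def proceed (C : Chart Γ) : TM2.Stmt Γ C.Λ (Option C.Λ) :=
  .branch Option.isSome (.goto fun v => v.getD C.start) .halt

/-- The statement of an instruction. -/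
def stmt (C : Chart Γ) : Instr Γ (Option C.Λ) → TM2.Stmt Γ C.Λ (Option C.Λ)
  | .jump l => .load (fun _ => l) C.proceed
  | .push k a l => .push k (fun _ => a) (.load (fun _ => l) C.proceed)
  | .pop k l => .pop k (fun _ a => l a) C.proceed

variable [DecidableEq K]

/-- The Turing machine of a flow chart. -/
def machine (C : Chart Γ) [Fintype K] [∀ k, Fintype (Γ k)] (kin kout : K) : FinTM2 where
  k₀ := kin
  k₁ := kout
  Γ := Γ
  Λ := C.Λ
  main := C.start
  σ := Option C.Λ
  initialState := none
  m := fun l => C.stmt (C.instr l)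

theorem stepAux_proceed (C : Chart Γ) (v : Option C.Λ) (T : ∀ k, List (Γ k)) :
    TM2.stepAux C.proceed v T = ⟨v, v, T⟩ := by
  cases v <;> rfl

theorem update_get (s : S) (k : K) (l : List (Γ k)) :
    Function.update (get s) k l = get (set s k l) := by
  funext j
  by_cases hj : j = k
  · subst hj; rw [Function.update_self, get_set_self]
  · rw [Function.update_of_ne hj, get_set_of_ne _ _ _ _ hj]

theorem stepAux_stmt (C : Chart Γ) (i : Instr Γ (Option C.Λ)) (v : Option C.Λ) (s : S) :
    TM2.stepAux (C.stmt i) v (get s) = ⟨(i.exec s).1, (i.exec s).1, get (i.exec s).2⟩ := by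
  cases i <;> simp only [stmt, TM2.stepAux, stepAux_proceed, update_get] <;> rfl

/-- One instruction is one step of the machine. The internal state `v` is arbitrary because every
statement overwrites it with the next target before reading it. -/
theorem Reach.iterate {C : Chart Γ} [Fintype K] [∀ k, Fintype (Γ k)] (kin kout : K) {t : ℕ}
    {l : C.Λ} {s s' : S} (h : C.Reach t (some l) s none s') (v : Option C.Λ) :
    (flip bind (C.machine kin kout).step)^[t] (some ⟨some l, v, get s⟩) =
      some ⟨none, none, get s'⟩ := by
  generalize ho : some l = o at h
  generalize ho' : none = o' at h
  induction h generalizing l v with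
  | refl => subst ho; cases ho'
  | @step t l s s' o h ih =>
    cases ho
    subst ho'
    rw [Function.iterate_succ_apply]
    refine (congrArg ((flip bind (C.machine kin kout).step)^[t])
      (congrArg some (C.stepAux_stmt (C.instr l) v s))).trans ?_
    generalize hx : ((C.instr l).exec s).1 = x at *
    cases x with
    | none =>
      cases h with
      | refl => rfl
    | some l₁ => exact ih _ rfl rfl

end Chart

open StackStore in
/-- A function is computable in polynomial time if it is computed by a structured program
whose loops are iterated only polynomially often. -/
theorem Cmd.computableInPolyTime {K : Type} [DecidableEq K] [Fintype K] {Γ : K → Type}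
    [∀ k, Fintype (Γ k)] {S : Type} [StackStore S Γ] (c : Cmd Γ) (kin kout : K)
    {ι αΓ βΓ β : Type} (ein : Γ kin ≃ αΓ) (eout : Γ kout ≃ βΓ)
    (enc : ι → List αΓ) (enc' : β → List βΓ) (f : ι → β) (b : Polynomial ℕ) (nil : S)
    (hnil : ∀ k, get nil k = [])
    (h : ∀ a, c.Runs (b.eval (enc a).length) (set nil kin ((enc a).map ein.symm))
      (set nil kout ((enc' (f a)).map eout.symm))) :
    Nonempty (Turing.TM2ComputableInPolyTime enc enc' f) := by
  refine ⟨{ tm := c.compile.machine kin kout, inputAlphabet := ein, outputAlphabet := eout,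
            time := c.time.comp b, outputsFun := fun a => ?_ }⟩
  have hr := (h a).reach
  refine ⟨⟨hr.choose, ?_⟩, by simpa using hr.choose_spec.1⟩
  have := Chart.Reach.iterate kin kout hr.choose_spec.2 none
  have key : ∀ (k₀ : K) (L : List (Γ k₀)) (k : K), get (set nil k₀ L) k =
      @dite (List (Γ k)) (k = k₀) (inferInstance) (fun h => by rw [h]; exact L) fun _ => [] := by
    intro k₀ L k
    split_ifs with hk
    · subst hk; rw [get_set_self]; rfl
    · rw [get_set_of_ne _ _ _ _ hk, hnil]
  -- Initial and halting configurations of a machine are given by a dependent `if` with one nonempty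
  -- stack; they are identified with memory states here.
  have hcfg : ∀ (o : Option c.compile.Λ) (k₀ : K) (L : List (Γ k₀)),
      (⟨o, none, fun k : K => @dite (List (Γ k)) (k = k₀) (‹DecidableEq K› k k₀)
        (fun h => by rw [h]; exact L) fun _ => []⟩ : (c.compile.machine kin kout).Cfg) =
        ⟨o, none, get (set nil k₀ L)⟩ := fun o k₀ L =>
    congrArg (fun T => (⟨o, none, T⟩ : Turing.TM2.Cfg Γ c.compile.Λ (Option c.compile.Λ)))
      (funext (key k₀ L)).symm
  exact (congrArg (fun x => (flip bind (c.compile.machine kin kout).step)^[hr.choose] (some x))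
    (hcfg (some c.compile.start) kin _)).trans (this.trans (congrArg some (hcfg none kout _).symm))

/-! ### Rules for stack programs -/

namespace Cmd

open StackStore

variable {K : Type} {Γ : K → Type} {S : Type} [StackStore S Γ] {n : ℕ}

theorem set_get_self (s : S) (k : K) {l : List (Γ k)} (h : get s k = l) : set s k l = s := by
  apply StackStore.ext (Γ := Γ)
  intro j
  by_cases hj : j = k
  · subst hj; rw [get_set_self, h]
  · rw [get_set_of_ne _ _ _ _ hj]

theorem set_set_self (s : S) (k : K) (l l' : List (Γ k)) : set (set s k l) k l' = set s k l' := by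
  apply StackStore.ext (Γ := Γ)
  intro j
  by_cases hj : j = k
  · subst hj; rw [get_set_self, get_set_self]
  · simp only [get_set_of_ne _ _ _ _ hj]

theorem set_comm (s : S) {k k' : K} (h : k ≠ k') (l : List (Γ k)) (l' : List (Γ k')) :
    set (set s k l) k' l' = set (set s k' l') k l := by
  apply StackStore.ext (Γ := Γ)
  intro j
  by_cases hj : j = k
  · subst hj
    rw [get_set_self, get_set_of_ne _ _ _ _ h, get_set_self]
  · by_cases hj' : j = k'
    · subst hj'
      rw [get_set_self, get_set_of_ne _ _ _ _ hj, get_set_self]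
    · simp only [get_set_of_ne _ _ _ _ hj, get_set_of_ne _ _ _ _ hj']

theorem runs_skip (s : S) : Runs n (skip : Cmd Γ) s s := rfl

theorem runs_push (k : K) (a : Γ k) (s : S) : Runs n (push k a) s (set s k (a :: get s k)) := rfl

theorem runs_seq {c d : Cmd Γ} {s s₁ s' : S} (h : Runs n c s s₁) (h' : Runs n d s₁ s') :
    Runs n (seq c d) s s' := ⟨s₁, h, h'⟩

theorem runs_pop {k : K} {c : Option (Γ k) → Cmd Γ} {s s' : S} {a : Γ k} {l : List (Γ k)}
    (h : get s k = a :: l) (h' : Runs n (c (some a)) (set s k l) s') : Runs n (pop k c) s s' := by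
  simpa [Runs, h] using h'

theorem runs_pop_nil {k : K} {c : Option (Γ k) → Cmd Γ} {s s' : S}
    (h : get s k = []) (h' : Runs n (c none) s s') : Runs n (pop k c) s s' := by
  simpa [Runs, h, set_get_self s k h] using h'

/-- The iterations of a loop over an initial part `L` of the stack; `F p l` is the memory state
when the letters `p` have been treated and `l` is left. -/
theorem LoopRuns.prepend {k : K} {isLast : Γ k → Bool} {c : Γ k → Cmd Γ}
    (F : List (Γ k) → List (Γ k) → S) (hget : ∀ p l, get (F p l) k = l) (L rest : List (Γ k))
    (hlast : ∀ a ∈ L, isLast a = false)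
    (hstep : ∀ p a l, p ++ a :: l = L →
      Runs n (c a) (set (F p (a :: (l ++ rest))) k (l ++ rest)) (F (p ++ [a]) (l ++ rest)))
    {i : ℕ} {s' : S} (h : LoopRuns k isLast (fun a => Runs n (c a)) i (F L rest) s') :
    LoopRuns k isLast (fun a => Runs n (c a)) (L.length + i) (F [] (L ++ rest)) s' := by
  have key : ∀ l p, p ++ l = L →
      LoopRuns k isLast (fun a => Runs n (c a)) (l.length + i) (F p (l ++ rest)) s' := by
    intro l
    induction l with
    | nil => intro p hp; rw [List.append_nil] at hp; subst hp; simpa using h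
    | cons a l ih =>
      intro p hp
      have := ih (p ++ [a]) (by simpa using hp)
      rw [List.length_cons, Nat.add_right_comm]
      exact .step (hget _ _) (hlast a (hp ▸ by simp)) (hstep p a l hp) this
  exact key L [] rfl

theorem runs_loop {k : K} {c : Γ k → Cmd Γ} (F : List (Γ k) → List (Γ k) → S)
    (hget : ∀ p l, get (F p l) k = l) (L : List (Γ k)) (hn : L.length ≤ n)
    (hstep : ∀ p a l, p ++ a :: l = L →
      Runs n (c a) (set (F p (a :: l)) k l) (F (p ++ [a]) l)) :
    Runs n (loop k (fun _ => false) c) (F [] L) (F L []) := by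
  refine ⟨L.length, hn, ?_⟩
  have := LoopRuns.prepend (n := n) (isLast := fun _ => false) (c := c) F hget L [] (fun _ _ => rfl)
    (fun p a l h => by simpa using hstep p a l h) (.done (hget _ _))
  simpa using this

/-- The closing letter `z` takes one more iteration than `L` has letters, hence the strict
inequality. -/
theorem runs_loop_until {k : K} {isLast : Γ k → Bool} {c : Γ k → Cmd Γ}
    (F : List (Γ k) → List (Γ k) → S)
    (hget : ∀ p l, get (F p l) k = l) (L rest : List (Γ k)) (z : Γ k) (hn : L.length < n)
    (hlast : ∀ a ∈ L, isLast a = false) (hz : isLast z = true)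
    (hstep : ∀ p a l, p ++ a :: l = L →
      Runs n (c a) (set (F p (a :: (l ++ z :: rest))) k (l ++ z :: rest))
        (F (p ++ [a]) (l ++ z :: rest)))
    {s' : S} (h : Runs n (c z) (set (F L (z :: rest)) k rest) s') :
    Runs n (loop k isLast c) (F [] (L ++ z :: rest)) s' :=
  ⟨L.length + 1, hn, LoopRuns.prepend F hget L (z :: rest) hlast hstep (.last (hget _ _) hz h)⟩

/-- Move the letters of a stack onto another one. -/
def move (p q : K) (f : Γ p → Γ q) : Cmd Γ :=
  loop p (fun _ => false) (fun a => push q (f a))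

/-- Empty a stack. -/
def clear (p : K) : Cmd Γ :=
  loop p (fun _ => false) (fun _ => skip)

theorem runs_move {p q : K} (h : p ≠ q) (f : Γ p → Γ q) {s : S} (hn : (get s p).length ≤ n) :
    Runs n (move p q f) s
      (set (set s q (((get s p).map f).reverse ++ get s q)) p []) := by
  have := runs_loop (n := n) (c := fun a => push q (f a))
    (fun a l => set (set s q ((a.map f).reverse ++ get s q)) p l)
    (fun _ _ => get_set_self _ _ _) (get s p) hn (fun a b l _ => by
      change _ = _
      rw [set_set_self, get_set_of_ne _ _ _ _ h.symm, get_set_self, set_comm _ h,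
        set_set_self, List.map_append, List.reverse_append]
      rfl)
  rw [List.map_nil, List.reverse_nil, List.nil_append, set_get_self s q rfl,
    set_get_self s p rfl] at this
  exact this

theorem runs_clear {p : K} {s : S} (hn : (get s p).length ≤ n) :
    Runs n (clear p) s (set s p []) := by
  have := runs_loop (n := n) (c := fun _ : Γ p => skip) (fun _ l => set s p l)
    (fun _ _ => get_set_self _ _ _) (get s p) hn (fun a b l _ => by
      change _ = _
      rw [set_set_self])
  rw [set_get_self s p rfl] at this
  exact this

/-- Push a list of letters. -/
def pushList {k : K} : List (Γ k) → Cmd Γ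
  | [] => skip
  | a :: l => seq (pushList l) (push k a)

theorem runs_pushList {k : K} (l : List (Γ k)) (s : S) :
    Runs n (pushList l) s (set s k (l ++ get s k)) := by
  induction l with
  | nil => exact (set_get_self s k rfl).symm ▸ runs_skip s
  | cons a l ih =>
    refine runs_seq ih ?_
    change _ = _
    rw [get_set_self, set_set_self, List.cons_append]

/-- Empty all the stacks of a list. -/
def clearAll : List K → Cmd Γ
  | [] => skip
  | k :: l => seq (clear k) (clearAll l)

theorem runs_clearAll (l : List K) {s s' : S} (hn : ∀ k, (get s k).length ≤ n)
    (hs : ∀ k, k ∈ l → get s' k = []) (hs' : ∀ k, k ∉ l → get s' k = get s k) :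
    Runs n (clearAll l) s s' := by
  induction l generalizing s with
  | nil => exact StackStore.ext (Γ := Γ) _ _ fun k => hs' k (by simp)
  | cons k l ih =>
    refine runs_seq (runs_clear (hn k)) (ih (fun j => ?_) (fun j hj => hs j (by simp [hj])) ?_)
    · by_cases hj : j = k
      · subst hj; rw [get_set_self]; simp
      · rw [get_set_of_ne _ _ _ _ hj]; exact hn j
    · intro j hj
      by_cases hjk : j = k
      · subst hjk; rw [get_set_self, hs _ (by simp)]
      · rw [get_set_of_ne _ _ _ _ hjk]; exact hs' j (by simp [hj, hjk])

end Cmd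

/-! ### Numbers in binary -/

/-- The value of a list of bits, least significant bit first. -/
def bitsValue (l : List Bool) : ℕ := l.foldr (fun b v => 2 * v + b.toNat) 0

theorem bitsValue_encodeNat (n : ℕ) : bitsValue (Computability.encodeNat n) = n := by
  have hpos : ∀ p : PosNum, bitsValue (Computability.encodePosNum p) = p := by
    intro p
    induction p with
    | one => rfl
    | bit1 p ih =>
      rw [PosNum.cast_bit1, ← ih]
      simp [bitsValue, Computability.encodePosNum]; omega
    | bit0 p ih =>
      rw [PosNum.cast_bit0, ← ih]
      simp [bitsValue, Computability.encodePosNum]; omega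
  conv_rhs => rw [← Num.to_of_nat n]
  rw [Computability.encodeNat]
  cases (n : Num) with
  | zero => rfl
  | pos p => exact hpos p

/-- The bits of a number, most significant bit first. -/
def natKey (x : ℕ) : List Bool := (Computability.encodeNat x).reverse

theorem natKey_injective : Function.Injective natKey := by
  intro a b h
  rw [← Computability.decode_encodeNat a, ← Computability.decode_encodeNat b,
    List.reverse_injective h]

/-- Zero is encoded by the empty word, so `[false]` is the key of no variable. Probing this key
evaluates at the constant assignment. -/
theorem natKey_ne_zero (x : ℕ) : natKey x ≠ [false] := by
  intro h
  have h1 : Computability.encodeNat x = [false] := by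
    simpa [natKey] using congrArg List.reverse h
  have h2 := bitsValue_encodeNat x
  rw [h1] at h2
  obtain rfl : x = 0 := by simpa [bitsValue] using h2.symm
  simp [Computability.encodeNat, Computability.encodeNum] at h1

theorem foldl_natKey (x : ℕ) : (natKey x).foldl (fun v b => 2 * v + b.toNat) 0 = x := by
  rw [natKey, List.foldl_reverse]
  exact bitsValue_encodeNat x

theorem foldl_bits_le (p q : List Bool) (v : ℕ) :
    p.foldl (fun v b => 2 * v + b.toNat) v ≤ (p ++ q).foldl (fun v b => 2 * v + b.toNat) v := by
  rw [List.foldl_append]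
  generalize p.foldl (fun v b => 2 * v + b.toNat) v = w
  induction q generalizing w with
  | nil => exact le_rfl
  | cons b q ih => exact le_trans (by dsimp only; omega) (ih _)

/-! ### The memory -/

/-- The stacks. -/
inductive Stk : Type
  | inp | w | z | kb | x | key | y | t | v | g | gy | u | uy | m | e | ans
  deriving DecidableEq

/-- All stacks. -/
def Stk.all : List Stk :=
  [inp, w, z, kb, x, key, y, t, v, g, gy, u, uy, m, e, ans]

theorem Stk.mem_all (k : Stk) : k ∈ Stk.all := by
  cases k <;> decide

instance : Fintype Stk := Fintype.ofList Stk.all Stk.mem_all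

/-- The alphabets of the stacks. -/
@[reducible] def Stk.letters (B : Finset BoolFun) : Stk → Type
  | inp | w | z => Letter B
  | _ => Bool

/-- The contents of the stacks. -/
structure Mem (B : Finset BoolFun) : Type where
  (inp w z : List (Letter B) := [])
  (kb x key y t v g gy u uy m e ans : List Bool := [])

/-- The contents of a stack. -/
def Mem.get {B : Finset BoolFun} (s : Mem B) : (k : Stk) → List (k.letters B)
  | .inp => s.inp | .w => s.w | .z => s.z | .kb => s.kb | .x => s.x | .key => s.key | .y => s.y
  | .t => s.t | .v => s.v | .g => s.g | .gy => s.gy | .u => s.u | .uy => s.uy | .m => s.m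
  | .e => s.e | .ans => s.ans

/-- Replace the contents of a stack. -/
def Mem.set {B : Finset BoolFun} (s : Mem B) : (k : Stk) → List (k.letters B) → Mem B
  | .inp, l => { s with inp := l } | .w, l => { s with w := l } | .z, l => { s with z := l }
  | .kb, l => { s with kb := l } | .x, l => { s with x := l } | .key, l => { s with key := l }
  | .y, l => { s with y := l } | .t, l => { s with t := l } | .v, l => { s with v := l }
  | .g, l => { s with g := l } | .gy, l => { s with gy := l } | .u, l => { s with u := l }
  | .uy, l => { s with uy := l } | .m, l => { s with m := l } | .e, l => { s with e := l }
  | .ans, l => { s with ans := l }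

instance (B : Finset BoolFun) : StackStore (Mem B) (Stk.letters B) where
  get := Mem.get
  set := Mem.set
  get_set_self s k l := by cases k <;> rfl
  get_set_of_ne s k l j h := by
    cases k <;> cases j <;> first | rfl | exact absurd rfl h
  ext s s' h := by
    cases s
    cases s'
    congr
    exacts [h .inp, h .w, h .z, h .kb, h .x, h .key, h .y, h .t, h .v, h .g, h .gy, h .u, h .uy,
      h .m, h .e, h .ans]

theorem Letter.finite (B : Finset BoolFun) : Finite (Letter B) := by
  let f : Letter B → {f : BoolFun // f ∈ B} ⊕ (Bool ⊕ Fin 3) := fun a => match a with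
    | .fn f => .inl f
    | .bit b => .inr (.inl b)
    | .var => .inr (.inr 0)
    | .gate => .inr (.inr 1)
    | .sep => .inr (.inr 2)
  refine Finite.of_injective f ?_
  intro a b h
  cases a <;> cases b <;> simp_all [f]

noncomputable instance (B : Finset BoolFun) (k : Stk) : Fintype (k.letters B) :=
  have := Letter.finite B
  have : Finite (k.letters B) := by cases k <;> dsimp only [Stk.letters] <;> infer_instance
  Fintype.ofFinite _

namespace Cmd

variable {B : Finset BoolFun} {n : ℕ}

/-- Compare the word on `t` with the one on `key`, discard the former, and continue with `c` if
they are equal, with `d` otherwise. -/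
def cmp (c d : Cmd (Stk.letters B)) : Cmd (Stk.letters B) :=
  seq (loop .key (fun _ => false) fun a =>
      seq (push .y a) (pop .t fun o => bif o == some a then skip else push .e true)) <|
    seq (loop .t (fun _ => false) fun _ => push .e true) <|
    seq (move .y .key id) <|
    pop .e fun o => match o with
      | none => c
      | some _ => seq (clear .e) d

/-- The stack `e` collects a letter for every position of `key` at which `t` disagrees or is
exhausted, and for every surplus letter of `t`; the words agree exactly if it stays empty. The key
is saved on `y` and restored. -/
theorem runs_cmp {c d : Cmd (Stk.letters B)} (s : Mem B) {s' : Mem B} {q r : List Bool}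
    (hn : q.length + r.length ≤ n)
    (h : Runs n (if q = r then c else d) { s with key := q, y := [], t := [], e := [] } s') :
    Runs n (cmp c d) { s with key := q, y := [], t := r, e := [] } s' := by
  -- `E` are the new letters on `e`. This loop compares the key only with a prefix of `t`; a longer
  -- `t` is detected by the next loop.
  have h1 : ∀ (l r q : List Bool), ∀ s : Mem B, s.key = l → s.t = r → s.e = q → ∃ E : List Bool,
      (E = [] ↔ r.take l.length = l) ∧ E.length ≤ l.length ∧
      LoopRuns (S := Mem B) .key (fun _ => false) (fun a => Runs n (seq (push .y a)
        (pop .t fun o => bif o == some a then skip else push .e true))) l.length s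
        { s with key := [], y := l.reverse ++ s.y, t := r.drop l.length, e := E ++ q } := by
    intro l
    induction l with
    | nil =>
      intro r q s hk ht he
      refine ⟨[], by simp, by simp, ?_⟩
      have : ({ s with key := [], y := s.y, t := r, e := q } : Mem B) = s := by
        subst ht; subst he; rw [← hk]
      simpa [this] using LoopRuns.done (S := Mem B) (Γ := Stk.letters B) (k := .key) hk
    | cons a l ih =>
      intro r q s hk ht he
      cases r with
      | nil =>
        obtain ⟨E, hE, hEl, hL⟩ := ih [] (true :: q)
          { s with key := l, y := a :: s.y, e := true :: q } rfl ht rfl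
        refine ⟨E ++ [true], by simp, by simp; omega, .step (a := a) (l := l) hk rfl
          (runs_seq (runs_push (Γ := Stk.letters B) .y a _) ?_)
          (by simpa using hL)⟩
        refine runs_pop_nil ht ?_
        rw [← he]
        exact rfl
      | cons b r =>
        by_cases hab : b = a
        · subst hab
          obtain ⟨E, hE, hEl, hL⟩ := ih r q
            { s with key := l, y := b :: s.y, t := r } rfl rfl he
          refine ⟨E, by simpa using hE, by simp; omega, .step (a := b) (l := l) hk rfl
            (runs_seq (runs_push (Γ := Stk.letters B) .y b _) ?_)
            (by simpa using hL)⟩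
          refine runs_pop (a := b) (l := r) ht ?_
          simp only [beq_self_eq_true, cond_true]
          exact rfl
        · obtain ⟨E, hE, hEl, hL⟩ := ih r (true :: q)
            { s with key := l, y := a :: s.y, t := r, e := true :: q } rfl rfl rfl
          refine ⟨E ++ [true], by simp [hab], by simp; omega, .step (a := a) (l := l) hk rfl
            (runs_seq (runs_push (Γ := Stk.letters B) .y a _) ?_)
            (by simpa using hL)⟩
          refine runs_pop (a := b) (l := r) ht ?_
          rw [← he]
          have : (some b == some a) = false := by simpa using hab
          rw [this]
          exact rfl
  obtain ⟨E, hE, hEl, hL⟩ := h1 q r [] { s with key := q, y := [], t := r, e := [] } rfl rfl rfl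
  refine runs_seq ⟨_, by omega, hL⟩ ?_
  have h2 := runs_loop (S := Mem B) (k := .t) (n := n) (c := fun _ => push .e true)
    (fun p l => { s with
      key := [], y := q.reverse, t := l, e := List.replicate p.length true ++ E })
    (fun _ _ => rfl) (r.drop q.length) (by simp; omega) (fun p a l _ => by
      rw [List.length_append, List.length_singleton, List.replicate_succ]
      exact rfl)
  simp only [List.append_nil] at h2 ⊢
  refine runs_seq h2 ?_
  refine runs_seq (runs_move (by decide) _ (by change (List.reverse _).length ≤ n; simp; omega)) ?_
  have hkey : (q.reverse.map id).reverse ++ [] = q := by simp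
  by_cases heq : q = r
  · rw [if_pos heq] at h
    have hE' : E = [] := hE.2 (by rw [heq, List.take_length])
    have hF : List.replicate (r.drop q.length).length true ++ E = [] := by
      simp [hE', heq]
    refine runs_pop_nil hF ?_
    change Runs n c { s with
      key := (q.reverse.map id).reverse ++ [], y := [], t := [], e := List.replicate _ true ++ E } s'
    rw [hkey, hF]
    exact h
  · rw [if_neg heq] at h
    obtain ⟨a, l, hF⟩ : ∃ a l, List.replicate (r.drop q.length).length true ++ E = a :: l := by
      refine List.exists_cons_of_ne_nil fun h0 => heq ?_
      rw [List.append_eq_nil_iff] at h0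
      have h1 := hE.1 h0.2
      have h2 := h0.1
      rw [List.replicate_eq_nil_iff, List.length_eq_zero_iff, List.drop_eq_nil_iff] at h2
      rw [← h1, List.take_of_length_le h2]
    refine runs_pop hF ?_
    have hl : l.length ≤ n := by
      have := congrArg List.length hF
      simp at this
      omega
    refine runs_seq (runs_clear hl) ?_
    change Runs n d { s with
      key := (q.reverse.map id).reverse ++ [], y := [], t := [], e := [] } s'
    rw [hkey]
    exact h

/-- Replace the binary number on `t`, most significant bit on top, by its unary version on `u`. -/
def unary : Cmd (Stk.letters B) :=
  loop .t (fun _ => false) fun b =>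
    seq (loop .u (fun _ => false) fun _ => seq (push .uy true) (push .uy true)) <|
    seq (move .uy .u id) (bif b then push .u true else skip)

/-- Horner's scheme in unary, the doubling being done through `uy`. The value of a prefix never
exceeds `x`, so `x` bounds all iterations of the inner loops. -/
theorem runs_unary (s : Mem B) {x : ℕ} (hn : x ≤ n) (hn' : (natKey x).length ≤ n) :
    Runs n (unary (B := B)) { s with t := natKey x, u := [], uy := [] }
      { s with t := [], u := List.replicate x true, uy := [] } := by
  have := runs_loop (S := Mem B) (k := .t) (n := n) (c := fun b =>
    seq (loop .u (fun _ => false) fun _ => seq (push .uy true) (push .uy true)) <|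
    seq (move .uy .u id) (bif b then push .u true else skip))
    (fun p l => { s with
      t := l, u := List.replicate (p.foldl (fun v b => 2 * v + b.toNat) 0) true, uy := [] })
    (fun _ _ => rfl) (natKey x) hn' (fun p b l hp => by
      have hle : (p ++ [b]).foldl (fun v b => 2 * v + b.toNat) 0 ≤ x := by
        refine (foldl_bits_le _ l 0).trans ?_
        rw [List.append_assoc, List.singleton_append, hp, foldl_natKey]
      rw [List.foldl_append, List.foldl_cons, List.foldl_nil] at hle ⊢
      generalize p.foldl (fun v b => 2 * v + b.toNat) 0 = v at *
      have h1 := runs_loop (S := Mem B) (k := .u) (n := n)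
        (c := fun _ => seq (push .uy true) (push .uy true))
        (fun p q => { s with t := l, u := q, uy := List.replicate (2 * p.length) true })
        (fun _ _ => rfl) (List.replicate v true) (by simp; omega) (fun p a q _ => by
          refine runs_seq rfl ?_
          rw [List.length_append, List.length_singleton, Nat.mul_add, Nat.mul_one,
            List.replicate_succ, List.replicate_succ]
          exact rfl)
      rw [List.length_replicate] at h1
      refine runs_seq h1 ?_
      refine runs_seq (runs_move (by decide) _ (by
        change (List.replicate _ true).length ≤ n; simp; omega)) ?_
      have hu : ((List.replicate (2 * v) true).map id).reverse ++ [] =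
        List.replicate (2 * v) true := by simp
      change Runs n _ { s with
        t := l, u := ((List.replicate (2 * v) true).map id).reverse ++ [], uy := [] } _
      rw [hu]
      cases b <;> exact rfl)
  rw [foldl_natKey] at this
  exact this

/-- Push on `v` the letter of `g` whose position from the bottom is the binary number on `t`. -/
def lookup : Cmd (Stk.letters B) :=
  seq unary <| seq (move .g .gy id) <|
  seq (loop .u (fun _ => false) fun _ => pop .gy fun o => o.elim skip fun a => push .g a) <|
  seq (pop .gy fun o => o.elim skip fun a => seq (push .gy a) (push .v a)) (move .gy .g id)

/-- Turning `g` over onto `gy` brings the bottom letter to the top; after `x` letters have been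
moved back, the wanted one is on top of `gy`. Moving the rest back restores `g`. -/
theorem runs_lookup (s : Mem B) (l : List Bool) (x : ℕ) (hx : x < l.length)
    (hn : l.length ≤ n) (hn' : (natKey x).length ≤ n) :
    Runs n (lookup (B := B)) { s with t := natKey x, u := [], uy := [], g := l.reverse, gy := [] }
      { s with t := [], u := [], uy := [], g := l.reverse, gy := [], v := l[x] :: s.v } := by
  refine runs_seq (runs_unary { s with g := l.reverse, gy := [] } (by omega) hn') ?_
  refine runs_seq (runs_move (by decide) _ (by change (List.reverse _).length ≤ n; simpa)) ?_
  have hg : (l.reverse.map id).reverse ++ [] = l := by simp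
  have h1 := runs_loop (S := Mem B) (k := .u) (n := n)
    (c := fun _ => pop .gy fun o => o.elim skip fun a => push .g a)
    (fun p q => { s with
      t := [], u := q, uy := [], g := (l.take p.length).reverse, gy := l.drop p.length })
    (fun _ _ => rfl) (List.replicate x true) (by simp; omega) (fun p a q hp => by
      have hpx : p.length < l.length := by
        have := congrArg List.length hp
        simp at this
        omega
      refine runs_pop (a := l[p.length]) (l := l.drop (p.length + 1)) ?_ ?_
      · exact List.drop_eq_getElem_cons hpx
      · rw [List.length_append, List.length_singleton, List.take_succ_eq_append_getElem hpx,
          List.reverse_append]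
        exact rfl)
  rw [List.length_replicate] at h1
  refine runs_seq (s₁ := { s with
      t := [], u := [], uy := [], g := (l.take x).reverse, gy := l.drop x }) ?_ ?_
  · rw [← hg] at h1
    simp only [List.take_zero, List.drop_zero, List.length_nil] at h1
    rw [hg] at h1
    convert! h1 using 1
    change Mem.mk _ _ _ _ _ _ _ _ _ _ _ _ _ _ _ _ = Mem.mk _ _ _ _ _ _ _ _ _ _ _ _ _ _ _ _
    congr 1
  refine runs_seq (runs_pop (a := l[x]) (l := l.drop (x + 1)) (List.drop_eq_getElem_cons hx)
    (runs_seq rfl rfl)) ?_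
  have hfin : ((l[x] :: l.drop (x + 1)).map id).reverse ++ (l.take x).reverse = l.reverse := by
    rw [← List.drop_eq_getElem_cons hx, List.map_id, ← List.reverse_append, List.take_append_drop]
  have h2 := runs_move (S := Mem B) (n := n) (p := .gy) (q := .g) (by decide) id
    (s := { s with
      t := [], u := [], uy := [], g := (l.take x).reverse, gy := l[x] :: l.drop (x + 1),
      v := l[x] :: s.v }) (by
        change (l[x] :: l.drop (x + 1)).length ≤ n
        rw [← List.drop_eq_getElem_cons hx]
        simp; omega)
  change Runs n _ _ { s with
      t := [], u := [], uy := [], g := ((l[x] :: l.drop (x + 1)).map id).reverse ++ (l.take x).reverse,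
      gy := [], v := l[x] :: s.v } at h2
  rw [hfin] at h2
  exact h2

end Cmd

/-! ### Evaluation of formulas -/

/-- The bit carried by a letter. -/
def Letter.bit? {B : Finset BoolFun} : Letter B → Option Bool
  | .bit b => some b
  | _ => none

theorem Letter.filterMap_bit? {B : Finset BoolFun} (l : List Bool) :
    (l.map (Letter.bit (B := B))).filterMap Letter.bit? = l := by
  rw [List.filterMap_map]
  exact List.filterMap_some

/-- The assignment that differs from the constant `e₀` at most at the variable with the key `l`,
and only if this variable is not marked. -/
def probe (e₀ : Bool) (l : List Bool) (D : ℕ → Bool) (y : ℕ) : Bool :=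
  if natKey y = l ∧ D y = false then !e₀ else e₀

/-- Mark the variable with the key `l`. -/
def mark (l : List Bool) (D : ℕ → Bool) (y : ℕ) : Bool :=
  D y || decide (natKey y = l)

/-- The word of a formula in which the letter `gate` replaces the letter `var` at the marked
variables. -/
def BFormula.word {B : Finset BoolFun} (D : ℕ → Bool) : BFormula B → List (Letter B)
  | .var x => (bif D x then Letter.gate else Letter.var) :: encodeNumber B x
  | .app f args => Letter.fn f :: (List.ofFn (fun i => (args i).word D)).flatten

theorem BFormula.word_false {B : Finset BoolFun} (φ : BFormula B) :
    φ.word (fun _ => false) = φ.encode := by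
  induction φ with
  | var x => rfl
  | app f args ih => simp only [word, encode, ih]

theorem BFormula.length_word {B : Finset BoolFun} (D : ℕ → Bool) (φ : BFormula B) :
    (φ.word D).length = φ.encode.length := by
  induction φ with
  | var x => rfl
  | app f args ih => simp [word, encode, ih, List.length_flatten, List.map_ofFn, Function.comp_def]

namespace Cmd

open StackStore

variable {B : Finset BoolFun} {n : ℕ}

/-- Pop `r` values and continue accordingly. -/
def popN : ℕ → List Bool → (List Bool → Cmd (Stk.letters B)) → Cmd (Stk.letters B)
  | 0, acc, c => c acc
  | r + 1, acc, c => pop .v fun o => popN r (o.getD false :: acc) c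

theorem runs_popN {c : List Bool → Cmd (Stk.letters B)} (s : Mem B) {s' : Mem B}
    (l acc rest : List Bool) (h : Runs n (c (l.reverse ++ acc)) { s with v := rest } s') :
    Runs n (popN l.length acc c) { s with v := l ++ rest } s' := by
  induction l generalizing acc with
  | nil => exact h
  | cons a l ih =>
    refine runs_pop (a := a) (l := l ++ rest) rfl ?_
    exact ih (a :: acc) (by simpa using h)

/-- The treatment of a letter of a formula, read from right to left. -/
def formulaBody (e₀ : Bool) : Letter B → Cmd (Stk.letters B)
  | .fn f => seq (push .inp (.fn f))
      (popN f.1.arity [] fun l => push .v (f.1.2 fun i => l.reverse.getD i false))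
  | .bit b => seq (push .inp (.bit b)) (push .t b)
  | .sep => push .inp .sep
  | .var => cmp (seq (push .inp .gate) (push .v (!e₀))) (seq (push .inp .var) (push .v e₀))
  | .gate => seq (clear .t) (seq (push .inp .gate) (push .v e₀))

/-- Evaluate the formula on `inp` at the assignment given by the key on `x`. -/
def evalFormula (e₀ : Bool) : Cmd (Stk.letters B) :=
  seq (move .x .key id) <| seq (move .inp .w id) <|
  seq (loop .w (fun _ => false) (formulaBody e₀)) (clear .key)

/-- The iterations of the main loop of `evalFormula`. -/
abbrev FormulaLoop (n : ℕ) (e₀ : Bool) : ℕ → Mem B → Mem B → Prop :=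
  LoopRuns (Γ := Stk.letters B) .w (fun _ => false) (fun a => Runs n (formulaBody e₀ a))

/-- The memory during the evaluation of a formula. -/
def formulaMem (s : Mem B) (l : List Bool) (w inp : List (Letter B)) (v : List Bool) : Mem B :=
  { s with key := l.reverse, y := [], t := [], e := [], w := w, inp := inp, v := v }

/-- Read from the right, a number yields its end marker, then its bits with the most significant one
first. When the letter `var` or `gate` is reached, `t` therefore has the least significant bit on
top, as does the key in its reversed form `l.reverse`. -/
theorem loopRuns_formula_var (e₀ : Bool) (D : ℕ → Bool) (s : Mem B) (l : List Bool) (x : ℕ)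
    (hn : l.length + (BFormula.var (B := B) x).encode.length ≤ n)
    (w inp : List (Letter B)) (v : List Bool) (i : ℕ) (s' : Mem B)
    (h : FormulaLoop n e₀ i
      (formulaMem s l w ((BFormula.var x).word (mark l D) ++ inp) (probe e₀ l D x :: v)) s') :
    FormulaLoop n e₀
      (((BFormula.var (B := B) x).word D).length + i)
      (formulaMem s l (((BFormula.var x).word D).reverse ++ w) inp v) s' := by
  have hlen : (natKey x).length + l.length ≤ n := by
    simp [BFormula.encode, encodeNumber] at hn
    simp [natKey]
    omega
  set bits := Computability.encodeNat x with hbits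
  have hword : ∀ D, (BFormula.var (B := B) x).word D =
      (bif D x then Letter.gate else Letter.var) :: (bits.map Letter.bit ++ [Letter.sep]) :=
    fun _ => rfl
  have hrev : ((BFormula.var (B := B) x).word D).reverse ++ w =
      Letter.sep :: ((bits.map Letter.bit).reverse ++
        (bif D x then Letter.gate else Letter.var) :: w) := by
    rw [hword]; simp
  rw [hrev, hword, List.length_cons, List.length_append, List.length_singleton]
  have hlast : FormulaLoop n e₀ (i + 1)
      { s with
        key := l.reverse, y := [], t := bits, e := [],
        w := (bif D x then Letter.gate else Letter.var) :: w,
        inp := bits.map Letter.bit ++ Letter.sep :: inp, v := v } s' := by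
    refine .step rfl rfl ?_ h
    rw [hword]
    cases hD : D x
    · refine runs_cmp { s with
        w := w, inp := bits.map Letter.bit ++ Letter.sep :: inp, v := v } (by
          simpa [natKey, add_comm, ← hbits] using hlen) ?_
      have hiff : l.reverse = bits ↔ natKey x = l := by
        rw [natKey, List.reverse_eq_iff, eq_comm]
      by_cases hl : natKey x = l
      · rw [if_pos (hiff.2 hl)]
        refine runs_seq rfl ?_
        have hm : mark l D x = true := by simp [mark, hl]
        have hp : probe e₀ l D x = !e₀ := by simp [probe, hl, hD]
        rw [hm, hp]
        simp only [cond_true, List.cons_append, List.append_assoc, List.nil_append]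
        exact rfl
      · rw [if_neg (mt hiff.1 hl)]
        refine runs_seq rfl ?_
        have hm : mark l D x = false := by simp [mark, hl, hD]
        have hp : probe e₀ l D x = e₀ := by simp [probe, hl]
        rw [hm, hp]
        simp only [cond_false, List.cons_append, List.append_assoc, List.nil_append]
        exact rfl
    · refine runs_seq (runs_clear (by
        change bits.length ≤ n
        rw [natKey, List.length_reverse, ← hbits] at hlen
        omega)) ?_
      refine runs_seq rfl ?_
      have hm : mark l D x = true := by simp [mark, hD]
      have hp : probe e₀ l D x = e₀ := by simp [probe, hD]
      rw [hm, hp]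
      simp only [cond_true, List.cons_append, List.append_assoc, List.nil_append]
      exact rfl
  have hbit := LoopRuns.prepend (Γ := Stk.letters B) (S := Mem B) (n := n) (k := .w)
    (c := formulaBody e₀) (isLast := fun _ => false)
    (fun p q => { s with
      key := l.reverse, y := [], t := (p.filterMap Letter.bit?).reverse, e := [], w := q,
      inp := p.reverse ++ Letter.sep :: inp, v := v })
    (fun _ _ => rfl) (bits.map Letter.bit).reverse
    ((bif D x then Letter.gate else Letter.var) :: w) (fun _ _ => rfl)
    (fun p a q hp => by
      obtain ⟨b, -, rfl⟩ : ∃ b, b ∈ bits ∧ Letter.bit b = a := by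
        have : a ∈ (bits.map (Letter.bit (B := B))).reverse := by rw [← hp]; simp
        simpa using this
      refine runs_seq rfl ?_
      simp only [List.filterMap_append, List.reverse_append]
      exact rfl) (i := i + 1) (s' := s') (by
        rw [← List.map_reverse, Letter.filterMap_bit?, List.reverse_reverse, List.map_reverse,
          List.reverse_reverse]
        exact hlast)
  rw [List.length_reverse] at hbit
  have := LoopRuns.step (S := Mem B) (Γ := Stk.letters B) (k := .w) (isLast := fun _ => false)
    (R := fun a => Runs n (formulaBody e₀ a))
    (s := formulaMem s l (Letter.sep :: ((bits.map Letter.bit).reverse ++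
        (bif D x then Letter.gate else Letter.var) :: w)) inp v) rfl rfl rfl hbit
  convert! this using 1
  omega

/-- Prefix notation read backwards is evaluated on a stack of values: the arguments of a symbol are
complete when the symbol is met, the first one on top. The remaining iterations `h` are arbitrary,
which makes the statement composable in the induction on `φ`. -/
theorem loopRuns_formula (e₀ : Bool) (D : ℕ → Bool) (s : Mem B) (l : List Bool) (φ : BFormula B)
    (hn : l.length + φ.encode.length ≤ n)
    (w inp : List (Letter B)) (v : List Bool) (i : ℕ) (s' : Mem B)
    (h : FormulaLoop n e₀ i
      (formulaMem s l w (φ.word (mark l D) ++ inp) (φ.eval (probe e₀ l D) :: v)) s') :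
    FormulaLoop n e₀
      ((φ.word D).length + i) (formulaMem s l ((φ.word D).reverse ++ w) inp v) s' := by
  induction φ generalizing w inp v i s' with
  | var x => exact loopRuns_formula_var e₀ D s l x hn w inp v i s' h
  | app f args ih =>
    -- The same for a list of arguments: the tail `L` is consumed before its head `j`, because the
    -- word is read from the right.
    have hlist : ∀ (L : List (Fin f.1.arity)) (w inp : List (Letter B)) (v : List Bool) (i : ℕ)
        (s' : Mem B), FormulaLoop n e₀ i
          (formulaMem s l w ((L.map fun j => (args j).word (mark l D)).flatten ++ inp)
            ((L.map fun j => (args j).eval (probe e₀ l D)) ++ v)) s' →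
        FormulaLoop n e₀
          ((L.map fun j => (args j).word D).flatten.length + i)
          (formulaMem s l ((L.map fun j => (args j).word D).flatten.reverse ++ w) inp v) s' := by
      intro L
      induction L with
      | nil => intro w inp v i s' h; simpa using h
      | cons j L ihL =>
        intro w inp v i s' h
        have hj : l.length + (args j).encode.length ≤ n := by
          have : (args j).encode.length ≤
              (List.ofFn fun i => (args i).encode).flatten.length := by
            rw [List.length_flatten, List.map_ofFn, List.sum_ofFn]
            exact Finset.single_le_sum (f := fun i => (args i).encode.length)
              (fun _ _ => Nat.zero_le _) (Finset.mem_univ j)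
          simp only [BFormula.encode, List.length_cons] at hn
          omega
        have := ihL _ _ _ _ _ (ih j hj w _ _ i s' (by simpa using h))
        convert! this using 1
        · simp; omega
        · simp only [List.map_cons, List.flatten_cons, List.reverse_append, List.append_assoc]
    have h1 : FormulaLoop n e₀ (i + 1)
        (formulaMem s l (Letter.fn f :: w)
          ((List.ofFn fun j => (args j).word (mark l D)).flatten ++ inp)
          ((List.ofFn fun j => (args j).eval (probe e₀ l D)) ++ v)) s' := by
      refine .step rfl rfl (runs_seq rfl ?_) h
      have := runs_popN (n := n)
        (c := fun l => push .v (f.1.2 fun i => l.reverse.getD i false))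
        (formulaMem s l w (Letter.fn f :: ((List.ofFn fun j => (args j).word (mark l D)).flatten ++
          inp)) v)
        (List.ofFn fun j => (args j).eval (probe e₀ l D)) [] v (runs_push _ _ _)
      rw [List.length_ofFn] at this
      convert! this using 1
      have : (fun i : Fin f.1.arity => ((List.ofFn fun j =>
          (args j).eval (probe e₀ l D)).reverse ++ []).reverse.getD i false) =
          fun i => (args i).eval (probe e₀ l D) := by
        funext i
        simp
      rw [this]
      exact rfl
    rw [List.ofFn_eq_map, List.ofFn_eq_map] at h1
    have := hlist _ _ _ _ _ _ h1
    rw [← List.ofFn_eq_map] at this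
    convert! this using 1
    · simp [BFormula.word]; omega
    · simp [BFormula.word]

theorem runs_evalFormula (e₀ : Bool) (D : ℕ → Bool) (z : List (Letter B)) (kb m l : List Bool)
    (φ : BFormula B) (hn : l.length + φ.encode.length ≤ n) :
    Runs n (evalFormula e₀) { inp := φ.word D, x := l, z := z, kb := kb, m := m : Mem B }
      { inp := φ.word (mark l D), v := [φ.eval (probe e₀ l D)], z := z, kb := kb, m := m } := by
  have hlen := φ.length_word D
  have hlen' := φ.length_word (mark l D)
  refine runs_seq (runs_move (by decide) _ (by change l.length ≤ n; omega)) ?_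
  refine runs_seq (runs_move (by decide) _ (by change (φ.word D).length ≤ n; omega)) ?_
  have := loopRuns_formula (n := n) e₀ D { z := z, kb := kb, m := m } l φ hn [] [] [] 0 _ (.done rfl)
  rw [List.append_nil, List.append_nil] at this
  refine runs_seq (s₁ := formulaMem { z := z, kb := kb, m := m } l [] (φ.word (mark l D))
    [φ.eval (probe e₀ l D)]) ⟨(φ.word D).length + 0, by omega, ?_⟩ ?_
  · convert! this using 1
    change Mem.mk _ _ _ _ _ _ _ _ _ _ _ _ _ _ _ _ = Mem.mk _ _ _ _ _ _ _ _ _ _ _ _ _ _ _ _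
    simp only [List.map_id]
    congr 1
    · exact List.append_nil _
    · exact List.append_nil _
  · exact runs_clear (by change l.reverse.length ≤ n; simp; omega)

end Cmd

/-! ### Evaluation of circuits -/

/-- The word of a wire, in which the letter `var` replaces the end marker at the marked
variables. -/
def Wire.word (B : Finset BoolFun) (D : ℕ → Bool) {m : ℕ} : Wire m → List (Letter B)
  | .var x => Letter.var :: ((Computability.encodeNat x).map Letter.bit ++
      [bif D x then Letter.var else Letter.sep])
  | .gate j => Letter.gate :: encodeNumber B (j : ℕ)

/-- The word of the gates, with the words of the wires changed at the marked variables. -/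
def GateSeq.word {B : Finset BoolFun} (D : ℕ → Bool) : {m : ℕ} → GateSeq B m → List (Letter B)
  | _, .nil => []
  | _, .snoc G f args =>
      G.word D ++ Letter.fn f :: (List.ofFn (fun i => (args i).word B D)).flatten

/-- The word of a circuit, with the words of the wires changed at the marked variables. -/
def BCircuit.word {B : Finset BoolFun} (D : ℕ → Bool) (C : BCircuit B) : List (Letter B) :=
  C.gates.word D ++ C.out.word B D

theorem Wire.word_false (B : Finset BoolFun) {m : ℕ} (w : Wire m) :
    w.word B (fun _ => false) = w.encode B := by
  cases w <;> rfl

theorem GateSeq.word_false {B : Finset BoolFun} {m : ℕ} (G : GateSeq B m) :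
    G.word (fun _ => false) = G.encode := by
  induction G with
  | nil => rfl
  | snoc G f args ih => simp only [word, encode, ih, Wire.word_false]

theorem BCircuit.word_false {B : Finset BoolFun} (C : BCircuit B) :
    C.word (fun _ => false) = C.encode := by
  rw [word, encode, GateSeq.word_false, Wire.word_false]

theorem Wire.length_word (B : Finset BoolFun) (D : ℕ → Bool) {m : ℕ} (w : Wire m) :
    (w.word B D).length = (w.encode B).length := by
  cases w <;> simp [word, encode, encodeNumber]

theorem GateSeq.length_word {B : Finset BoolFun} (D : ℕ → Bool) {m : ℕ} (G : GateSeq B m) :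
    (G.word D).length = G.encode.length := by
  induction G with
  | nil => rfl
  | snoc G f args ih =>
    simp [word, encode, ih, List.length_flatten, List.map_ofFn, Function.comp_def,
      Wire.length_word]

theorem BCircuit.length_word {B : Finset BoolFun} (D : ℕ → Bool) (C : BCircuit B) :
    (C.word D).length = C.encode.length := by
  simp [word, encode, GateSeq.length_word, Wire.length_word]

theorem GateSeq.le_length_encode {B : Finset BoolFun} {m : ℕ} (G : GateSeq B m) :
    m ≤ G.encode.length := by
  induction G with
  | nil => exact le_rfl
  | snoc G f args ih => simp [encode]; omega

namespace Cmd

open StackStore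

variable {B : Finset BoolFun} {n : ℕ}

/-- Whether a letter ends a number. -/
def numberEnd : Letter B → Bool
  | .bit _ => false
  | _ => true

/-- Read the number of a variable or of a gate, and push its value. -/
def wireNumber (e₀ : Bool) (isVar : Bool) : Cmd (Stk.letters B) :=
  loop .inp numberEnd fun a => match a with
    | .bit b => seq (push .w (.bit b)) (push .t b)
    | .sep => bif isVar then
        cmp (seq (push .w .var) (push .v (!e₀))) (seq (push .w .sep) (push .v e₀))
      else seq (push .w .sep) lookup
    | .var => seq (clear .t) (seq (push .w .var) (push .v e₀))
    | _ => skip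

/-- Read the rest of a wire, and push its value. -/
def wireRest (e₀ : Bool) : Letter B → Cmd (Stk.letters B)
  | .var => seq (push .w .var) (wireNumber e₀ true)
  | .gate => seq (push .w .gate) (wireNumber e₀ false)
  | _ => skip

/-- Read a number of wires, and push their values. -/
def readWires (e₀ : Bool) : ℕ → Cmd (Stk.letters B)
  | 0 => skip
  | r + 1 => seq (pop .inp fun o => o.elim skip (wireRest e₀)) (readWires e₀ r)

/-- Read a gate, or the output, and push its value. -/
def circuitBody (e₀ : Bool) : Letter B → Cmd (Stk.letters B)
  | .fn f => seq (push .w (.fn f)) <| seq (readWires e₀ f.1.arity)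
      (popN f.1.arity [] fun l => push .g (f.1.2 fun i => l.getD i false))
  | a => wireRest e₀ a

/-- Evaluate the circuit on `inp` at the assignment given by the key on `x`. -/
def evalCircuit (e₀ : Bool) : Cmd (Stk.letters B) :=
  seq (move .x .y id) <| seq (move .y .key id) <|
  seq (loop .inp (fun _ => false) (circuitBody e₀)) <|
  seq (move .w .inp id) <| seq (clear .g) (clear .key)

/-- The memory during the evaluation of a circuit. -/
def circuitMem (s : Mem B) (l : List Bool) (inp w : List (Letter B)) (g v : List Bool) : Mem B :=
  { s with
    key := l, y := [], t := [], e := [], u := [], uy := [], gy := [], g := g.reverse, w := w,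
    inp := inp, v := v }

theorem runs_wireNumber (e₀ : Bool) (isVar : Bool) (s : Mem B) (l : List Bool) (x : ℕ)
    (z : Letter B) (hz : numberEnd z = true) (rest w : List (Letter B)) (g v : List Bool)
    {s' : Mem B} (hn : (natKey x).length < n)
    (h : Runs n (match z with
      | .bit b => seq (push .w (.bit b)) (push .t b)
      | .sep => bif isVar then
          cmp (seq (push .w .var) (push .v (!e₀))) (seq (push .w .sep) (push .v e₀))
        else seq (push .w .sep) lookup
      | .var => seq (clear .t) (seq (push .w .var) (push .v e₀))
      | _ => skip) { circuitMem s l rest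
          (((Computability.encodeNat x).map Letter.bit).reverse ++ w) g v with t := natKey x } s') :
    Runs n (wireNumber (B := B) e₀ isVar)
      (circuitMem s l ((Computability.encodeNat x).map Letter.bit ++ z :: rest) w g v) s' := by
  refine runs_loop_until (S := Mem B) (Γ := Stk.letters B) (k := .inp)
    (fun p q => { circuitMem s l q (p.reverse ++ w) g v with
      t := (p.filterMap Letter.bit?).reverse }) (fun _ _ => rfl)
    ((Computability.encodeNat x).map Letter.bit) rest z (by simpa [natKey] using hn)
    (fun a ha => ?_) hz (fun p a q hp => ?_) ?_
  · obtain ⟨b, -, rfl⟩ := List.mem_map.1 ha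
    rfl
  · obtain ⟨b, -, rfl⟩ : ∃ b, b ∈ Computability.encodeNat x ∧ Letter.bit b = a :=
      List.mem_map.1 (by rw [← hp]; simp)
    refine runs_seq rfl ?_
    simp only [List.filterMap_append, List.reverse_append]
    exact rfl
  · rw [Letter.filterMap_bit?]
    exact h

/-- The first letter `a` is split off because the caller pops it. As it is not a function symbol,
the main loop recognizes the output of a circuit by it. -/
theorem runs_wireRest (e₀ : Bool) (D : ℕ → Bool) (s : Mem B) (l : List Bool) {m : ℕ}
    (u : Wire m) (G : Fin m → Bool) (hn : l.length + (u.encode B).length ≤ n) (hm : m ≤ n)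
    (rest w : List (Letter B)) (v : List Bool) :
    ∃ a L, u.word B D ++ rest = a :: L ∧ (∀ f, a ≠ .fn f) ∧
      Runs n (wireRest e₀ a) (circuitMem s l L w (List.ofFn G) v)
        (circuitMem s l rest ((u.word B (mark l D)).reverse ++ w) (List.ofFn G)
          (u.eval (probe e₀ l D) G :: v)) := by
  cases u with
  | var x =>
    have hlen : l.length + (natKey x).length < n := by
      simp [Wire.encode, encodeNumber] at hn
      simp [natKey]
      omega
    refine ⟨Letter.var, (Computability.encodeNat x).map Letter.bit ++
      (bif D x then Letter.var else Letter.sep) :: rest, by simp [Wire.word], by simp, ?_⟩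
    refine runs_seq rfl ?_
    refine runs_wireNumber e₀ true s l x _ (by cases D x <;> rfl) rest (Letter.var :: w)
      (List.ofFn G) v (by omega) ?_
    have hword : ∀ D, ((Wire.var (m := m) x).word B D).reverse ++ w =
        (bif D x then Letter.var else Letter.sep) ::
          (((Computability.encodeNat x).map Letter.bit).reverse ++ Letter.var :: w) := by
      intro D; simp [Wire.word]
    rw [hword]
    cases hD : D x
    · refine runs_cmp (q := l) (r := natKey x) (circuitMem s l rest
        (((Computability.encodeNat x).map Letter.bit).reverse ++ Letter.var :: w)
        (List.ofFn G) v) (by omega) ?_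
      by_cases hl : natKey x = l
      · rw [if_pos hl.symm]
        refine runs_seq rfl ?_
        have hm : mark l D x = true := by simp [mark, hl]
        have hp : probe e₀ l D x = !e₀ := by simp [probe, hl, hD]
        rw [hm, Wire.eval, hp]
        exact rfl
      · rw [if_neg (Ne.symm hl)]
        refine runs_seq rfl ?_
        have hm : mark l D x = false := by simp [mark, hl, hD]
        have hp : probe e₀ l D x = e₀ := by simp [probe, hl]
        rw [hm, Wire.eval, hp]
        exact rfl
    · refine runs_seq (runs_clear (by change (natKey x).length ≤ n; omega)) ?_
      refine runs_seq rfl ?_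
      have hm : mark l D x = true := by simp [mark, hD]
      have hp : probe e₀ l D x = e₀ := by simp [probe, hD]
      rw [hm, Wire.eval, hp]
      exact rfl
  | gate j =>
    have hlen : l.length + (natKey j).length < n := by
      simp [Wire.encode, encodeNumber] at hn
      simp [natKey]
      omega
    refine ⟨Letter.gate, (Computability.encodeNat j).map Letter.bit ++
      Letter.sep :: rest, by simp [Wire.word, encodeNumber], by simp, ?_⟩
    refine runs_seq rfl ?_
    refine runs_wireNumber e₀ false s l j _ rfl rest (Letter.gate :: w)
      (List.ofFn G) v (by omega) ?_
    have hword : ((Wire.gate j).word B (mark l D)).reverse ++ w =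
        Letter.sep :: (((Computability.encodeNat j).map Letter.bit).reverse ++
          Letter.gate :: w) := by
      simp [Wire.word, encodeNumber]
    rw [hword]
    refine runs_seq rfl ?_
    have := runs_lookup (n := n) (circuitMem s l rest (Letter.sep ::
      (((Computability.encodeNat j).map Letter.bit).reverse ++ Letter.gate :: w)) (List.ofFn G) v)
      (List.ofFn G) j (by simp) (by simpa) (by omega)
    rw [List.getElem_ofFn] at this
    exact this

theorem runs_readWires (e₀ : Bool) (D : ℕ → Bool) (s : Mem B) (l : List Bool) {m : ℕ}
    (G : Fin m → Bool) (hm : m ≤ n) (us : List (Wire m))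
    (hn : ∀ u ∈ us, l.length + (u.encode B).length ≤ n)
    (rest w : List (Letter B)) (v : List Bool) :
    Runs n (readWires e₀ us.length)
      (circuitMem s l ((us.map (Wire.word B D)).flatten ++ rest) w (List.ofFn G) v)
      (circuitMem s l rest ((us.map (Wire.word B (mark l D))).flatten.reverse ++ w) (List.ofFn G)
        ((us.map (Wire.eval (probe e₀ l D) G)).reverse ++ v)) := by
  induction us generalizing w v with
  | nil => exact rfl
  | cons u us ih =>
    obtain ⟨a, L, hL, -, hr⟩ := runs_wireRest e₀ D s l u G (hn u (by simp)) hm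
      ((us.map (Wire.word B D)).flatten ++ rest) w v
    refine runs_seq (runs_pop (S := Mem B) (a := a) (l := L) ?_ hr) ?_
    · change ((u :: us).map (Wire.word B D)).flatten ++ rest = a :: L
      rw [← hL]; simp
    · have := ih (fun u hu => hn u (by simp [hu])) ((u.word B (mark l D)).reverse ++ w)
        (u.eval (probe e₀ l D) G :: v)
      simpa using this

/-- The iterations of the main loop of `evalCircuit`. -/
abbrev CircuitLoop (n : ℕ) (e₀ : Bool) : ℕ → Mem B → Mem B → Prop :=
  LoopRuns (Γ := Stk.letters B) .inp (fun _ => false) (fun a => Runs n (circuitBody e₀ a))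

/-- The body consumes a function symbol together with all its wires, so there is one iteration per
gate. The values of the earlier gates are on `g`, gate 0 at the bottom, which is the order required
by `lookup`. -/
theorem loopRuns_gates (e₀ : Bool) (D : ℕ → Bool) (s : Mem B) (l : List Bool) {m : ℕ}
    (G : GateSeq B m) (hn : l.length + G.encode.length ≤ n)
    (rest : List (Letter B)) (i : ℕ) (s' : Mem B)
    (h : CircuitLoop n e₀ i
      (circuitMem s l rest (G.word (mark l D)).reverse (List.ofFn (G.eval (probe e₀ l D))) []) s') :
    CircuitLoop n e₀ (m + i) (circuitMem s l (G.word D ++ rest) [] [] []) s' := by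
  induction G generalizing rest i s' with
  | nil => simpa [GateSeq.word] using h
  | @snoc m G f args ih =>
    have hm := G.le_length_encode
    simp only [GateSeq.encode, List.length_append, List.length_cons] at hn
    have := ih (by omega) (Letter.fn f :: ((List.ofFn (fun i => (args i).word B D)).flatten ++ rest))
      (i + 1) s' (.step rfl rfl (runs_seq rfl (runs_seq
        (s₁ := circuitMem s l rest
          ((List.ofFn (fun i => (args i).word B (mark l D))).flatten.reverse ++
            Letter.fn f :: (G.word (mark l D)).reverse) (List.ofFn (G.eval (probe e₀ l D)))
          ((List.ofFn fun i => (args i).eval (probe e₀ l D) (G.eval (probe e₀ l D))).reverse ++ []))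
        ?_ ?_)) h)
    · convert! this using 1
      · omega
      · simp [GateSeq.word]
    · have := runs_readWires (n := n) e₀ D s l (G.eval (probe e₀ l D)) (by omega) (List.ofFn args)
        (by
          intro u hu
          obtain ⟨i, rfl⟩ := List.mem_ofFn.1 hu
          have : ((args i).encode B).length ≤
              (List.ofFn fun i => (args i).encode B).flatten.length := by
            rw [List.length_flatten, List.map_ofFn, List.sum_ofFn]
            exact Finset.single_le_sum (f := fun i => ((args i).encode B).length)
              (fun _ _ => Nat.zero_le _) (Finset.mem_univ i)
          omega) rest (Letter.fn f :: (G.word (mark l D)).reverse) []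
      rw [List.length_ofFn, List.map_ofFn, List.map_ofFn, List.map_ofFn] at this
      exact this
    · have := runs_popN (n := n)
        (c := fun l => push .g (f.1.2 fun i => l.getD i false))
        (circuitMem s l rest
          ((List.ofFn (fun i => (args i).word B (mark l D))).flatten.reverse ++
            Letter.fn f :: (G.word (mark l D)).reverse) (List.ofFn (G.eval (probe e₀ l D))) [])
        (List.ofFn fun i => (args i).eval (probe e₀ l D) (G.eval (probe e₀ l D))).reverse [] []
        (runs_push _ _ _)
      rw [List.length_reverse, List.length_ofFn] at this
      convert! this using 1
      have hv : (fun i : Fin f.1.arity => ((List.ofFn fun i =>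
          (args i).eval (probe e₀ l D) (G.eval (probe e₀ l D))).reverse.reverse ++ []).getD i
            false) = fun i => (args i).eval (probe e₀ l D) (G.eval (probe e₀ l D)) := by
        funext i
        simp
      have hw : ((GateSeq.snoc G f args).word (mark l D)).reverse =
          (List.ofFn (fun i => (args i).word B (mark l D))).flatten.reverse ++
            Letter.fn f :: (G.word (mark l D)).reverse := by
        simp [GateSeq.word]
      have hg : (List.ofFn ((GateSeq.snoc G f args).eval (probe e₀ l D))).reverse =
          f.1.2 (fun i => (args i).eval (probe e₀ l D) (G.eval (probe e₀ l D))) ::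
            (List.ofFn (G.eval (probe e₀ l D))).reverse := by
        rw [List.ofFn_succ', List.concat_eq_append, List.reverse_append]
        simp [GateSeq.eval]
      rw [hv, circuitMem, hw, hg]
      exact rfl

theorem runs_evalCircuit (e₀ : Bool) (D : ℕ → Bool) (z : List (Letter B)) (kb m l : List Bool)
    (C : BCircuit B) (hn : l.length + C.encode.length ≤ n) :
    Runs n (evalCircuit e₀) { inp := C.word D, x := l, z := z, kb := kb, m := m : Mem B }
      { inp := C.word (mark l D), v := [C.eval (probe e₀ l D)], z := z, kb := kb, m := m } := by
  have hlen' := C.length_word (mark l D)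
  have hC : C.encode.length = C.gates.encode.length + (C.out.encode B).length := by
    simp [BCircuit.encode]
  have hm := C.gates.le_length_encode
  have hout : 0 < (C.out.encode B).length := by cases C.out <;> simp [Wire.encode]
  refine runs_seq (runs_move (by decide) _ (by change l.length ≤ n; omega)) ?_
  -- The key is moved twice and so keeps its orientation: the numbers in a circuit are read from
  -- left to right, which leaves the most significant bit on top of `t`.
  refine runs_seq (runs_move (by decide) _ (by
    change ((l.map id).reverse ++ []).length ≤ n; simp; omega)) ?_
  obtain ⟨a, L, hL, ha, hr⟩ := runs_wireRest (n := n) e₀ D { z := z, kb := kb, m := m } l C.out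
    (C.gates.eval (probe e₀ l D)) (by omega) (by omega) [] (C.gates.word (mark l D)).reverse []
  have hr' : Runs n (circuitBody e₀ a) (circuitMem { z := z, kb := kb, m := m } l L
      (C.gates.word (mark l D)).reverse (List.ofFn (C.gates.eval (probe e₀ l D))) [])
      (circuitMem { z := z, kb := kb, m := m } l []
        ((C.out.word B (mark l D)).reverse ++ (C.gates.word (mark l D)).reverse)
        (List.ofFn (C.gates.eval (probe e₀ l D))) [C.eval (probe e₀ l D)]) := by
    cases a with
    | fn f => exact absurd rfl (ha f)
    | _ => exact hr
  have hloop := loopRuns_gates (n := n) e₀ D { z := z, kb := kb, m := m } l C.gates (by omega)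
    (C.out.word B D ++ []) 1 _ (by rw [hL]; exact .step rfl rfl hr' (.done rfl))
  refine runs_seq (s₁ := circuitMem { z := z, kb := kb, m := m } l []
    ((C.out.word B (mark l D)).reverse ++ (C.gates.word (mark l D)).reverse)
    (List.ofFn (C.gates.eval (probe e₀ l D))) [C.eval (probe e₀ l D)])
    ⟨C.m + 1, by omega, ?_⟩ ?_
  · have h1 : ((((l.map id).reverse ++ []).map id).reverse ++ [] : List Bool) = l := by simp
    have h2 : C.word D = C.gates.word D ++ (C.out.word B D ++ []) := by simp [BCircuit.word]
    change CircuitLoop n e₀ _ (Mem.mk (C.word D) [] z kb []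
      ((((l.map id).reverse ++ []).map id).reverse ++ []) [] [] [] [] [] [] [] m [] []) _
    rw [h1, h2]
    exact hloop
  · refine runs_seq (runs_move (by decide) _ (by
      change (_ ++ _ : List (Letter B)).length ≤ n
      rw [← List.reverse_append, List.length_reverse, ← BCircuit.word]; omega)) ?_
    refine runs_seq (runs_clear (by
      change (List.reverse _).length ≤ n; simp; omega)) ?_
    have := runs_clear (n := n) (p := .key)
      (s := Mem.mk (C.word (mark l D)) [] z kb [] l [] [] [C.eval (probe e₀ l D)] [] [] [] [] m [] [])
      (by change l.length ≤ n; omega)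
    convert! this using 1
    have h3 : ((((C.out.word B (mark l D)).reverse ++
        (C.gates.word (mark l D)).reverse).map id).reverse ++ []) = C.word (mark l D) := by
      simp [BCircuit.word]
    rw [← h3]
    exact rfl

end Cmd

/-! ### Counting the variables on which a function depends -/

/-- The binary numbers that are closed by an end marker in a word, most significant bit first. -/
def keys {B : Finset BoolFun} : List (Letter B) → List Bool → List (List Bool)
  | [], _ => []
  | .bit b :: w, acc => keys w (b :: acc)
  | .sep :: w, acc => acc :: keys w []
  | _ :: w, acc => keys w acc

/-- The number of keys at which a function is found to differ from `c`, when the keys are probed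
one after the other, and marked. -/
def hits (e₀ c : Bool) (F : (ℕ → Bool) → Bool) : List (List Bool) → (ℕ → Bool) → ℕ
  | [], _ => 0
  | l :: ls, D => hits e₀ c F ls (mark l D) + (bif F (probe e₀ l D) == c then 0 else 1)

theorem keys_length_le {B : Finset BoolFun} (w : List (Letter B)) (acc : List Bool) :
    (keys w acc).length ≤ w.length := by
  induction w generalizing acc with
  | nil => exact le_rfl
  | cons a w ih => cases a <;> simp only [keys, List.length_cons] <;> grind

theorem hits_le (e₀ c : Bool) (F : (ℕ → Bool) → Bool) (ls : List (List Bool)) (D : ℕ → Bool) :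
    hits e₀ c F ls D ≤ ls.length := by
  induction ls generalizing D with
  | nil => exact le_rfl
  | cons l ls ih =>
    have := ih (mark l D)
    simp only [hits, List.length_cons]
    cases F (probe e₀ l D) == c <;> simp <;> omega

theorem probe_of_forall {e₀ : Bool} {l : List Bool} {D : ℕ → Bool}
    (h : ∀ y, natKey y = l → D y = true) : probe e₀ l D = fun _ => e₀ := by
  funext y
  rw [probe, if_neg]
  rintro ⟨h1, h2⟩
  simp [h y h1] at h2

theorem probe_natKey {e₀ : Bool} {D : ℕ → Bool} {y : ℕ} (h : D y = false) :
    probe e₀ (natKey y) D = Function.update (fun _ => e₀) y (!e₀) := by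
  funext x
  by_cases hx : x = y
  · subst hx; simp [probe, h]
  · rw [probe, if_neg fun h => hx (natKey_injective h.1), Function.update_of_ne hx]

/-- The marks prevent a repeated key from being counted twice. A key that belongs to no unmarked
variable probes the constant assignment and gives no hit; the number of a gate that is not a
variable of the circuit is equally harmless. -/
theorem hits_eq_card {e₀ c : Bool} {F : (ℕ → Bool) → Bool} (hc : F (fun _ => e₀) = c)
    (T : Finset ℕ) (hT : ∀ y, y ∈ T ↔ F (Function.update (fun _ => e₀) y (!e₀)) ≠ c)
    (ls : List (List Bool)) (D : ℕ → Bool) :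
    hits e₀ c F ls D = (T.filter fun y => D y = false ∧ natKey y ∈ ls).card := by
  induction ls generalizing D with
  | nil => simp [hits]
  | cons l ls ih =>
    rw [hits, ih]
    by_cases h : ∃ y, natKey y = l ∧ D y = false
    · obtain ⟨y, rfl, hy⟩ := h
      rw [probe_natKey hy]
      by_cases hyT : y ∈ T
      · have h1 : (F (Function.update (fun _ => e₀) y (!e₀)) == c) = false := by
          simpa using (hT y).1 hyT
        rw [h1, cond_false, ← Finset.card_insert_of_notMem (a := y) (by simp [mark])]
        congr 1
        ext x
        simp only [Finset.mem_insert, Finset.mem_filter, mark, Bool.or_eq_false_iff,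
          decide_eq_false_iff_not, List.mem_cons, natKey_injective.eq_iff]
        grind
      · have h1 : (F (Function.update (fun _ => e₀) y (!e₀)) == c) = true := by
          have := mt (hT y).2 hyT
          simpa using this
        rw [h1, cond_true, add_zero]
        congr 1
        ext x
        simp only [Finset.mem_filter, mark, Bool.or_eq_false_iff,
          decide_eq_false_iff_not, List.mem_cons, natKey_injective.eq_iff]
        grind
    · have h' : ∀ y, natKey y = l → D y = true := fun y hy => by
        by_contra hD
        exact h ⟨y, hy, by simpa using hD⟩
      rw [probe_of_forall h', hc, beq_self_eq_true, cond_true, add_zero]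
      congr 1
      ext x
      simp only [Finset.mem_filter, mark, Bool.or_eq_false_iff,
        decide_eq_false_iff_not, List.mem_cons]
      grind

/-! ### The decision procedure -/

namespace Cmd

open StackStore

variable {B : Finset BoolFun} {n : ℕ}

/-- The treatment of a letter during the search for the variables on which the value depends. -/
def scanBody (ev : Cmd (Stk.letters B)) (c : Bool) : Letter B → Cmd (Stk.letters B)
  | .bit b => push .x b
  | .sep => seq ev (pop .v fun o => bif o == some c then skip else push .m true)
  | _ => skip

/-- `Evaluates n ev e₀ W F`: the program `ev` evaluates the function `F` with the words `W` at the
assignments given by keys. -/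
def Evaluates (n : ℕ) (ev : Cmd (Stk.letters B)) (e₀ : Bool) (N : ℕ)
    (W : (ℕ → Bool) → List (Letter B)) (F : (ℕ → Bool) → Bool) : Prop :=
  ∀ (D : ℕ → Bool) (z : List (Letter B)) (kb m l : List Bool), l.length + N ≤ n →
    Runs n ev { inp := W D, x := l, z := z, kb := kb, m := m : Mem B }
      { inp := W (mark l D), v := [F (probe e₀ l D)], z := z, kb := kb, m := m }

/-- The keys are read from the unmarked copy `z`, since the evaluations change the word on `inp`.
The final marks `D'` and the leftover bits `acc'` are irrelevant and are cleared later; only their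
lengths matter. -/
theorem runs_scan {ev : Cmd (Stk.letters B)} {e₀ : Bool} {N : ℕ}
    {W : (ℕ → Bool) → List (Letter B)} {F : (ℕ → Bool) → Bool} (hev : Evaluates n ev e₀ N W F)
    (c : Bool) (z : List (Letter B)) (acc : List Bool) (D : ℕ → Bool) (kb : List Bool) (r : ℕ)
    (hn : acc.length + z.length + N ≤ n) :
    ∃ D' acc', acc'.length ≤ acc.length + z.length ∧
      LoopRuns (Γ := Stk.letters B) .z (fun _ => false) (fun a => Runs n (scanBody ev c a)) z.length
        { inp := W D, x := acc, z := z, kb := kb, m := List.replicate r true : Mem B }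
        { inp := W D', x := acc', kb := kb,
          m := List.replicate (hits e₀ c F (keys z acc) D + r) true } := by
  induction z generalizing acc D r with
  | nil => exact ⟨D, acc, by simp, by simpa [keys, hits] using LoopRuns.done rfl⟩
  | cons a z ih =>
    rw [List.length_cons] at hn ⊢
    cases a with
    | bit b =>
      obtain ⟨D', acc', hacc, hL⟩ := ih (b :: acc) D r (by simp; omega)
      exact ⟨D', acc', by simp at hacc; omega, .step rfl rfl rfl hL⟩
    | sep =>
      have hr := hev D z kb (List.replicate r true) acc (by omega)
      cases hF : F (probe e₀ acc D) == c with
      | true =>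
        obtain ⟨D', acc', hacc, hL⟩ := ih [] (mark acc D) r (by simp; omega)
        have he : hits e₀ c F (keys (Letter.sep :: z) acc) D + r =
          hits e₀ c F (keys z []) (mark acc D) + r := by simp [keys, hits, hF]
        rw [he]
        refine ⟨D', acc', by simp at hacc; omega,
          .step rfl rfl (runs_seq hr (runs_pop rfl ?_)) hL⟩
        have : (some (F (probe e₀ acc D)) == some c) = true := hF
        rw [this]
        exact rfl
      | false =>
        obtain ⟨D', acc', hacc, hL⟩ := ih [] (mark acc D) (r + 1) (by simp; omega)
        have he : hits e₀ c F (keys (Letter.sep :: z) acc) D + r =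
            hits e₀ c F (keys z []) (mark acc D) + (r + 1) := by
          rw [keys, hits, hF, cond_false, add_assoc, add_comm 1 r]
        rw [he]
        refine ⟨D', acc', by simp at hacc; omega,
          .step rfl rfl (runs_seq hr (runs_pop rfl ?_)) hL⟩
        have : (some (F (probe e₀ acc D)) == some c) = false := hF
        rw [this]
        exact rfl
    | _ =>
      obtain ⟨D', acc', hacc, hL⟩ := ih acc D r (by omega)
      exact ⟨D', acc', by omega, .step rfl rfl rfl hL⟩

/-- One round of the computation of `h`: count `r` letters of `m`. -/
def tableStep (h : ℕ → ℕ) (a q : ℕ) : ℕ → ℕ → Cmd (Stk.letters B)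
  | 0, _ => seq (pushList (k := .m) (List.replicate (a + 1) true))
      (pushList (k := .u) (List.replicate q true))
  | r + 1, i => pop .m fun o => match o with
    | none => pushList (k := .u) (List.replicate (h i) true)
    | some _ => tableStep h a q r (i + 1)

/-- Replace `x + 1` letters on `m` by `h x` letters on `u`, where `h (x + p) = h x + q` for
`x ≥ a`. -/
def table (h : ℕ → ℕ) (a p q : ℕ) : Cmd (Stk.letters B) :=
  loop .m (fun _ => false) fun _ => tableStep h a q (a + p) 0

theorem runs_tableStep_lt (h : ℕ → ℕ) (a q : ℕ) (s : Mem B) (u : List Bool) (r i x : ℕ)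
    (hx : x < r) : Runs n (tableStep h a q r i) { s with m := List.replicate x true, u := u }
      { s with m := [], u := List.replicate (h (i + x)) true ++ u } := by
  induction r generalizing i x with
  | zero => omega
  | succ r ih =>
    cases x with
    | zero => exact runs_pop_nil rfl (runs_pushList (Γ := Stk.letters B) (k := .u) _ _)
    | succ x =>
      refine runs_pop (a := true) (l := List.replicate x true) rfl ?_
      have := ih (i + 1) x (by omega)
      rw [show i + 1 + x = i + (x + 1) by omega] at this
      exact this

theorem runs_tableStep_ge (h : ℕ → ℕ) (a q : ℕ) (s : Mem B) (u : List Bool) (r i x : ℕ) :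
    Runs n (tableStep h a q r i) { s with m := List.replicate (r + x) true, u := u }
      { s with m := List.replicate (a + 1 + x) true, u := List.replicate q true ++ u } := by
  induction r generalizing i with
  | zero =>
    rw [zero_add, List.replicate_add]
    exact runs_seq (runs_pushList (Γ := Stk.letters B) (k := .m) _ _)
      (runs_pushList (Γ := Stk.letters B) (k := .u) _ _)
  | succ r ih =>
    rw [Nat.add_right_comm]
    exact runs_pop (a := true) (l := List.replicate (r + x) true) rfl (ih (i + 1))

/-- The additional letter makes the loop run at least once, even for `x = 0`. A round with `x ≥ a +
p` removes `a + p + 1` letters and puts `a + 1` back, so it replaces `x` by `x - p` and contributes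
`q`; the last round reads `h x` from a finite table. -/
theorem runs_table {h : ℕ → ℕ} {a p q : ℕ} (hp : 0 < p) (hh : ∀ x, a ≤ x → h (x + p) = h x + q)
    (s : Mem B) (x : ℕ) (hn : x < n) :
    Runs n (table (B := B) h a p q) { s with m := List.replicate (x + 1) true, u := [] }
      { s with m := [], u := List.replicate (h x) true } := by
  have key : ∀ (x : ℕ) (u : List Bool), ∃ i ≤ x + 1,
      LoopRuns (Γ := Stk.letters B) .m (fun _ => false)
        (fun _ => Runs n (tableStep h a q (a + p) 0)) i
        { s with m := List.replicate (x + 1) true, u := u }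
        { s with m := [], u := List.replicate (h x) true ++ u } := by
    intro x
    induction x using Nat.strong_induction_on with
    | _ x ih =>
      intro u
      by_cases hx : x < a + p
      · refine ⟨1, by omega, .step (a := true) (l := List.replicate x true) rfl rfl
          (runs_tableStep_lt h a q s u (a + p) 0 x hx) ?_⟩
        rw [zero_add]
        exact .done rfl
      · obtain ⟨y, rfl⟩ := Nat.exists_eq_add_of_le (not_lt.1 hx)
        obtain ⟨i, hi, hL⟩ := ih (a + y) (by omega) (List.replicate q true ++ u)
        refine ⟨i + 1, by omega, .step (a := true) (l := List.replicate (a + p + y) true) rfl rfl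
          (runs_tableStep_ge h a q s u (a + p) 0 y) ?_⟩
        have he : List.replicate (h (a + p + y)) true ++ u =
            List.replicate (h (a + y)) true ++ (List.replicate q true ++ u) := by
          rw [show a + p + y = a + y + p by omega, hh _ (by omega), List.replicate_add,
            List.append_assoc]
        rw [he, show a + 1 + y = a + y + 1 by omega]
        exact hL
  obtain ⟨i, hi, hL⟩ := key x []
  rw [List.append_nil] at hL
  exact ⟨i, by omega, hL⟩

/-- Subtract the binary number on `kb` from the unary number on `u`, up to a power of two. -/
def compare : Cmd (Stk.letters B) :=
  loop .kb (fun _ => false) fun b =>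
    seq (bif b then pop .u fun _ => skip else skip) <|
    seq (loop .u (fun _ => false) fun _ => pop .u fun _ => push .uy true) (move .uy .u id)

/-- x ≤ 2v + b holds exactly if v is at least half of the truncated difference x − b, rounded up. -/
theorem foldl_half_eq_zero (l : List Bool) (x : ℕ) :
    l.foldl (fun x b => (x - b.toNat + 1) / 2) x = 0 ↔ x ≤ bitsValue l := by
  induction l generalizing x with
  | nil => simp [bitsValue]
  | cons b l ih =>
    rw [List.foldl_cons, ih]
    change _ ↔ x ≤ 2 * bitsValue l + b.toNat
    cases b <;> simp <;> omega

theorem foldl_half_le (l : List Bool) (x : ℕ) :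
    l.foldl (fun x b => (x - b.toNat + 1) / 2) x ≤ x := by
  induction l generalizing x with
  | nil => exact le_rfl
  | cons b l ih =>
    rw [List.foldl_cons]
    refine (ih _).trans ?_
    omega

/-- The number on `kb` may be exponentially large, so it is never written in unary: instead, the
unary number on `u` is halved once per bit. -/
theorem runs_compare (s : Mem B) (x : ℕ) (l : List Bool) (hn : x ≤ n) (hl : l.length ≤ n) :
    Runs n (compare (B := B)) { s with kb := l, u := List.replicate x true, uy := [] }
      { s with
        kb := [], uy := [],
        u := List.replicate (l.foldl (fun x b => (x - b.toNat + 1) / 2) x) true } := by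
  -- An iteration consumes two letters, or a single last one, and produces one; hence halves are
  -- rounded up.
  have hhalf : ∀ (s : Mem B) (x : ℕ) (r : List Bool),
      LoopRuns (Γ := Stk.letters B) .u (fun _ => false)
        (fun _ => Runs n (pop .u fun _ => push .uy true)) ((x + 1) / 2)
        { s with u := List.replicate x true, uy := r }
        { s with u := [], uy := List.replicate ((x + 1) / 2) true ++ r } := by
    intro s x
    induction x using Nat.strong_induction_on with
    | _ x ih =>
      intro r
      match x with
      | 0 => exact .done rfl
      | 1 => exact .step (a := true) (l := []) rfl rfl (runs_pop_nil rfl rfl) (.done rfl)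
      | x + 2 =>
        have := ih x (by omega) (true :: r)
        have he : List.replicate ((x + 1) / 2 + 1) true ++ r =
            List.replicate ((x + 1) / 2) true ++ true :: r := by
          rw [List.replicate_succ', List.append_assoc, List.singleton_append]
        rw [show (x + 2 + 1) / 2 = (x + 1) / 2 + 1 by omega, he]
        exact .step (a := true) (l := List.replicate (x + 1) true) rfl rfl
          (runs_pop (a := true) (l := List.replicate x true) rfl rfl) this
  refine runs_loop (S := Mem B) (Γ := Stk.letters B) (k := .kb) (fun p q => { s with
      kb := q, uy := [],
      u := List.replicate (p.foldl (fun x b => (x - b.toNat + 1) / 2) x) true })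
    (fun _ _ => rfl) l hl (fun p b q _ => ?_)
  have hle := (foldl_half_le p x).trans hn
  rw [List.foldl_append, List.foldl_cons, List.foldl_nil]
  generalize p.foldl (fun x b => (x - b.toNat + 1) / 2) x = y at *
  refine runs_seq (s₁ := { s with kb := q, uy := [], u := List.replicate (y - b.toNat) true })
    ?_ ?_
  · cases b with
    | false => exact rfl
    | true =>
      cases y with
      | zero => exact runs_pop_nil rfl rfl
      | succ y => exact runs_pop (a := true) (l := List.replicate y true) rfl rfl
  · refine runs_seq ⟨_, ?_, hhalf { s with kb := q } (y - b.toNat) []⟩ ?_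
    · omega
    · have := runs_move (n := n) (S := Mem B) (p := .uy) (q := .u) (by decide) id
        (s := { s with
          kb := q, u := [], uy := List.replicate ((y - b.toNat + 1) / 2) true ++ [] }) (by
          change (List.replicate _ true ++ []).length ≤ n; simp; omega)
      have he : ((List.replicate ((y - b.toNat + 1) / 2) true ++ []).map id).reverse ++ [] =
          List.replicate ((y - b.toNat + 1) / 2) true := by simp
      change Runs n _ _ { s with
        kb := q, u := ((List.replicate ((y - b.toNat + 1) / 2) true ++ []).map id).reverse ++ [],
        uy := [] } at this
      rw [he] at this
      exact this

/-- The part of the decision procedure that follows the evaluation of the constant `c`. -/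
def decideRest (ev : Cmd (Stk.letters B)) (h : ℕ → ℕ) (a p q : ℕ) (c : Bool) :
    Cmd (Stk.letters B) :=
  seq (move .inp .w id) <|
  seq (loop .w (fun _ => false) fun a => seq (push .inp a) (push .z a)) <|
  seq (loop .z (fun _ => false) (scanBody ev c)) <|
  seq (push .m true) <|
  seq (table h a p q) <|
  seq compare <|
  pop .u fun o => seq (clearAll Stk.all) (push .ans o.isNone)

/-- The decision procedure. -/
def decideSize (ev : Cmd (Stk.letters B)) (h : Bool → ℕ → ℕ) (a p q : Bool → ℕ) :
    Cmd (Stk.letters B) :=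
  seq (loop .inp numberEnd fun a => match a with
    | .bit b => push .t b
    | _ => skip) <|
  seq (move .t .kb id) <|
  seq (push .x false) <| seq ev <|
  pop .v fun o => decideRest ev (h (o.getD false)) (a (o.getD false)) (p (o.getD false))
    (q (o.getD false)) (o.getD false)

theorem runs_decideRest {ev : Cmd (Stk.letters B)} {e₀ : Bool} {N : ℕ}
    {W : (ℕ → Bool) → List (Letter B)} {F : (ℕ → Bool) → Bool} (hev : Evaluates n ev e₀ N W F)
    {h : ℕ → ℕ} {a p q : ℕ} (hp : 0 < p) (hh : ∀ x, a ≤ x → h (x + p) = h x + q) (c : Bool)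
    (D : ℕ → Bool) (kb : List Bool) (hN : ∀ D, (W D).length = N) (hkb : kb.length ≤ n)
    (hn : 2 * N < n) (hhn : ∀ x ≤ N, h x ≤ n) :
    Runs n (decideRest ev h a p q c) { inp := W D, kb := kb : Mem B }
      { ans := [decide (h (hits e₀ c F (keys (W D) []) D) ≤ bitsValue kb)] } := by
  have hlen := hN D
  refine runs_seq (runs_move (by decide) _ (by change (W D).length ≤ n; omega)) ?_
  refine runs_seq (s₁ := { inp := W D, z := W D, kb := kb }) ?_ ?_
  · have := runs_loop (S := Mem B) (Γ := Stk.letters B) (n := n) (k := .w)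
      (c := fun a => seq (push .inp a) (push .z a))
      (fun p q => { inp := p.reverse, w := q, z := p.reverse, kb := kb })
      (fun _ _ => rfl) (W D).reverse (by simp; omega) (fun p b q _ => by
        rw [List.reverse_append]
        exact runs_seq rfl rfl)
    rw [List.reverse_reverse, ← List.append_nil (W D).reverse, ← List.map_id (W D)] at this
    rw [List.map_id] at this
    convert! this using 1
    change Mem.mk _ _ _ _ _ _ _ _ _ _ _ _ _ _ _ _ = Mem.mk _ _ _ _ _ _ _ _ _ _ _ _ _ _ _ _
    rw [List.map_id]
    rfl
  obtain ⟨D', acc, hacc, hL⟩ := runs_scan hev c (W D) [] D kb 0 (by simp; omega)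
  have hk := (hits_le e₀ c F (keys (W D) []) D).trans (keys_length_le (W D) [])
  generalize hits e₀ c F (keys (W D) []) D = x at *
  refine runs_seq ⟨_, by omega, hL⟩ ?_
  refine runs_seq rfl ?_
  refine runs_seq (runs_table hp hh { inp := W D', x := acc, kb := kb } x (by omega)) ?_
  have hx := hhn x (by omega)
  refine runs_seq (runs_compare { inp := W D', x := acc } (h x) kb hx hkb) ?_
  have hz := foldl_half_eq_zero kb (h x)
  have hle := foldl_half_le kb (h x)
  generalize kb.foldl (fun x b => (x - b.toNat + 1) / 2) (h x) = y at *
  have hclear : ∀ y, y ≤ n → Runs n (clearAll Stk.all)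
      { inp := W D', x := acc, u := List.replicate y true : Mem B } {} := by
    intro y hy
    refine runs_clearAll _ (fun k => ?_) (fun k _ => by cases k <;> rfl)
      (fun k hk => absurd k.mem_all hk)
    have h1 := hN D'
    simp only [List.length_nil] at hacc
    cases k
    case inp => change (W D').length ≤ n; omega
    case x => change acc.length ≤ n; omega
    case u => change (List.replicate y true).length ≤ n; simpa
    all_goals exact Nat.zero_le _
  cases y with
  | zero =>
    rw [decide_eq_true (hz.1 rfl)]
    exact runs_pop_nil rfl (runs_seq (hclear 0 (by omega)) rfl)
  | succ y =>
    rw [decide_eq_false (mt hz.2 (by omega))]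
    exact runs_pop (a := true) (l := List.replicate y true) rfl
      (runs_seq (hclear y (by omega)) rfl)

theorem runs_decideSize {ev : Cmd (Stk.letters B)} {e₀ : Bool} {N : ℕ}
    {W : (ℕ → Bool) → List (Letter B)} {F : (ℕ → Bool) → Bool} (hev : Evaluates n ev e₀ N W F)
    {h : Bool → ℕ → ℕ} {a p q : Bool → ℕ} (hp : ∀ c, 0 < p c)
    (hh : ∀ c x, a c ≤ x → h c (x + p c) = h c x + q c)
    (k : ℕ) (hN : ∀ D, (W D).length = N) (hk : (encodeNumber B k).length ≤ n)
    (hn : 2 * N < n) (hhn : ∀ c, ∀ x ≤ N, h c x ≤ n) :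
    Runs n (decideSize ev h a p q)
      { inp := encodeNumber B k ++ W (fun _ => false) : Mem B }
      { ans := [decide (h (F fun _ => e₀) (hits e₀ (F fun _ => e₀) F
        (keys (W fun _ => false) []) fun _ => false) ≤ k)] } := by
  have hk' : (Computability.encodeNat k).length < n := by
    simpa [encodeNumber] using hk
  refine runs_seq (s₁ := { inp := W fun _ => false, t := natKey k }) ?_ ?_
  · rw [encodeNumber, List.append_assoc]
    refine runs_loop_until (S := Mem B) (Γ := Stk.letters B) (k := .inp)
      (fun p q => { inp := q, t := (p.filterMap Letter.bit?).reverse }) (fun _ _ => rfl)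
      ((Computability.encodeNat k).map Letter.bit) (W fun _ => false) .sep (by simpa using hk')
      (fun a ha => ?_) rfl (fun p a q hp => ?_) ?_
    · obtain ⟨b, -, rfl⟩ := List.mem_map.1 ha
      rfl
    · obtain ⟨b, -, rfl⟩ : ∃ b, b ∈ Computability.encodeNat k ∧ Letter.bit b = a :=
        List.mem_map.1 (by rw [← hp]; simp)
      simp only [List.filterMap_append, List.reverse_append]
      exact rfl
    · rw [Letter.filterMap_bit?]
      exact rfl
  refine runs_seq (s₁ := { inp := W fun _ => false, kb := Computability.encodeNat k }) ?_ ?_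
  · have := runs_move (n := n) (S := Mem B) (p := .t) (q := .kb) (by decide) id
      (s := { inp := W fun _ => false, t := natKey k }) (by
        change (natKey k).length ≤ n; simp [natKey]; omega)
    convert! this using 1
    have : ((natKey k).map id).reverse ++ [] = Computability.encodeNat k := by simp [natKey]
    rw [← this]
    exact rfl
  -- The first evaluation uses the key `[false]`: it yields the value at the constant assignment and
  -- marks nothing.
  have hpr : ∀ D, probe e₀ [false] D = fun _ => e₀ := fun D =>
    probe_of_forall fun y hy => absurd hy (natKey_ne_zero y)
  have hmk : ∀ D, mark [false] D = D := fun D => by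
    funext y
    simp [mark, natKey_ne_zero]
  refine runs_seq rfl ?_
  have hr := hev (fun _ => false) [] (Computability.encodeNat k) [] [false] (by simp; omega)
  rw [hpr, hmk] at hr
  refine runs_seq hr ?_
  refine runs_pop (a := F fun _ => e₀) (l := []) rfl ?_
  have := runs_decideRest hev (hp (F fun _ => e₀)) (hh (F fun _ => e₀)) (F fun _ => e₀)
    (fun _ => false) (Computability.encodeNat k) hN hk'.le hn (hhn _)
  rw [bitsValue_encodeNat] at this
  exact this

end Cmd

/-! ### Functions that are linear on residue classes, up to finitely many exceptions -/

/-- Along the class of `m`, the excess p·N + C − q·m is a natural number by `hL` and does not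
increase by `hU`. From the point where it attains its minimum it is constant, and this is the
claimed recursion. -/
theorem exists_quasilinear_class {N : ℕ → ℕ} {R : ℕ → Prop} {p q C : ℕ} (hp : 0 < p)
    (hR : ∀ m, 2 ≤ m → R m → R (m + p)) (hU : ∀ m, 2 ≤ m → R m → N (m + p) ≤ N m + q)
    (hL : ∀ m, R m → q * m ≤ p * N m + C) {m : ℕ} (hm : 2 ≤ m) (hRm : R m) :
    ∃ a, m ≤ a ∧ ∀ j, a ≤ m + p * j →
      R (m + p * j) ∧ N (m + p * j + p) = N (m + p * j) + q := by
  have hRj : ∀ j, R (m + p * j) := fun j => by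
    induction j with
    | zero => exact hRm
    | succ j ih =>
      rw [Nat.mul_succ, ← add_assoc]
      exact hR _ (hm.trans (Nat.le_add_right _ _)) ih
  have hUj : ∀ j, N (m + p * j + p) ≤ N (m + p * j) + q :=
    fun j => hU _ (hm.trans (Nat.le_add_right _ _)) (hRj j)
  let g : ℕ → ℕ := fun j => p * N (m + p * j) + C - q * (m + p * j)
  have hg : ∀ j, (g j : ℤ) = p * N (m + p * j) + C - q * (m + p * j) := fun j => by
    have := hL _ (hRj j)
    simp only [g]
    push_cast [Nat.cast_sub this]
    ring
  have hstep : ∀ j, (g (j + 1) : ℤ) =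
      g j + p * ((N (m + p * j + p) : ℤ) - N (m + p * j) - q) := by
    intro j
    rw [hg, hg, show m + p * (j + 1) = m + p * j + p by ring]
    push_cast
    ring
  have hanti : Antitone g := antitone_nat_of_succ_le fun j => by
    have h1 := hstep j
    have h2 := hUj j
    have h3 : (p : ℤ) * ((N (m + p * j + p) : ℤ) - N (m + p * j) - q) ≤ 0 :=
      mul_nonpos_of_nonneg_of_nonpos (by positivity) (by zify at h2; linarith)
    omega
  obtain ⟨j₀, hj₀⟩ : ∃ j₀, ∀ j, g j₀ ≤ g j := by
    obtain ⟨j₀, hj₀⟩ := Nat.sInf_mem (Set.range_nonempty g)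
    exact ⟨j₀, fun j => hj₀ ▸ Nat.sInf_le ⟨j, rfl⟩⟩
  refine ⟨m + p * j₀, Nat.le_add_right _ _, fun j hj => ⟨hRj j, ?_⟩⟩
  have hle : j₀ ≤ j := Nat.le_of_mul_le_mul_left (Nat.le_of_add_le_add_left hj) hp
  have h1 := hanti hle
  have h2 := hj₀ (j + 1)
  have h3 := hstep j
  have h4 := hUj j
  by_contra hne
  have h5 : (p : ℤ) * ((N (m + p * j + p) : ℤ) - N (m + p * j) - q) < 0 :=
    mul_neg_of_pos_of_neg (by exact_mod_cast hp) (by zify at h4 hne; omega)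
  omega

/-- A size that grows linearly under steps of length `p`, up to a constant, is a quasi-linear
function from some point on. -/
theorem exists_quasilinear {P : ℕ → ℕ → Prop} (hP : ∀ m k l, k ≤ l → P m k → P m l)
    {p q C : ℕ} (hp : 0 < p) (hU : ∀ m k, 2 ≤ m → P m k → P (m + p) (k + q))
    (hL : ∀ m k, P m k → q * m ≤ p * k + C) :
    ∃ (h : ℕ → ℕ) (a K : ℕ), (∀ x, a ≤ x → h (x + p) = h x + q) ∧ (∀ x, h x ≤ K * (x + 1)) ∧
      ∀ m, (∃ k, P m k) → ∀ k, P m k ↔ h m ≤ k := by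
  classical
  let R : ℕ → Prop := fun m => ∃ k, P m k
  let N : ℕ → ℕ := fun m => sInf {k | P m k}
  have hN : ∀ m, R m → P m (N m) := fun m hm => Nat.sInf_mem (s := {k | P m k}) hm
  have hN' : ∀ m k, P m k → N m ≤ k := fun m k hk => Nat.sInf_le hk
  -- Where no size is attained the value of `h` is immaterial; the one chosen satisfies the
  -- recursion.
  let h : ℕ → ℕ := fun m => if R m then N m else q * (m / p)
  have hclass : ∀ r, ∃ a, ∀ x, a ≤ x → x % p = r → h (x + p) = h x + q := by
    intro r
    have hRp : ∀ m, 2 ≤ m → R m → R (m + p) := fun m hm ⟨k, hk⟩ => ⟨_, hU m k hm hk⟩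
    by_cases hr : ∃ m, 2 ≤ m ∧ m % p = r ∧ R m
    · obtain ⟨m, hm, rfl, hRm⟩ := hr
      obtain ⟨a, hma, ha⟩ := exists_quasilinear_class (N := N) (R := R) (q := q) (C := C) hp hRp
        (fun m hm hRm => hN' _ _ (hU m _ hm (hN m hRm))) (fun m hRm => hL _ _ (hN m hRm)) hm hRm
      refine ⟨a, fun x hx hxm => ?_⟩
      obtain ⟨j, rfl⟩ : ∃ j, x = m + p * j := by
        obtain ⟨j, hj⟩ := (Nat.modEq_iff_dvd' (hma.trans hx)).1 (show m ≡ x [MOD p] from hxm.symm)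
        exact ⟨j, by omega⟩
      obtain ⟨h1, h2⟩ := ha j hx
      have h3 := hRp _ (by omega) h1
      simp only [h, if_pos h1, if_pos h3, h2]
    · push Not at hr
      refine ⟨2, fun x hx hxr => ?_⟩
      have h1 := hr x hx hxr
      have h2 := hr (x + p) (by omega) (by simpa using hxr)
      simp only [h, if_neg h1, if_neg h2, Nat.add_div_right _ hp, Nat.mul_succ]
  choose a ha using hclass
  -- The sum of the thresholds of all residue classes dominates each of them.
  have hrec : ∀ x, ∑ r ∈ Finset.range p, a r ≤ x → h (x + p) = h x + q := fun x hx =>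
    ha (x % p) x ((Finset.single_le_sum (f := a) (fun _ _ => Nat.zero_le _)
      (Finset.mem_range.2 (Nat.mod_lt x hp))).trans hx) rfl
  generalize ∑ r ∈ Finset.range p, a r = A at hrec
  -- With this `K`, the sum bounds `h` below `A + p`, and the summand `q` pays for every later step
  -- of length `p`.
  refine ⟨h, A, ∑ x ∈ Finset.range (A + p), h x + q, hrec, fun x => ?_, fun m hm k => ?_⟩
  · induction x using Nat.strong_induction_on with
    | _ x ih =>
      by_cases hx : x < A + p
      · have := Finset.single_le_sum (f := h) (fun _ _ => Nat.zero_le _) (Finset.mem_range.2 hx)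
        nlinarith
      · obtain ⟨y, rfl⟩ := Nat.exists_eq_add_of_le' (show p ≤ x by omega)
        have := ih y (by omega)
        rw [hrec y (by omega)]
        have hK := Nat.le_mul_of_pos_right (∑ x ∈ Finset.range (A + p), h x + q) hp
        rw [show y + p + 1 = y + 1 + p by omega, Nat.mul_add]
        omega
  · simp only [h, if_pos (show R m from hm)]
    exact ⟨hN' m k, fun hk => hP m _ _ hk (hN m hm)⟩

/-! ### Profiles -/

section Profile

variable {V : Type*} [CommMonoid V] (val : Bool ≃ V) {ι : Type*}

/-- The Boolean value that is neutral for the multiplication of `V`. -/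
def neutralBit : Bool := val.symm 1

/-- The element of `V` that is not `1`. -/
def antiOne : V := val (!neutralBit val)

@[simp]
theorem val_neutralBit : val (neutralBit val) = 1 := by simp [neutralBit]

theorem eq_one_or_eq_antiOne (v : V) : v = 1 ∨ v = antiOne val := by
  obtain ⟨b, rfl⟩ := val.surjective v
  rw [antiOne, ← val_neutralBit val]
  by_cases h : b = neutralBit val
  · exact Or.inl (by rw [h])
  · exact Or.inr (by rw [Bool.eq_not.2 h])

/-- The condition excludes an absorbing element. The remaining elements have square 1 and are closed
under multiplication. -/
theorem mul_self_of_ne {a : V} (h : a * antiOne val ≠ a) : a * a = 1 := by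
  rcases eq_one_or_eq_antiOne val a with rfl | rfl
  · exact mul_one 1
  · exact (eq_one_or_eq_antiOne val _).resolve_right h

theorem mul_antiOne_ne {a b : V} (ha : a * antiOne val ≠ a) (hb : b * antiOne val ≠ b) :
    a * b * antiOne val ≠ a * b := by
  intro h
  apply hb
  have := congrArg (a * ·) h
  simpa [← mul_assoc, mul_self_of_ne val ha] using this

/-- `F` is the product of the variables in `T`, multiplied by `c`, and really depends on them. -/
def HasProfile (F : (ι → Bool) → Bool) (c : V) (T : Finset ι) : Prop :=
  (∀ α, val (F α) = c * ∏ x ∈ T, val (α x)) ∧ (T = ∅ ∨ c * antiOne val ≠ c)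

/-- `G` is a product of variables and a constant. -/
def IsMonomial (G : (ι → Bool) → V) : Prop :=
  ∃ (c : V) (s : Multiset ι), ∀ α, G α = c * (s.map fun x => val (α x)).prod

variable {val}

theorem IsMonomial.const (c : V) : IsMonomial val (fun _ : ι → Bool => c) :=
  ⟨c, 0, by simp⟩

theorem IsMonomial.var (x : ι) : IsMonomial val (fun α : ι → Bool => val (α x)) :=
  ⟨1, {x}, by simp⟩

theorem IsMonomial.mul {G H : (ι → Bool) → V} (hG : IsMonomial val G) (hH : IsMonomial val H) :
    IsMonomial val (fun α => G α * H α) := by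
  obtain ⟨c, s, hG⟩ := hG
  obtain ⟨d, t, hH⟩ := hH
  exact ⟨c * d, s + t, fun α => by simp only [hG, hH, Multiset.map_add, Multiset.prod_add,
    mul_mul_mul_comm]⟩

theorem IsMonomial.prod {κ : Type*} (S : Finset κ) {G : κ → (ι → Bool) → V}
    (h : ∀ i ∈ S, IsMonomial val (G i)) : IsMonomial val (fun α => ∏ i ∈ S, G i α) := by
  classical
  induction S using Finset.induction_on with
  | empty => exact IsMonomial.const 1
  | insert i S hi ih =>
    simp only [Finset.prod_insert hi]
    exact (h i (Finset.mem_insert_self _ _)).mul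
      (ih fun j hj => h j (Finset.mem_insert_of_mem hj))

/-- An absorbing coefficient makes the function constant. Otherwise a power of a variable is either
trivial or equal to the variable, according to the power of `antiOne`: all variables survive for
conjunctions, those of odd multiplicity for parity. -/
theorem IsMonomial.exists_hasProfile {F : (ι → Bool) → Bool}
    (h : IsMonomial val (fun α => val (F α))) : ∃ c T, HasProfile val F c T := by
  classical
  obtain ⟨c, s, h⟩ := h
  change ∀ α, val (F α) = _ at h
  by_cases hc : c * antiOne val = c
  · refine ⟨c, ∅, fun α => ?_, Or.inl rfl⟩
    rw [h, Finset.prod_empty, mul_one]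
    rcases eq_one_or_eq_antiOne val (s.map fun x => val (α x)).prod with h1 | h1
    · rw [h1, mul_one]
    · rw [h1, hc]
  · refine ⟨c, s.toFinset.filter fun x => antiOne val ^ s.count x ≠ 1, fun α => ?_, Or.inr hc⟩
    rw [h, Finset.prod_multiset_map_count, Finset.prod_filter]
    congr 1
    refine Finset.prod_congr rfl fun x _ => ?_
    by_cases hx : antiOne val ^ s.count x = 1
    · rw [if_neg (not_not.2 hx)]
      rcases eq_one_or_eq_antiOne val (val (α x)) with h1 | h1 <;> simp [h1, hx]
    · rw [if_pos hx]
      rcases eq_one_or_eq_antiOne val (val (α x)) with h1 | h1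
      · rw [h1, one_pow]
      · rw [h1]
        exact (eq_one_or_eq_antiOne val _).resolve_left hx

namespace HasProfile

variable {F : (ι → Bool) → Bool} {c : V} {T : Finset ι}

theorem val_const (h : HasProfile val F c T) : val (F fun _ => neutralBit val) = c := by
  simp [h.1]

/-- At the neutral assignment the product is trivial, and flipping y multiplies the value by
`antiOne` exactly if y occurs. The second clause of `HasProfile` makes this factor visible. So a
profile can be found by evaluations alone. -/
theorem mem_iff [DecidableEq ι] (h : HasProfile val F c T) (y : ι) :
    y ∈ T ↔ F (Function.update (fun _ => neutralBit val) y (!neutralBit val)) ≠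
      F fun _ => neutralBit val := by
  rw [← val.injective.ne_iff, h.val_const, h.1]
  have hprod : ∏ x ∈ T, val (Function.update (fun _ => neutralBit val) y (!neutralBit val) x) =
      if y ∈ T then antiOne val else 1 := by
    rw [← Finset.prod_ite_eq' T y fun _ => antiOne val]
    refine Finset.prod_congr rfl fun x _ => ?_
    by_cases hx : x = y
    · subst hx; simp [antiOne]
    · simp [hx]
  rw [hprod]
  by_cases hy : y ∈ T
  · simp only [hy, if_true, true_iff]
    exact h.2.resolve_left (Finset.ne_empty_of_mem hy)
  · simp [hy]

theorem subset_of_dependsOn (h : HasProfile val F c T) {R : Set ι} (hR : DependsOn F R) :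
    (T : Set ι) ⊆ R := by
  classical
  intro y hy
  by_contra hyR
  refine (h.mem_iff y).1 hy (hR fun x hx => Function.update_of_ne ?_ _ _)
  rintro rfl
  exact hyR hx

theorem dependsOn (h : HasProfile val F c T) : DependsOn F (T : Set ι) := by
  intro α β hαβ
  apply val.injective
  rw [h.1, h.1]
  congr 1
  exact Finset.prod_congr rfl fun x hx => by rw [hαβ x hx]

theorem funext {G : (ι → Bool) → Bool} (h : HasProfile val F c T) (h' : HasProfile val G c T)
    (α : ι → Bool) : F α = G α :=
  val.injective ((h.1 α).trans (h'.1 α).symm)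

theorem congr {G : (ι → Bool) → Bool} (h : HasProfile val F c T) (h' : ∀ α, F α = G α) :
    HasProfile val G c T :=
  (_root_.funext h' : F = G) ▸ h

/-- Any bijection from `T` to `U` serves, since variables outside `T` do not matter. This is why
only the number of essential variables influences the minimal size. -/
theorem exists_rename (h : HasProfile val F c T) {U : Finset ι} (hTU : T.card = U.card) :
    ∃ ρ : ι → ι, HasProfile val (fun α => F (α ∘ ρ)) c U := by
  classical
  let e := Finset.equivOfCardEq hTU
  let ρ : ι → ι := fun x => if hx : x ∈ T then e ⟨x, hx⟩ else x
  have hρ : ∀ x (hx : x ∈ T), ρ x = e ⟨x, hx⟩ := fun x hx => dif_pos hx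
  refine ⟨ρ, fun α => ?_, h.2.imp_left fun hT => ?_⟩
  · rw [h.1]
    congr 1
    refine Finset.prod_bij (fun x _ => ρ x) (fun x hx => ?_) (fun x hx y hy hxy => ?_)
      (fun y hy => ?_) (fun _ _ => rfl)
    · rw [hρ x hx]; exact (e ⟨x, hx⟩).2
    · rw [hρ x hx, hρ y hy] at hxy
      simpa using e.injective (Subtype.ext hxy)
    · refine ⟨e.symm ⟨y, hy⟩, (e.symm ⟨y, hy⟩).2, ?_⟩
      rw [hρ _ (e.symm ⟨y, hy⟩).2]
      simp
  · rw [hT, Finset.card_empty] at hTU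
    exact Finset.card_eq_zero.1 hTU.symm

/-- The profile of a function in which one of the arguments is a function with nonempty profile
and the others are new variables. -/
theorem comp [DecidableEq ι] {κ : Type*} [DecidableEq κ] {f : (κ → Bool) → Bool} {d : V}
    {S : Finset κ} (hf : HasProfile val f d S) (h : HasProfile val F c T) {i₀ : κ} (hi₀ : i₀ ∈ S)
    (hT : T.Nonempty) {y : κ → ι} (hy : Set.InjOn y (S.erase i₀)) (hyT : ∀ i, y i ∉ T)
    {G : (ι → Bool) → κ → Bool} (hG₀ : ∀ α, G α i₀ = F α)
    (hG : ∀ i ∈ S.erase i₀, ∀ α, G α i = α (y i)) :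
    HasProfile val (fun α => f (G α)) (d * c) (T ∪ (S.erase i₀).image y) := by
  refine ⟨fun α => ?_, Or.inr (mul_antiOne_ne val (hf.2.resolve_left ?_)
    (h.2.resolve_left hT.ne_empty))⟩
  · rw [hf.1, ← Finset.mul_prod_erase _ _ hi₀, hG₀, h.1,
      Finset.prod_congr rfl fun i hi => congrArg val (hG i hi α), Finset.prod_union,
      Finset.prod_image hy]
    · simp only [mul_assoc]
    · rw [Finset.disjoint_right]
      intro x hx
      obtain ⟨i, -, rfl⟩ := Finset.mem_image.1 hx
      exact hyT i
  · exact Finset.ne_empty_of_mem hi₀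

end HasProfile

/-! ### Minimal sizes -/

variable (val) in
/-- Expressions with at least two essential variables can be extended by `p` further essential
variables at the cost of `q`, and up to a constant nothing is cheaper than that. -/
def Grows {X : Type*} (ev : X → (ℕ → Bool) → Bool) (size : X → ℕ) : Prop :=
  ∃ p q C, 0 < p ∧
    (∀ ψ c T, HasProfile val (ev ψ) c T → 2 ≤ T.card →
      ∃ ψ' T', HasProfile val (ev ψ') c T' ∧ T'.card = T.card + p ∧ size ψ' ≤ size ψ + q) ∧
    ∀ ψ c T, HasProfile val (ev ψ) c T → q * T.card ≤ p * size ψ + C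

theorem Grows.of_card_le_one {X : Type*} {ev : X → (ℕ → Bool) → Bool} {size : X → ℕ}
    (h : ∀ ψ c T, HasProfile val (ev ψ) c T → T.card ≤ 1) : Grows val ev size :=
  ⟨1, 0, 0, Nat.one_pos, fun ψ c T hψ hT => absurd (h ψ c T hψ) (by omega), by simp⟩

/-- The extension of an expression by a function symbol at the top, used twice. -/
theorem Grows.of_plug {X : Type*} {ev : X → (ℕ → Bool) → Bool} {size : X → ℕ} {κ : Type*}
    {f : (κ → Bool) → Bool} {d : V} {S : Finset κ} (hf : HasProfile val f d S) (hS : 2 ≤ S.card)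
    {i₀ : κ} (hi₀ : i₀ ∈ S) (w C : ℕ)
    (hplug : ∀ ψ c T, HasProfile val (ev ψ) c T → 2 ≤ T.card → ∀ y : κ → ℕ,
      ∃ (ψ' : X) (G : (ℕ → Bool) → κ → Bool), size ψ' ≤ size ψ + w ∧ (∀ α, ev ψ' α = f (G α)) ∧ (∀ α, G α i₀ = ev ψ α) ∧
        ∀ i ∈ S, i ≠ i₀ → ∀ α, G α i = α (y i))
    (hL : ∀ ψ c T, HasProfile val (ev ψ) c T →
      2 * w * T.card ≤ 2 * (S.card - 1) * size ψ + C) : Grows val ev size := by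
  classical
  have hstep : ∀ ψ c T, HasProfile val (ev ψ) c T → 2 ≤ T.card →
      ∃ ψ' T', HasProfile val (ev ψ') (d * c) T' ∧ T'.card = T.card + (S.card - 1) ∧
        size ψ' ≤ size ψ + w := by
    intro ψ c T hψ hT
    let e := (S.erase i₀).equivFin
    -- Fresh variables, beyond all those in `T` and distinct for distinct essential arguments.
    let y : κ → ℕ := fun i => if hi : i ∈ S.erase i₀ then T.sup id + 1 + e ⟨i, hi⟩
      else T.sup id + 1
    have hyT : ∀ i, y i ∉ T := fun i hi => by
      have h1 : y i ≤ T.sup id := Finset.le_sup (f := id) hi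
      have h2 : T.sup id + 1 ≤ y i := by
        simp only [y]
        split_ifs <;> omega
      omega
    have hy : Set.InjOn y (S.erase i₀) := fun i hi j hj hij => by
      simp only [y, dif_pos (Finset.mem_coe.1 hi), dif_pos (Finset.mem_coe.1 hj)] at hij
      simpa using e.injective (Fin.ext (Nat.add_left_cancel hij))
    obtain ⟨ψ', G, h1, h2, h3, h4⟩ := hplug ψ c T hψ hT y
    refine ⟨ψ', _, (hf.comp hψ hi₀ (Finset.card_pos.1 (by omega)) hy hyT h3 fun i hi =>
      h4 i (Finset.mem_of_mem_erase hi) (Finset.ne_of_mem_erase hi)).congr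
        fun α => (h2 α).symm, ?_, h1⟩
    rw [Finset.card_union_of_disjoint, Finset.card_image_of_injOn hy, Finset.card_erase_of_mem hi₀]
    rw [Finset.disjoint_right]
    intro x hx
    obtain ⟨i, -, rfl⟩ := Finset.mem_image.1 hx
    exact hyT i
  -- One application of `f` turns the constant `c` into `d * c`, and a second one restores `c`.
  have hd : d * d = 1 := mul_self_of_ne val (hf.2.resolve_left (Finset.ne_empty_of_mem hi₀))
  refine ⟨2 * (S.card - 1), 2 * w, C, by omega, fun ψ c T hψ hT => ?_, hL⟩
  obtain ⟨ψ₁, T₁, h1, h2, h3⟩ := hstep ψ c T hψ hT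
  obtain ⟨ψ₂, T₂, h4, h5, h6⟩ := hstep ψ₁ _ T₁ h1 (by omega)
  rw [← mul_assoc, hd, one_mul] at h4
  exact ⟨ψ₂, T₂, h4, by omega, by omega⟩

/-- The minimal size of an expression that is equivalent to a given one is a quasi-linear function
of the number of variables on which the value depends. -/
theorem exists_threshold {X : Type*} {ev : X → (ℕ → Bool) → Bool} {size : X → ℕ}
    (hren : ∀ φ (ρ : ℕ → ℕ), ∃ ψ, size ψ = size φ ∧ ∀ α, ev ψ α = ev φ (α ∘ ρ))
    (hgrow : Grows val ev size) :
    ∃ (h : Bool → ℕ → ℕ) (a p q : Bool → ℕ) (K : ℕ), (∀ c, 0 < p c) ∧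
      (∀ c x, a c ≤ x → h c (x + p c) = h c x + q c) ∧ (∀ c x, h c x ≤ K * (x + 1)) ∧
      ∀ φ c T, HasProfile val (ev φ) c T → ∀ k, (∃ ψ, size ψ ≤ k ∧ ∀ α, ev φ α = ev ψ α) ↔
        h (ev φ fun _ => neutralBit val) T.card ≤ k := by
  obtain ⟨p, q, C, hp, hU, hL⟩ := hgrow
  have := fun b : Bool => exists_quasilinear (C := C) (q := q)
    (P := fun m k => ∃ ψ T, HasProfile val (ev ψ) (val b) T ∧ T.card = m ∧ size ψ ≤ k)
    (fun m k l hkl ⟨ψ, T, h1, h2, h3⟩ => ⟨ψ, T, h1, h2, h3.trans hkl⟩) hp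
    (fun m k hm ⟨ψ, T, h1, h2, h3⟩ => by
      subst h2
      obtain ⟨ψ', T', h4, h5, h6⟩ := hU ψ _ T h1 hm
      exact ⟨ψ', T', h4, h5, h6.trans (Nat.add_le_add_right h3 q)⟩)
    (fun m k ⟨ψ, T, h1, h2, h3⟩ => by
      subst h2
      exact (hL ψ _ T h1).trans (Nat.add_le_add_right (Nat.mul_le_mul_left p h3) C))
  choose h a K h1 h2 h3 using this
  refine ⟨h, a, fun _ => p, fun _ => q, K true + K false, fun _ => hp, h1, fun c x => ?_, ?_⟩
  · refine (h2 c x).trans (Nat.mul_le_mul_right _ ?_)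
    cases c
    · exact Nat.le_add_left _ _
    · exact Nat.le_add_right _ _
  · intro φ c T hφ k
    have hc : val (ev φ fun _ => neutralBit val) = c := hφ.val_const
    rw [← h3 _ T.card ⟨size φ, φ, T, hc ▸ hφ, rfl, le_rfl⟩, hc]
    constructor
    · rintro ⟨ψ, hψ, he⟩
      exact ⟨ψ, T, hφ.congr he, rfl, hψ⟩
    · rintro ⟨ψ, U, hψ, hU, hk⟩
      -- An expression with the same constant and equally many essential variables becomes
      -- equivalent to `φ` by renaming, at no cost.
      obtain ⟨ρ, hρ⟩ := hψ.exists_rename hU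
      obtain ⟨χ, hχ, he⟩ := hren ψ ρ
      exact ⟨χ, hχ ▸ hk, hφ.funext (hρ.congr fun α => (he α).symm)⟩

end Profile

/-! ### Formulas -/

/-- This is (n − 1)(r' − 1) ≤ (r − 1)(n' − 1) without subtractions on the primed side. For r' ≤ 1
the left side is not positive; otherwise the ratios are cross-multiplied. Here n stands for arities
and r for numbers of essential arguments. -/
theorem mul_add_le_of_ratio_le {n r n' r' : ℕ} (hr : 2 ≤ r) (hrn : r ≤ n) (hn' : 0 < n')
    (h : 2 ≤ r' → ((n : ℚ) - 1) / (r - 1) ≤ (n' - 1) / (r' - 1)) :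
    (n - 1) * r' + (r - 1) ≤ (r - 1) * n' + (n - 1) := by
  obtain ⟨n, rfl⟩ := Nat.exists_eq_add_of_le' (show 1 ≤ n by omega)
  obtain ⟨n', rfl⟩ := Nat.exists_eq_add_of_le' (show 1 ≤ n' by omega)
  obtain ⟨r, rfl⟩ := Nat.exists_eq_add_of_le' (show 1 ≤ r by omega)
  rw [Nat.add_sub_cancel, Nat.add_sub_cancel]
  rcases Nat.lt_or_ge r' 2 with hr' | hr'
  · have : n * r' ≤ n * 1 := Nat.mul_le_mul_left _ (by omega)
    nlinarith [Nat.zero_le (r * n')]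
  · have hm := h hr'
    obtain ⟨s, rfl⟩ := Nat.exists_eq_add_of_le' (show 1 ≤ r' by omega)
    push_cast at hm
    rw [add_sub_cancel_right, add_sub_cancel_right, add_sub_cancel_right,
      add_sub_cancel_right, div_le_div_iff₀ (by norm_cast; omega) (by norm_cast; omega)] at hm
    norm_cast at hm
    nlinarith

section Formula

variable {V : Type*} [CommMonoid V] {val : Bool ≃ V} {B : Finset BoolFun}

namespace BFormula

/-- The variables of a formula. -/
def vars : BFormula B → Finset ℕ
  | var x => {x}
  | app _ args => Finset.univ.biUnion fun i => (args i).vars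

/-- Rename the variables of a formula. -/
def rename (ρ : ℕ → ℕ) : BFormula B → BFormula B
  | var x => var (ρ x)
  | app f args => app f fun i => (args i).rename ρ

theorem eval_rename (ρ : ℕ → ℕ) (φ : BFormula B) (α : ℕ → Bool) :
    (φ.rename ρ).eval α = φ.eval (α ∘ ρ) := by
  induction φ with
  | var x => rfl
  | app f args ih => simp only [rename, eval, ih]

theorem sizeL_rename (ρ : ℕ → ℕ) (φ : BFormula B) : (φ.rename ρ).sizeL = φ.sizeL := by
  induction φ with
  | var x => rfl
  | app f args ih => simp only [rename, sizeL, ih]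

theorem sizeS_rename (ρ : ℕ → ℕ) (φ : BFormula B) : (φ.rename ρ).sizeS = φ.sizeS := by
  induction φ with
  | var x => rfl
  | app f args ih => simp only [rename, sizeS, ih]

theorem card_vars_le (φ : BFormula B) : φ.vars.card ≤ φ.sizeL := by
  induction φ with
  | var x => exact le_rfl
  | app f args ih => exact Finset.card_biUnion_le.trans (Finset.sum_le_sum fun i _ => ih i)

theorem dependsOn_app {f : {f : BoolFun // f ∈ B}} {args : Fin f.1.arity → BFormula B}
    {S : Finset (Fin f.1.arity)} (hS : DependsOn f.1.2 (S : Set (Fin f.1.arity)))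
    {R : Fin f.1.arity → Finset ℕ}
    (h : ∀ i ∈ S, DependsOn (fun α => (args i).eval α) (R i : Set ℕ)) :
    DependsOn (fun α => (app f args).eval α) (S.biUnion R : Set ℕ) := by
  intro α β hαβ
  refine hS fun i hi => h i hi fun x hx => hαβ x ?_
  exact Finset.mem_coe.2 (Finset.mem_biUnion.2 ⟨i, hi, hx⟩)

theorem dependsOn_vars (φ : BFormula B) : DependsOn (fun α => φ.eval α) (φ.vars : Set ℕ) := by
  induction φ with
  | var x => exact fun α β h => h x (by simp [vars])
  | app f args ih =>
    exact dependsOn_app (S := Finset.univ) (fun α β h => congrArg _ (funext fun i => h i (by simp)))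
      fun i _ => ih i

theorem isMonomial (hB : ∀ f ∈ B, ∃ c S, HasProfile val f.2 c S) (φ : BFormula B) :
    IsMonomial val fun α => val (φ.eval α) := by
  induction φ with
  | var x => exact .var x
  | app f args ih =>
    obtain ⟨c, S, h⟩ := hB f.1 f.2
    simp only [eval, h.1]
    exact (IsMonomial.const c).mul (.prod S fun i _ => ih i)

variable {coef : {f : BoolFun // f ∈ B} → V}
  {ess : ∀ f : {f : BoolFun // f ∈ B}, Finset (Fin f.1.arity)}

/-- Only essential arguments are followed, so each symbol replaces one relevant subformula by at
most ρ + 1 of them. -/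
theorem exists_dependsOn_sizeS (hB : ∀ f, HasProfile val f.1.2 (coef f) (ess f)) {ρ : ℕ}
    (hρ : ∀ f, (ess f).card ≤ ρ + 1) (φ : BFormula B) :
    ∃ R : Finset ℕ, DependsOn (fun α => φ.eval α) (R : Set ℕ) ∧ R.card ≤ ρ * φ.sizeS + 1 := by
  induction φ with
  | var x => exact ⟨{x}, fun α β h => h x (by simp), by simp⟩
  | app f args ih =>
    choose R hR hc using ih
    refine ⟨(ess f).biUnion R, dependsOn_app (hB f).dependsOn fun i _ => hR i, ?_⟩
    calc _ ≤ ∑ i ∈ ess f, (R i).card := Finset.card_biUnion_le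
      _ ≤ ∑ i ∈ ess f, (ρ * (args i).sizeS + 1) := Finset.sum_le_sum fun i _ => hc i
      _ = ρ * ∑ i ∈ ess f, (args i).sizeS + (ess f).card := by
        rw [Finset.sum_add_distrib, Finset.mul_sum, Finset.card_eq_sum_ones]
      _ ≤ ρ * ∑ i, (args i).sizeS + (ρ + 1) := Nat.add_le_add (Nat.mul_le_mul_left _
        (Finset.sum_le_sum_of_subset (Finset.subset_univ _))) (hρ f)
      _ = _ := by simp only [sizeS]; ring

theorem sizeL_pos (h : ∀ f ∈ B, 0 < f.arity) (φ : BFormula B) : 0 < φ.sizeL := by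
  induction φ with
  | var x => exact Nat.one_pos
  | app f args ih =>
    exact (ih ⟨0, h f.1 f.2⟩).trans_le
      (Finset.single_le_sum (f := fun i => (args i).sizeL) (fun _ _ => Nat.zero_le _)
        (Finset.mem_univ _))

/-- The inequality reads N(|R| − 1) ≤ ρ(size − 1), and `hρ` is its instance for a single symbol. It
propagates because, without symbols of arity 0, even an inessential argument contains an occurrence
of a variable. -/
theorem exists_dependsOn_sizeL (hB : ∀ f, HasProfile val f.1.2 (coef f) (ess f))
    (h : ∀ f ∈ B, 0 < f.arity) {N ρ : ℕ}
    (hρ : ∀ f, N * (ess f).card + ρ ≤ ρ * f.1.arity + N) (φ : BFormula B) :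
    ∃ R : Finset ℕ, DependsOn (fun α => φ.eval α) (R : Set ℕ) ∧
      N * R.card + ρ ≤ ρ * φ.sizeL + N := by
  induction φ with
  | var x => exact ⟨{x}, fun α β h => h x (by simp), by simp [sizeL, add_comm]⟩
  | app f args ih =>
    choose R hR hc using ih
    refine ⟨(ess f).biUnion R, dependsOn_app (hB f).dependsOn fun i _ => hR i, ?_⟩
    have h1 : N * ((ess f).biUnion R).card + ρ * (ess f).card ≤
        ρ * ∑ i ∈ ess f, (args i).sizeL + N * (ess f).card := by
      have := Finset.sum_le_sum fun i (_ : i ∈ ess f) => hc i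
      rw [Finset.sum_add_distrib, Finset.sum_add_distrib, ← Finset.mul_sum, ← Finset.mul_sum,
        Finset.sum_const, Finset.sum_const, smul_eq_mul, smul_eq_mul] at this
      have h2 := Nat.mul_le_mul_left N (Finset.card_biUnion_le (s := ess f) (t := R))
      rw [mul_comm ρ (ess f).card, mul_comm N (ess f).card]
      omega
    have h2 : ∑ i ∈ ess f, (args i).sizeL + (f.1.arity - (ess f).card) ≤
        ∑ i, (args i).sizeL := by
      rw [← Finset.sum_add_sum_compl (ess f)]
      refine Nat.add_le_add_left ?_ _
      have := Finset.card_nsmul_le_sum (ess f)ᶜ (fun i => (args i).sizeL) 1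
        fun i _ => sizeL_pos h (args i)
      simpa [Finset.card_compl] using this
    have h3 : (ess f).card ≤ f.1.arity := by simpa using Finset.card_le_univ (ess f)
    have h4 := Nat.mul_le_mul_left ρ (show ∑ i ∈ ess f, (args i).sizeL + f.1.arity ≤
      ∑ i, (args i).sizeL + (ess f).card by omega)
    have h5 := hρ f
    rw [Nat.mul_add, Nat.mul_add] at h4
    simp only [sizeL]
    omega

/-- The formula with the symbol `f` at the top, applied to the formula `ψ`, to variables and
to `ζ`. -/
def plug (f : {f : BoolFun // f ∈ B}) (S : Finset (Fin f.1.arity)) (i₀ : Fin f.1.arity)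
    (y : Fin f.1.arity → ℕ) (ζ ψ : BFormula B) : BFormula B :=
  app f fun i => if i = i₀ then ψ else if i ∈ S then var (y i) else ζ

theorem exists_plug {size : BFormula B → ℕ} (f : {f : BoolFun // f ∈ B})
    (S : Finset (Fin f.1.arity)) (i₀ : Fin f.1.arity) (y : Fin f.1.arity → ℕ) (ζ ψ : BFormula B)
    {w : ℕ} (h : size (plug f S i₀ y ζ ψ) ≤ size ψ + w) :
    ∃ (ψ' : BFormula B) (G : (ℕ → Bool) → Fin f.1.arity → Bool), size ψ' ≤ size ψ + w ∧
      (∀ α, ψ'.eval α = f.1.2 (G α)) ∧ (∀ α, G α i₀ = ψ.eval α) ∧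
      ∀ i ∈ S, i ≠ i₀ → ∀ α, G α i = α (y i) :=
  ⟨plug f S i₀ y ζ ψ, _, h, fun α => rfl, fun α => by simp,
    fun i hi hi₀ α => by simp [hi, hi₀, eval]⟩

theorem sizeS_plug (f : {f : BoolFun // f ∈ B}) (S : Finset (Fin f.1.arity)) (i₀ : Fin f.1.arity)
    (y : Fin f.1.arity → ℕ) (ψ : BFormula B) : (plug f S i₀ y (var 0) ψ).sizeS = ψ.sizeS + 1 := by
  simp only [plug, sizeS]
  rw [Finset.sum_eq_single i₀ (fun i _ hi => by rw [if_neg hi]; split_ifs <;> rfl) (by simp),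
    if_pos rfl, add_comm]

theorem sizeL_plug_var (f : {f : BoolFun // f ∈ B}) (S : Finset (Fin f.1.arity))
    (i₀ : Fin f.1.arity) (y : Fin f.1.arity → ℕ) (ψ : BFormula B) :
    (plug f S i₀ y (var 0) ψ).sizeL = ψ.sizeL + (f.1.arity - 1) := by
  simp only [plug, sizeL]
  rw [← Finset.add_sum_erase _ _ (Finset.mem_univ i₀), if_pos rfl, Finset.sum_congr rfl
    (g := fun _ => 1) fun i hi => by
      rw [if_neg (Finset.ne_of_mem_erase hi)]
      split_ifs <;> rfl]
  simp [Finset.card_erase_of_mem]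

theorem sizeL_plug_of_eq_zero (f : {f : BoolFun // f ∈ B}) {S : Finset (Fin f.1.arity)}
    {i₀ : Fin f.1.arity} (hi₀ : i₀ ∈ S) (y : Fin f.1.arity → ℕ) {ζ : BFormula B} (ψ : BFormula B)
    (hζ : ζ.sizeL = 0) : (plug f S i₀ y ζ ψ).sizeL = ψ.sizeL + (S.card - 1) := by
  simp only [plug, sizeL]
  rw [← Finset.add_sum_erase _ _ (Finset.mem_univ i₀), if_pos rfl, Finset.sum_congr rfl
    (g := fun i => if i ∈ S then 1 else 0) fun i hi => by
      rw [if_neg (Finset.ne_of_mem_erase hi)]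
      split_ifs
      exacts [rfl, hζ]]
  rw [Finset.sum_ite_mem, Finset.erase_inter, Finset.univ_inter, ← Finset.card_erase_of_mem hi₀,
    Finset.card_eq_sum_ones]

theorem grows_sizeS (hB : ∀ f, HasProfile val f.1.2 (coef f) (ess f)) :
    Grows val (fun (φ : BFormula B) α => φ.eval α) sizeS := by
  by_cases h : ∃ f, 2 ≤ (ess f).card
  · obtain ⟨f₀, hf₀⟩ := h
    have : Nonempty {f : BoolFun // f ∈ B} := ⟨f₀⟩
    obtain ⟨f, hf⟩ := Finite.exists_max fun f => (ess f).card
    have hf2 := hf₀.trans (hf f₀)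
    obtain ⟨i₀, hi₀⟩ := Finset.card_pos.1 (show 0 < (ess f).card by omega)
    refine .of_plug (hB f) hf2 hi₀ 1 2 (fun ψ c T _ _ y =>
      exists_plug f (ess f) i₀ y (var 0) ψ (sizeS_plug f (ess f) i₀ y ψ).le) fun ψ c T hψ => ?_
    obtain ⟨R, hR, hc⟩ := exists_dependsOn_sizeS hB (ρ := (ess f).card - 1)
      (fun g => (hf g).trans (by omega)) ψ
    have := Finset.card_le_card (Finset.coe_subset.1 (hψ.subset_of_dependsOn hR))
    rw [mul_assoc 2 ((ess f).card - 1)]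
    omega
  · push Not at h
    refine .of_card_le_one fun ψ c T hψ => ?_
    obtain ⟨R, hR, hc⟩ := exists_dependsOn_sizeS hB (ρ := 0) (fun g => Nat.lt_succ_iff.1 (h g)) ψ
    have := Finset.card_le_card (Finset.coe_subset.1 (hψ.subset_of_dependsOn hR))
    omega

/-- With a symbol of arity 0, inessential arguments can be filled at no cost, so a new variable
costs one occurrence, which is optimal. Otherwise they cost one occurrence each, and the best symbol
minimizes (arity − 1)/(essential arguments − 1). -/
theorem grows_sizeL (hB : ∀ f, HasProfile val f.1.2 (coef f) (ess f)) :
    Grows val (fun (φ : BFormula B) α => φ.eval α) sizeL := by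
  by_cases h : ∃ f, 2 ≤ (ess f).card
  · by_cases h0 : ∃ g ∈ B, BoolFun.arity g = 0
    · obtain ⟨f, hf⟩ := h
      obtain ⟨g, hgB, hg⟩ := h0
      let ζ : BFormula B := app ⟨g, hgB⟩ fun _ => var 0
      have hζ : ζ.sizeL = 0 := by
        simp only [ζ, sizeL, Finset.sum_const, Finset.card_univ, Fintype.card_fin]
        rw [hg, zero_smul]
      obtain ⟨i₀, hi₀⟩ := Finset.card_pos.1 (show 0 < (ess f).card by omega)
      refine .of_plug (hB f) hf hi₀ ((ess f).card - 1) 0 (fun ψ c T _ _ y =>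
        exists_plug f (ess f) i₀ y ζ ψ (sizeL_plug_of_eq_zero f hi₀ y ψ hζ).le) fun ψ c T hψ => ?_
      have := Finset.card_le_card (Finset.coe_subset.1 (hψ.subset_of_dependsOn ψ.dependsOn_vars))
      exact Nat.mul_le_mul_left _ (this.trans ψ.card_vars_le)
    · have hpos : ∀ f ∈ B, 0 < f.arity := fun f hf => Nat.pos_of_ne_zero fun h => h0 ⟨f, hf, h⟩
      obtain ⟨f₀, hf₀⟩ := h
      obtain ⟨f, hfm, hf⟩ := Finset.exists_min_image
        (Finset.univ.filter fun f : {f : BoolFun // f ∈ B} => 2 ≤ (ess f).card)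
        (fun f => ((f.1.arity : ℚ) - 1) / ((ess f).card - 1)) ⟨f₀, by simpa using hf₀⟩
      have hf2 : 2 ≤ (ess f).card := by simpa using hfm
      have hle : ∀ f, (ess f).card ≤ f.1.arity := fun f => by
        simpa using Finset.card_le_univ (ess f)
      have hN : ∀ g, (f.1.arity - 1) * (ess g).card + ((ess f).card - 1) ≤
          ((ess f).card - 1) * g.1.arity + (f.1.arity - 1) := by
        intro g
        exact mul_add_le_of_ratio_le hf2 (hle f) (hpos g.1 g.2) fun hg => hf g (by simpa using hg)
      obtain ⟨i₀, hi₀⟩ := Finset.card_pos.1 (show 0 < (ess f).card by omega)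
      refine .of_plug (hB f) hf2 hi₀ (f.1.arity - 1) (2 * (f.1.arity - 1)) (fun ψ c T _ _ y =>
        exists_plug f (ess f) i₀ y (var 0) ψ (sizeL_plug_var f (ess f) i₀ y ψ).le)
        fun ψ c T hψ => ?_
      obtain ⟨R, hR, hc⟩ := exists_dependsOn_sizeL hB hpos (N := f.1.arity - 1)
        (ρ := (ess f).card - 1) hN ψ
      have := Nat.mul_le_mul_left (f.1.arity - 1)
        (Finset.card_le_card (Finset.coe_subset.1 (hψ.subset_of_dependsOn hR)))
      rw [mul_assoc, mul_assoc]
      omega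
  · push Not at h
    refine .of_card_le_one fun ψ c T hψ => ?_
    obtain ⟨R, hR, hc⟩ := exists_dependsOn_sizeS hB (ρ := 0) (fun g => Nat.lt_succ_iff.1 (h g)) ψ
    have := Finset.card_le_card (Finset.coe_subset.1 (hψ.subset_of_dependsOn hR))
    omega

end BFormula

/-! ### Circuits -/

namespace Wire

/-- The variable of a wire, if it has one. -/
def vars {m : ℕ} : Wire m → Finset ℕ
  | var x => {x}
  | gate _ => ∅

/-- Rename the variable of a wire. -/
def rename (ρ : ℕ → ℕ) {m : ℕ} : Wire m → Wire m
  | var x => var (ρ x)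
  | gate j => gate j

theorem eval_rename (ρ : ℕ → ℕ) {m : ℕ} (w : Wire m) (α : ℕ → Bool) (v : Fin m → Bool) :
    (w.rename ρ).eval α v = w.eval (α ∘ ρ) v := by
  cases w <;> rfl

theorem varCount_rename (ρ : ℕ → ℕ) {m : ℕ} (w : Wire m) :
    (w.rename ρ).varCount = w.varCount := by
  cases w <;> rfl

theorem card_vars {m : ℕ} (w : Wire m) : w.vars.card = w.varCount := by
  cases w <;> rfl

theorem eval_congr {m : ℕ} (w : Wire m) {α β : ℕ → Bool} {u v : Fin m → Bool}
    (h : ∀ x ∈ w.vars, α x = β x) (h' : ∀ j, u j = v j) : w.eval α u = w.eval β v := by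
  cases w with
  | var x => exact h x (by simp [vars])
  | gate j => exact h' j

end Wire

namespace GateSeq

/-- The variables that feed the gates. -/
def vars : {m : ℕ} → GateSeq B m → Finset ℕ
  | _, nil => ∅
  | _, snoc G _ args => G.vars ∪ Finset.univ.biUnion fun i => (args i).vars

/-- Rename the variables that feed the gates. -/
def rename (ρ : ℕ → ℕ) : {m : ℕ} → GateSeq B m → GateSeq B m
  | _, nil => nil
  | _, snoc G f args => snoc (G.rename ρ) f fun i => (args i).rename ρ

theorem eval_rename (ρ : ℕ → ℕ) {m : ℕ} (G : GateSeq B m) (α : ℕ → Bool) :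
    (G.rename ρ).eval α = G.eval (α ∘ ρ) := by
  induction G with
  | nil => rfl
  | snoc G f args ih => simp only [rename, eval, ih, Wire.eval_rename]

theorem varCount_rename (ρ : ℕ → ℕ) {m : ℕ} (G : GateSeq B m) :
    (G.rename ρ).varCount = G.varCount := by
  induction G with
  | nil => rfl
  | snoc G f args ih => simp only [rename, varCount, ih, Wire.varCount_rename]

theorem card_vars_le {m : ℕ} (G : GateSeq B m) : G.vars.card ≤ G.varCount := by
  induction G with
  | nil => exact le_rfl
  | snoc G f args ih =>
    refine (Finset.card_union_le _ _).trans (Nat.add_le_add ih ?_)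
    exact Finset.card_biUnion_le.trans (Finset.sum_le_sum fun i _ => (args i).card_vars.le)

theorem eval_congr {m : ℕ} (G : GateSeq B m) {α β : ℕ → Bool} (h : ∀ x ∈ G.vars, α x = β x) :
    G.eval α = G.eval β := by
  induction G with
  | nil => rfl
  | snoc G f args ih =>
    have h1 := ih fun x hx => h x (Finset.mem_union_left _ hx)
    simp only [eval, h1]
    congr 2
    refine congrArg f.1.2 (funext fun i => ?_)
    exact (args i).eval_congr (fun x hx => h x (Finset.mem_union_right _
      (Finset.mem_biUnion.2 ⟨i, Finset.mem_univ i, hx⟩))) fun _ => rfl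

theorem isMonomial (hB : ∀ f ∈ B, ∃ c S, HasProfile val f.2 c S) {m : ℕ} (G : GateSeq B m)
    (w : Wire m) : IsMonomial val fun α => val (w.eval α (G.eval α)) := by
  induction G with
  | nil =>
    cases w with
    | var x => exact .var x
    | gate j => exact j.elim0
  | snoc G f args ih =>
    cases w with
    | var x => exact .var x
    | gate j =>
      refine Fin.lastCases ?_ (fun j => ?_) j
      · obtain ⟨c, S, h⟩ := hB f.1 f.2
        simp only [Wire.eval, eval, Fin.snoc_last, h.1]
        exact (IsMonomial.const c).mul (.prod S fun i _ => ih (args i))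
      · simpa only [Wire.eval, eval, Fin.snoc_castSucc] using ih (.gate j)

end GateSeq

namespace BCircuit

/-- The variables of a circuit. -/
def vars (C : BCircuit B) : Finset ℕ :=
  C.gates.vars ∪ C.out.vars

/-- Rename the variables of a circuit. -/
def rename (ρ : ℕ → ℕ) (C : BCircuit B) : BCircuit B :=
  ⟨C.m, C.gates.rename ρ, C.out.rename ρ⟩

theorem eval_rename (ρ : ℕ → ℕ) (C : BCircuit B) (α : ℕ → Bool) :
    (C.rename ρ).eval α = C.eval (α ∘ ρ) := by
  simp only [eval, rename, Wire.eval_rename, GateSeq.eval_rename]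

theorem sizeL_rename (ρ : ℕ → ℕ) (C : BCircuit B) : (C.rename ρ).sizeL = C.sizeL := by
  simp only [sizeL, rename, Wire.varCount_rename, GateSeq.varCount_rename]

theorem card_vars_le (C : BCircuit B) : C.vars.card ≤ C.sizeL :=
  (Finset.card_union_le _ _).trans (Nat.add_le_add C.gates.card_vars_le C.out.card_vars.le)

theorem dependsOn_vars (C : BCircuit B) : DependsOn (fun α => C.eval α) (C.vars : Set ℕ) :=
  fun _ _ h => C.out.eval_congr (fun x hx => h x (by simp [vars, hx])) fun j =>
    congrFun (C.gates.eval_congr fun x hx => h x (by simp [vars, hx])) j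

end BCircuit

variable {coef : {f : BoolFun // f ∈ B} → V}
  {ess : ∀ f : {f : BoolFun // f ∈ B}, Finset (Fin f.1.arity)}

/-- A set of observed wires is pulled back through the gates, the last one first: if that gate is
observed, it is replaced by its essential inputs, at most ρ + 1 wires. Following a set instead of
one wire counts a shared gate only once. -/
theorem GateSeq.exists_dependsOn (hB : ∀ f, HasProfile val f.1.2 (coef f) (ess f)) {ρ : ℕ}
    (hρ : ∀ f, (ess f).card ≤ ρ + 1) {m : ℕ} (G : GateSeq B m) (W : Finset (Wire m)) :
    ∃ R : Finset ℕ, (∀ w ∈ W, DependsOn (fun α => w.eval α (G.eval α)) (R : Set ℕ)) ∧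
      R.card ≤ ρ * m + W.card := by
  classical
  induction G with
  | nil =>
    refine ⟨W.biUnion Wire.vars, fun w hw α β h => w.eval_congr (fun x hx =>
      h x (Finset.mem_coe.2 (Finset.mem_biUnion.2 ⟨w, hw, hx⟩))) fun j => j.elim0, ?_⟩
    rw [mul_zero, zero_add, Finset.card_eq_sum_ones W]
    refine Finset.card_biUnion_le.trans (Finset.sum_le_sum fun w _ => ?_)
    cases w <;> simp [Wire.vars]
  | @snoc m G f args ih =>
    let g : Wire (m + 1) → Finset (Wire m) := fun w => match w with
      | .var x => {.var x}
      | .gate j => Fin.lastCases (motive := fun _ => Finset (Wire m)) ((ess f).image args)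
          (fun j => {.gate j}) j
    obtain ⟨R, hR, hc⟩ := ih (W.biUnion g)
    refine ⟨R, fun w hw => ?_, hc.trans ?_⟩
    · have hg : ∀ u ∈ g w, DependsOn (fun α => u.eval α (G.eval α)) (R : Set ℕ) := fun u hu =>
        hR u (Finset.mem_biUnion.2 ⟨w, hw, hu⟩)
      cases w with
      | var x => exact hg (.var x) (by simp [g])
      | gate j =>
        revert hg
        refine Fin.lastCases (fun hg => ?_) (fun j hg => ?_) j
        · simp only [Wire.eval, eval, Fin.snoc_last]
          intro α β h
          refine (hB f).dependsOn fun i hi => hg (args i) ?_ h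
          simpa [g] using ⟨i, hi, rfl⟩
        · simp only [Wire.eval, eval, Fin.snoc_castSucc]
          exact hg (.gate j) (by simp [g])
    · have h1 : ∀ w, (g w).card ≤ 1 + if w = .gate (Fin.last m) then ρ else 0 := by
        intro w
        cases w with
        | var x => simp [g]
        | gate j =>
          refine Fin.lastCases ?_ (fun j => ?_) j
          · simpa [g, add_comm] using
              (Finset.card_image_le (s := ess f) (f := args)).trans (hρ f)
          · simp [g]
      have h2 : (W.biUnion g).card ≤ W.card + ρ := by
        refine Finset.card_biUnion_le.trans ((Finset.sum_le_sum fun w _ => h1 w).trans ?_)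
        rw [Finset.sum_add_distrib, ← Finset.card_eq_sum_ones, Finset.sum_ite_eq']
        split_ifs <;> omega
      rw [Nat.mul_succ]
      omega

namespace BCircuit

theorem exists_dependsOn_sizeS (hB : ∀ f, HasProfile val f.1.2 (coef f) (ess f)) {ρ : ℕ}
    (hρ : ∀ f, (ess f).card ≤ ρ + 1) (C : BCircuit B) :
    ∃ R : Finset ℕ, DependsOn (fun α => C.eval α) (R : Set ℕ) ∧ R.card ≤ ρ * C.sizeS + 1 := by
  obtain ⟨R, hR, hc⟩ := C.gates.exists_dependsOn hB hρ {C.out}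
  exact ⟨R, hR _ (Finset.mem_singleton_self _), hc⟩

/-- The circuit with an additional gate, which is fed by the output of `C` and by variables. -/
def plug (f : {f : BoolFun // f ∈ B}) (S : Finset (Fin f.1.arity)) (i₀ : Fin f.1.arity)
    (y : Fin f.1.arity → ℕ) (C : BCircuit B) : BCircuit B :=
  ⟨C.m + 1, C.gates.snoc f fun i => if i = i₀ then C.out else if i ∈ S then .var (y i) else C.out,
    .gate (Fin.last C.m)⟩

theorem exists_plug {size : BCircuit B → ℕ} (f : {f : BoolFun // f ∈ B})
    (S : Finset (Fin f.1.arity)) (i₀ : Fin f.1.arity) (y : Fin f.1.arity → ℕ) (C : BCircuit B)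
    {w : ℕ} (h : size (plug f S i₀ y C) ≤ size C + w) :
    ∃ (C' : BCircuit B) (G : (ℕ → Bool) → Fin f.1.arity → Bool), size C' ≤ size C + w ∧
      (∀ α, C'.eval α = f.1.2 (G α)) ∧ (∀ α, G α i₀ = C.eval α) ∧
      ∀ i ∈ S, i ≠ i₀ → ∀ α, G α i = α (y i) :=
  ⟨plug f S i₀ y C, fun α i => (if i = i₀ then C.out else if i ∈ S then .var (y i)
      else C.out).eval α (C.gates.eval α), h,
    fun α => by simp only [eval, plug, Wire.eval, GateSeq.eval, Fin.snoc_last],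
    fun α => by simp [eval], fun i hi hi₀ α => by simp [hi, hi₀, Wire.eval]⟩

theorem sizeL_plug (f : {f : BoolFun // f ∈ B}) {S : Finset (Fin f.1.arity)}
    {i₀ : Fin f.1.arity} (hi₀ : i₀ ∈ S) (y : Fin f.1.arity → ℕ) (C : BCircuit B)
    (hC : C.out.varCount = 0) : (plug f S i₀ y C).sizeL = C.sizeL + (S.card - 1) := by
  change C.gates.varCount + ∑ i, Wire.varCount (if i = i₀ then C.out else if i ∈ S then
    .var (y i) else C.out) + 0 = C.gates.varCount + C.out.varCount + _
  rw [hC, add_zero, add_zero, ← Finset.add_sum_erase _ _ (Finset.mem_univ i₀), if_pos rfl, hC, zero_add,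
    Finset.sum_congr rfl (g := fun i => if i ∈ S then 1 else 0) fun i hi => by
      rw [if_neg (Finset.ne_of_mem_erase hi)]
      split_ifs
      exacts [rfl, hC]]
  rw [Finset.sum_ite_mem, Finset.erase_inter, Finset.univ_inter, ← Finset.card_erase_of_mem hi₀,
    Finset.card_eq_sum_ones]

theorem grows_sizeS (hB : ∀ f, HasProfile val f.1.2 (coef f) (ess f)) :
    Grows val (fun (C : BCircuit B) α => C.eval α) sizeS := by
  by_cases h : ∃ f, 2 ≤ (ess f).card
  · obtain ⟨f₀, hf₀⟩ := h
    have : Nonempty {f : BoolFun // f ∈ B} := ⟨f₀⟩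
    obtain ⟨f, hf⟩ := Finite.exists_max fun f => (ess f).card
    have hf2 := hf₀.trans (hf f₀)
    obtain ⟨i₀, hi₀⟩ := Finset.card_pos.1 (show 0 < (ess f).card by omega)
    refine .of_plug (hB f) hf2 hi₀ 1 2 (fun ψ c T _ _ y =>
      exists_plug f (ess f) i₀ y ψ le_rfl) fun ψ c T hψ => ?_
    obtain ⟨R, hR, hc⟩ := exists_dependsOn_sizeS hB (ρ := (ess f).card - 1)
      (fun g => (hf g).trans (by omega)) ψ
    have := Finset.card_le_card (Finset.coe_subset.1 (hψ.subset_of_dependsOn hR))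
    rw [mul_assoc 2 ((ess f).card - 1)]
    omega
  · push Not at h
    refine .of_card_le_one fun ψ c T hψ => ?_
    obtain ⟨R, hR, hc⟩ := exists_dependsOn_sizeS hB (ρ := 0) (fun g => Nat.lt_succ_iff.1 (h g)) ψ
    have := Finset.card_le_card (Finset.coe_subset.1 (hψ.subset_of_dependsOn hR))
    omega

/-- With two essential variables the output must be a gate, and the inessential inputs of a new gate
can be fed by it at no cost. So a new variable costs one occurrence, whether or not `B` has symbols
of arity 0. -/
theorem grows_sizeL (hB : ∀ f, HasProfile val f.1.2 (coef f) (ess f)) :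
    Grows val (fun (C : BCircuit B) α => C.eval α) sizeL := by
  by_cases h : ∃ f, 2 ≤ (ess f).card
  · obtain ⟨f, hf⟩ := h
    obtain ⟨i₀, hi₀⟩ := Finset.card_pos.1 (show 0 < (ess f).card by omega)
    refine .of_plug (hB f) hf hi₀ ((ess f).card - 1) 0 (fun ψ c T hψ hT y =>
      exists_plug f (ess f) i₀ y ψ (sizeL_plug f hi₀ y ψ ?_).le) fun ψ c T hψ => ?_
    · obtain ⟨m, G, out⟩ := ψ
      cases out with
      | gate j => rfl
      | var x =>
        have hx : DependsOn (fun α => eval α (⟨m, G, .var x⟩ : BCircuit B))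
            (({x} : Finset ℕ) : Set ℕ) := fun α β h => h x (by simp)
        have := Finset.card_le_card (Finset.coe_subset.1 (hψ.subset_of_dependsOn hx))
        rw [Finset.card_singleton] at this
        omega
    · have := Finset.card_le_card (Finset.coe_subset.1 (hψ.subset_of_dependsOn ψ.dependsOn_vars))
      exact Nat.mul_le_mul_left _ (this.trans ψ.card_vars_le)
  · push Not at h
    refine .of_card_le_one fun ψ c T hψ => ?_
    obtain ⟨R, hR, hc⟩ := exists_dependsOn_sizeS hB (ρ := 0) (fun g => Nat.lt_succ_iff.1 (h g)) ψ
    have := Finset.card_le_card (Finset.coe_subset.1 (hψ.subset_of_dependsOn hR))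
    omega

end BCircuit

end Formula

/-! ### Keys of the variables -/

section Keys

variable {B : Finset BoolFun}

/-- The word consists of complete tokens. -/
def IsClosedWord (u : List (Letter B)) : Prop :=
  ∀ w, keys (u ++ w) [] = keys u [] ++ keys w []

theorem IsClosedWord.append {u v : List (Letter B)} (hu : IsClosedWord u) (hv : IsClosedWord v) :
    IsClosedWord (u ++ v) := fun w => by
  rw [List.append_assoc, hu, hv, hu, List.append_assoc]

theorem IsClosedWord.flatten {L : List (List (Letter B))} (h : ∀ u ∈ L, IsClosedWord u) :
    IsClosedWord L.flatten := by
  induction L with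
  | nil => exact fun w => rfl
  | cons u L ih =>
    exact (h u List.mem_cons_self).append (ih fun v hv => h v (List.mem_cons_of_mem _ hv))

theorem IsClosedWord.mem_keys_flatten {L : List (List (Letter B))} (h : ∀ u ∈ L, IsClosedWord u)
    {u : List (Letter B)} (hu : u ∈ L) {l : List Bool} (hl : l ∈ keys u []) :
    l ∈ keys L.flatten [] := by
  induction L with
  | nil => simp at hu
  | cons v L ih =>
    rw [List.flatten_cons, h v List.mem_cons_self, List.mem_append]
    rcases List.mem_cons.1 hu with rfl | hu
    · exact Or.inl hl
    · exact Or.inr (ih (fun v hv => h v (List.mem_cons_of_mem _ hv)) hu)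

theorem keys_encodeNumber_append (x : ℕ) (w : List (Letter B)) :
    keys (encodeNumber B x ++ w) [] = natKey x :: keys w [] := by
  have : ∀ (l acc : List Bool), keys (l.map Letter.bit ++ [Letter.sep] ++ w) acc =
      (l.reverse ++ acc) :: keys w [] := fun l => by
    induction l with
    | nil => exact fun acc => rfl
    | cons b l ih => exact fun acc => (ih (b :: acc)).trans (by simp)
  rw [encodeNumber, this, List.append_nil, natKey]

theorem isClosedWord_encodeNumber (x : ℕ) : IsClosedWord (encodeNumber B x) := fun w => by
  have := keys_encodeNumber_append (B := B) x []
  rw [List.append_nil] at this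
  rw [keys_encodeNumber_append, this]
  rfl

theorem natKey_mem_keys_encodeNumber (x : ℕ) : natKey x ∈ keys (encodeNumber B x) [] := by
  rw [← List.append_nil (encodeNumber B x), keys_encodeNumber_append]
  exact List.mem_cons_self

theorem BFormula.isClosedWord_encode (φ : BFormula B) : IsClosedWord φ.encode := by
  induction φ with
  | var x => exact isClosedWord_encodeNumber x
  | app f args ih =>
    refine IsClosedWord.flatten (L := List.ofFn fun i => (args i).encode) fun u hu => ?_
    obtain ⟨i, rfl⟩ := (List.mem_ofFn' _ _).1 hu
    exact ih i

theorem BFormula.natKey_mem_keys (φ : BFormula B) {x : ℕ} (hx : x ∈ φ.vars) :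
    natKey x ∈ keys φ.encode [] := by
  induction φ with
  | var y =>
    rw [Finset.mem_singleton.1 hx]
    exact natKey_mem_keys_encodeNumber y
  | app f args ih =>
    obtain ⟨i, -, hi⟩ := Finset.mem_biUnion.1 hx
    refine IsClosedWord.mem_keys_flatten (L := List.ofFn fun i => (args i).encode) (fun u hu => ?_)
      ((List.mem_ofFn' _ _).2 ⟨i, rfl⟩) (ih i hi)
    obtain ⟨j, rfl⟩ := (List.mem_ofFn' _ _).1 hu
    exact (args j).isClosedWord_encode

theorem Wire.isClosedWord_encode {m : ℕ} (w : Wire m) : IsClosedWord (w.encode B) := by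
  cases w with
  | var x => exact isClosedWord_encodeNumber x
  | gate j => exact isClosedWord_encodeNumber (j : ℕ)

theorem Wire.natKey_mem_keys {m : ℕ} (w : Wire m) {x : ℕ} (hx : x ∈ w.vars) :
    natKey x ∈ keys (w.encode B) [] := by
  cases w with
  | var y =>
    rw [Finset.mem_singleton.1 hx]
    exact natKey_mem_keys_encodeNumber y
  | gate j => simp [vars] at hx

theorem GateSeq.isClosedWord_encode {m : ℕ} (G : GateSeq B m) : IsClosedWord G.encode := by
  induction G with
  | nil => exact fun w => rfl
  | snoc G f args ih =>
    refine ih.append (IsClosedWord.flatten (L := List.ofFn fun i => (args i).encode B)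
      fun u hu => ?_)
    obtain ⟨i, rfl⟩ := (List.mem_ofFn' _ _).1 hu
    exact (args i).isClosedWord_encode

theorem GateSeq.natKey_mem_keys {m : ℕ} (G : GateSeq B m) {x : ℕ} (hx : x ∈ G.vars) :
    natKey x ∈ keys G.encode [] := by
  induction G with
  | nil => simp [vars] at hx
  | snoc G f args ih =>
    rw [encode, G.isClosedWord_encode, List.mem_append]
    rcases Finset.mem_union.1 hx with hx | hx
    · exact Or.inl (ih hx)
    · obtain ⟨i, -, hi⟩ := Finset.mem_biUnion.1 hx
      refine Or.inr (IsClosedWord.mem_keys_flatten (L := List.ofFn fun i => (args i).encode B)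
        (fun u hu => ?_) ((List.mem_ofFn' _ _).2 ⟨i, rfl⟩) ((args i).natKey_mem_keys hi))
      obtain ⟨j, rfl⟩ := (List.mem_ofFn' _ _).1 hu
      exact (args j).isClosedWord_encode

theorem BCircuit.natKey_mem_keys (C : BCircuit B) {x : ℕ} (hx : x ∈ C.vars) :
    natKey x ∈ keys C.encode [] := by
  rw [encode, C.gates.isClosedWord_encode, List.mem_append]
  exact (Finset.mem_union.1 hx).imp C.gates.natKey_mem_keys C.out.natKey_mem_keys

end Keys

/-! ### Minimization in polynomial time -/

section Solvable

variable {V : Type*} [CommMonoid V] {val : Bool ≃ V} {B : Finset BoolFun}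

theorem solvableInPolyTime_of_grows {X : Type} {enc : X → List (Letter B)}
    {W : X → (ℕ → Bool) → List (Letter B)} {ev : X → (ℕ → Bool) → Bool} {size : X → ℕ}
    {prog : Cmd (Stk.letters B)} (hW : ∀ φ, W φ (fun _ => false) = enc φ)
    (hlen : ∀ φ D, (W φ D).length = (enc φ).length)
    (hprog : ∀ n φ, Cmd.Evaluates n prog (neutralBit val) (enc φ).length (W φ) (ev φ))
    (hvars : ∀ φ, ∃ R : Finset ℕ, DependsOn (ev φ) (R : Set ℕ) ∧
      ∀ x ∈ R, natKey x ∈ keys (enc φ) [])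
    (hprof : ∀ φ, IsMonomial val fun α => val (ev φ α))
    (hren : ∀ φ (ρ : ℕ → ℕ), ∃ ψ, size ψ = size φ ∧ ∀ α, ev ψ α = ev φ (α ∘ ρ))
    (hgrow : Grows val ev size) :
    SolvableInPolyTime (fun p : X × ℕ => encodeNumber B p.2 ++ enc p.1)
      (fun p => ∃ ψ, size ψ ≤ p.2 ∧ ∀ α, ev p.1 α = ev ψ α) := by
  classical
  obtain ⟨h, a, p, q, K, hp, hh, hK, hmin⟩ := exists_threshold hren hgrow
  refine ⟨fun p => decide (∃ ψ, size ψ ≤ p.2 ∧ ∀ α, ev p.1 α = ev ψ α),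
    fun p => decide_eq_true_iff, ?_⟩
  -- The summand `K` covers the values of `h`, which are at most `K * (x + 1)`; the summand 4 leaves
  -- room for reading `k` and for keys read together with the word.
  refine Cmd.computableInPolyTime (S := Mem B) (Cmd.decideSize prog h a p q) .inp .ans
    (Equiv.refl (Letter B)) (Equiv.refl Bool) _ _ _
    (Polynomial.C (K + 4) * (Polynomial.X + 1)) {} (fun k => by cases k <;> rfl) ?_
  rintro ⟨φ, k⟩
  obtain ⟨c, T, hT⟩ := (hprof φ).exists_hasProfile
  obtain ⟨R, hR, hRk⟩ := hvars φ
  have hhits : hits (neutralBit val) (ev φ fun _ => neutralBit val) (ev φ) (keys (enc φ) [])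
      (fun _ => false) = T.card := by
    rw [hits_eq_card rfl T hT.mem_iff, Finset.filter_true_of_mem]
    exact fun y hy => ⟨rfl, hRk y (hT.subset_of_dependsOn hR hy)⟩
  have hn : (Polynomial.C (K + 4) * (Polynomial.X + 1) : Polynomial ℕ).eval
      (encodeNumber B k ++ enc φ).length =
      (K + 4) * ((encodeNumber B k).length + (enc φ).length + 1) := by simp
  have hr := Cmd.runs_decideSize (n := (Polynomial.C (K + 4) * (Polynomial.X + 1)).eval
    (encodeNumber B k ++ enc φ).length) (hprog _ φ) hp hh k (hlen φ)
    (by rw [hn]; nlinarith) (by rw [hn]; nlinarith) fun c x hx => by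
      rw [hn]
      refine (hK c x).trans (Nat.mul_le_mul ?_ ?_) <;> omega
  rw [hW, hhits] at hr
  have hd : decide (∃ ψ, size ψ ≤ k ∧ ∀ α, ev φ α = ev ψ α) =
      decide (h (ev φ fun _ => neutralBit val) T.card ≤ k) := by
    rw [decide_eq_decide]
    exact hmin φ c T hT k
  change Cmd.Runs _ _ _ ({ ans := [decide (∃ ψ, size ψ ≤ k ∧ ∀ α, ev φ α = ev ψ α)].map id } :
    Mem B)
  rw [hd]
  change Cmd.Runs _ _ ({ inp := (encodeNumber B k ++ enc φ).map id } : Mem B) _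
  rw [List.map_id]
  exact hr

theorem solvableInPolyTime_mee (hB : ∀ f ∈ B, ∃ c S, HasProfile val f.2 c S) :
    SolvableInPolyTime encodeFormulaInstance (MEEFormula (B := B) BFormula.sizeL) ∧
    SolvableInPolyTime encodeFormulaInstance (MEEFormula (B := B) BFormula.sizeS) ∧
    SolvableInPolyTime encodeCircuitInstance (MEECircuit (B := B) BCircuit.sizeL) ∧
    SolvableInPolyTime encodeCircuitInstance (MEECircuit (B := B) BCircuit.sizeS) := by
  choose coef ess h using fun f : {f : BoolFun // f ∈ B} => hB f.1 f.2
  have hF : ∀ size : BFormula B → ℕ, (∀ ρ φ, size (φ.rename ρ) = size φ) →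
      Grows val (fun (φ : BFormula B) α => φ.eval α) size →
      SolvableInPolyTime encodeFormulaInstance (MEEFormula size) := fun size hs hg =>
    solvableInPolyTime_of_grows (prog := Cmd.evalFormula (neutralBit val))
      (fun φ => φ.word_false) (fun φ D => φ.length_word D)
      (fun n φ D z kb m l hn => Cmd.runs_evalFormula _ D z kb m l φ hn)
      (fun φ => ⟨φ.vars, φ.dependsOn_vars, fun x => φ.natKey_mem_keys⟩)
      (fun φ => φ.isMonomial hB) (fun φ ρ => ⟨φ.rename ρ, hs ρ φ, φ.eval_rename ρ⟩) hg
  have hC : ∀ size : BCircuit B → ℕ, (∀ ρ C, size (C.rename ρ) = size C) →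
      Grows val (fun (C : BCircuit B) α => C.eval α) size →
      SolvableInPolyTime encodeCircuitInstance (MEECircuit size) := fun size hs hg =>
    solvableInPolyTime_of_grows (prog := Cmd.evalCircuit (neutralBit val))
      (fun C => C.word_false) (fun C D => C.length_word D)
      (fun n C D z kb m l hn => Cmd.runs_evalCircuit _ D z kb m l C hn)
      (fun C => ⟨C.vars, C.dependsOn_vars, fun x => C.natKey_mem_keys⟩)
      (fun C => C.gates.isMonomial hB C.out)
      (fun C ρ => ⟨C.rename ρ, hs ρ C, C.eval_rename ρ⟩) hg
  exact ⟨hF _ BFormula.sizeL_rename (BFormula.grows_sizeL h),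
    hF _ BFormula.sizeS_rename (BFormula.grows_sizeS h),
    hC _ BCircuit.sizeL_rename (BCircuit.grows_sizeL h),
    hC _ (fun _ _ => rfl) (BCircuit.grows_sizeS h)⟩

end Solvable

/-! ### The three classes of functions -/

theorem Bool.prod_eq_true_iff {κ : Type*} (S : Finset κ) (x : κ → Bool) :
    ∏ i ∈ S, x i = true ↔ ∀ i ∈ S, x i = true := by
  classical
  induction S using Finset.induction_on with
  | empty => simp; rfl
  | insert i S hi ih =>
    rw [Finset.prod_insert hi, Finset.forall_mem_insert, ← ih]
    exact Bool.and_eq_true_iff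

theorem Bool.sum_eq_decide_odd {κ : Type*} (S : Finset κ) (x : κ → Bool) :
    ∑ i ∈ S, x i = decide (Odd (S.filter fun i => x i = true).card) := by
  classical
  induction S using Finset.induction_on with
  | empty => simp; rfl
  | insert i S hi ih =>
    rw [Finset.sum_insert hi, ih, Finset.filter_insert]
    change xor _ _ = _
    cases h : x i
    · simp
    · rw [if_pos rfl, Finset.card_insert_of_notMem (by simp [hi])]
      simp [Nat.odd_add_one, ← Nat.not_even_iff_odd]

theorem BoolFun.IsAnd.exists_hasProfile {f : BoolFun} (h : f.IsAnd) :
    ∃ c S, HasProfile (Equiv.refl Bool) f.2 c S := by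
  refine IsMonomial.exists_hasProfile ?_
  rcases h with ⟨c, h⟩ | ⟨S, h⟩
  · simp only [h]
    exact .const _
  · refine ⟨1, S.val, fun x => ?_⟩
    rw [one_mul]
    refine Bool.eq_iff_iff.2 ((h x).trans ?_)
    exact (Bool.prod_eq_true_iff S x).symm

/-- De Morgan: the negation of a disjunction is the product of the negated arguments. -/
theorem BoolFun.IsOr.exists_hasProfile {f : BoolFun} (h : f.IsOr) :
    ∃ c S, HasProfile Equiv.boolNot f.2 c S := by
  refine IsMonomial.exists_hasProfile ?_
  rcases h with ⟨c, h⟩ | ⟨S, h⟩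
  · simp only [h]
    exact .const _
  · refine ⟨1, S.val, fun x => ?_⟩
    rw [one_mul]
    refine Bool.eq_iff_iff.2 (Iff.trans ?_ (Bool.prod_eq_true_iff S fun i => !x i).symm)
    change (!f.2 x) = true ↔ _
    rw [Bool.not_eq_true', ← Bool.not_eq_true, h]
    simp

theorem BoolFun.IsXor.exists_hasProfile {f : BoolFun} (h : f.IsXor) :
    ∃ c S, HasProfile (Multiplicative.ofAdd (α := Bool)) f.2 c S := by
  refine IsMonomial.exists_hasProfile ?_
  obtain ⟨c, S, h⟩ := h
  refine ⟨Multiplicative.ofAdd c, S.val, fun x => ?_⟩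
  change Multiplicative.ofAdd _ = Multiplicative.ofAdd c * ∏ i ∈ S, Multiplicative.ofAdd (x i)
  rw [← ofAdd_sum, ← ofAdd_add, Bool.sum_eq_decide_odd, h]
  rfl

theorem mainTheorem11 (B : Finset BoolFun)
    (hB : (∀ f ∈ B, f.IsOr) ∨ (∀ f ∈ B, f.IsAnd) ∨ (∀ f ∈ B, f.IsXor)) :
    SolvableInPolyTime encodeFormulaInstance (MEEFormula (B := B) BFormula.sizeL) ∧
    SolvableInPolyTime encodeFormulaInstance (MEEFormula (B := B) BFormula.sizeS) ∧
    SolvableInPolyTime encodeCircuitInstance (MEECircuit (B := B) BCircuit.sizeL) ∧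
    SolvableInPolyTime encodeCircuitInstance (MEECircuit (B := B) BCircuit.sizeS) := by
  rcases hB with hB | hB | hB
  · exact solvableInPolyTime_mee fun f hf => (hB f hf).exists_hasProfile
  · exact solvableInPolyTime_mee fun f hf => (hB f hf).exists_hasProfile
  · exact solvableInPolyTime_mee fun f hf => (hB f hf).exists_hasProfile
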